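/- **Conventions.** Spaces are compactly generated, and limits are formed in compactly generated spaces. Let $d\ge 0$ and let $\theta\colon L\to B\mathrm{O}(d)$ be a tangential structure, i.e. a fibration with path-connected Hausdorff $L$. Write $V_d$ for the universal vector bundle, and $\mathrm{Fr}^\theta(M)=\mathrm{Bun}(TM,\theta^*V_d)$ for the space of $\theta$-framings of a smooth $d$-manifold $M$. Fix a $\theta$-framing $\ell_{\mathbb R^d}$ of $\mathbb{R}^d$ that only depends on the fibre factor of $T\mathbb{R}^d=\mathbb{R}^d\times\mathbb{R}^d$; it restricts to a framing $\ell_{D}$ of the closed disc $D^d$. For a $\theta$-framed $d$-manifold $(M,\ell)$, possibly with boundary, let $\mathrm{Emb}^\theta(r\times D^d,(M,\ell))$ be the space of tuples $(\alpha,t,\gamma)$ of a smooth embedding $\alpha\colon\{1,\dots,r\}\times D^d\hookrightarrow M$ and, for each of the $r$ discs, a Moore path $\gamma$ in $\mathrm{Fr}^\theta(D^d)$, of length $t\ge 0$, from $\ell_{D}$ to $\ell\circ T\alpha$. The operad $E_d^\theta$ has operation spaces $E_d^\theta(r)=\mathrm{Emb}^\theta(r\times D^d,D^d)$, composed by composing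 embeddings and concatenating Moore paths; $\mathbb{E}_d^\theta$ denotes its monad. All bar constructions below are monadic two-sided bar constructions, $|{-}|$ is geometric realisation, and $X/\!\!/G=|B_\bullet(\mathbf 1,G\times{-},X)|$ for a well-pointed topological group $G$ and a $G$-space $X$. **Moduli spaces.** Let $(W,\ell_W)$ be a $\theta$-framed smooth $d$-manifold, possibly with boundary, and fix an open collar of $\partial W$. Let $\mathrm{Diff}_\partial(W)$ be the group of diffeomorphisms of $W$ that fix the collar pointwise, with the $C^\infty$-topology; we assume that it is well-pointed, as the definition of homotopy quotients requires. Let $\mathrm{Fr}^\theta_\partial(W)\subseteq \mathrm{Fr}^\theta(W)$ be the space of $\theta$-framings that agree with $\ell_W$ on the collar, and let $\mathrm{Fr}^\theta_\partial(W,\ell_W)\subseteq\mathrm{Fr}^\theta_\partial(W)$ be the union of those path components that meet the $\mathrm{Diff}_\partial(W)$-orbit of $\ell_W$. Let $\underline{\mathrm{Emb}}^\theta(r\times D^d,W)$ be the space of tuples $(\alpha,t,\gamma,\ell)$ with $\ell\in\mathrm{Fr}^\theta_\partial(W,\ell_W)$ and $(\alpha,t,\gamma)\in\mathrm{Emb}^\theta(r\times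 D^d,(W,\ell))$, on which $\mathrm{Diff}_\partial(W)$ acts by $\varphi\cdot(\alpha,t,\gamma,\ell)=(\varphi\circ\alpha,t,\gamma,\ell\circ T\varphi^{-1})$. For an $E_d^\theta$-algebra $A$, put $$\int_W^\theta A=\bigl|B_\bullet(\mathbb{E}_W^\theta,\mathbb{E}_d^\theta,A)\bigr|,\qquad W^\theta[A]=\bigl|B_\bullet(\underline{\mathbb{E}}_W^\theta/\!\!/\mathrm{Diff}_\partial(W),\mathbb{E}_d^\theta,A)\bigr|,\qquad \mathcal{M}^\theta_\partial(W,\ell_W)=\mathrm{Fr}^\theta_\partial(W,\ell_W)/\!\!/\mathrm{Diff}_\partial(W),$$ where $\mathbb{E}_W^\theta(X)=\coprod_{r\ge0}\mathrm{Emb}^\theta(r\times D^d,(W,\ell_W))\times_{\mathfrak{S}_r}X^r$ and $\underline{\mathbb{E}}_W^\theta(X)=\coprod_{r\ge0}\underline{\mathrm{Emb}}^\theta(r\times D^d,W)\times_{\mathfrak{S}_r}X^r$. **Proposition.** For each $E_d^\theta$-algebra $A$, the sequence $$\int_W^\theta A\xrightarrow{\ \iota\ } W^\theta[A]\xrightarrow{\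 q\ }\mathcal{M}^\theta_\partial(W,\ell_W)$$ is a homotopy fibre sequence. Here, $\iota$ is induced by the inclusion of the framed embeddings with fixed framing $\ell=\ell_W$, and $q$ is induced by forgetting the discs and their labels and remembering only $\ell$. That is, $\iota$ and $q$ are continuous, $q\circ\iota$ is constant with value the point $[\ell_W]$, and the induced map from $\int_W^\theta A$ to the homotopy fibre of $q$ at $[\ell_W]$ is a weak homotopy equivalence. Moreover, $q$ admits a section, i.e. a continuous map $s\colon\mathcal{M}^\theta_\partial(W,\ell_W)\to W^\theta[A]$ with $q\circ s=\mathrm{id}$. -/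

import Mathlib

open scoped Manifold ContDiff NNReal Topology
open Set Function TopologicalSpace Bundle

universe u v w

noncomputable section

namespace DecoratedModuli

/-! ### Compactly generated spaces, weak equivalences, homotopy fibres -/

/-- The set underlying `X`, with the compactly generated topology associated with the topology
of `X`. Limits of compactly generated spaces are obtained by applying `Kify` to the limit taken
in all topological spaces. -/
def Kify (X : Type u) : Type u := X

instance (X : Type u) [TopologicalSpace X] : TopologicalSpace (Kify X) :=
  TopologicalSpace.compactlyGenerated.{u} X

instance (X : Type u) [h : Group X] : Group (Kify X) := h

/-- The map induced by a continuous map on `n`-th homotopy groups (on `π₀`, for `n = 0`). -/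
def piMap {X : Type u} {Y : Type v} [TopologicalSpace X] [TopologicalSpace Y] (f : C(X, Y))
    (n : ℕ) (x : X) : HomotopyGroup (Fin n) X x → HomotopyGroup (Fin n) Y (f x) :=
  Quotient.map' (fun g => ⟨f.comp g.1, fun y hy => congrArg f (g.2 y hy)⟩)
    (fun _ _ h => h.comp_continuousMap f)

/-- Weak homotopy equivalences: continuous maps that induce bijections on path components, and
on all homotopy groups at all basepoints. -/
def IsWeakEquiv {X : Type u} {Y : Type v} [TopologicalSpace X] [TopologicalSpace Y]
    (f : X → Y) : Prop :=
  ∃ hf : Continuous f,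
    (∀ y : Y, ∃ x : X, Joined (f x) y) ∧ (∀ x x' : X, Joined (f x) (f x') → Joined x x') ∧
    ∀ (n : ℕ) (x : X), Bijective (piMap ⟨f, hf⟩ (n + 1) x)

/-- The homotopy fibre of `q` at `b`: points of the total space, together with a path from `b` to
their image. (Passing to the associated compactly generated topology would not change its weak
homotopy type.) -/
def HoFib {X : Type u} {B : Type v} [TopologicalSpace X] [TopologicalSpace B] (q : X → B) (b : B) :
    Type (max u v) :=
  {p : X × C(unitInterval, B) // p.2 0 = b ∧ p.2 1 = q p.1}

instance {X : Type u} {B : Type v} [TopologicalSpace X] [TopologicalSpace B] (q : X → B) (b : B) :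
    TopologicalSpace (HoFib q b) :=
  inferInstanceAs (TopologicalSpace {p : X × C(unitInterval, B) // p.2 0 = b ∧ p.2 1 = q p.1})

/-- `F → X → B` is a homotopy fibre sequence over `b`: the maps are continuous, the composite is
constant with value `b`, and the induced map from `F` to the homotopy fibre is a weak
equivalence. -/
def IsHomotopyFibreSequence {F : Type u} {X : Type v} {B : Type w} [TopologicalSpace F]
    [TopologicalSpace X] [TopologicalSpace B] (i : F → X) (q : X → B) (b : B) : Prop :=
  Continuous i ∧ Continuous q ∧ ∃ h : ∀ z, q (i z) = b,
    IsWeakEquiv (fun z => (⟨(i z, ContinuousMap.const _ b), rfl, (h z).symm⟩ : HoFib q b))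

/-- The inclusion of the point `x` into `X` is a Hurewicz cofibration: it has the homotopy
extension property with respect to all spaces. -/
def WellPointed (X : Type u) [TopologicalSpace X] (x : X) : Prop :=
  ∀ (Z : Type u) [TopologicalSpace Z] (f : C(X, Z)) (h : C(unitInterval, Z)), h 0 = f x →
    ∃ h' : C(X × unitInterval, Z), (∀ y, h' (y, 0) = f y) ∧ ∀ t, h' (x, t) = h t

/-- Serre fibrations: the homotopy lifting property with respect to all cubes. -/
def IsSerreFibration {X : Type u} {B : Type v} [TopologicalSpace X] [TopologicalSpace B]
    (q : C(X, B)) : Prop :=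
  ∀ (n : ℕ) (f : C(Fin n → unitInterval, X)) (h : C((Fin n → unitInterval) × unitInterval, B)), (∀ y, h (y, 0) = q (f y)) →
    ∃ h' : C((Fin n → unitInterval) × unitInterval, X), (∀ y, h' (y, 0) = f y) ∧ ∀ z, q (h' z) = h z

/-! ### Simplicial spaces and bar constructions -/

/-- The data of a simplicial space that enter its geometric realisation: the spaces of
simplices, and the face and degeneracy maps. The realisation only depends on the topologies of the
spaces of simplices and on the underlying functions of these maps; therefore, the structure maps
of simplicial spaces, monads and right functors are recorded as functions. -/
structure SimplicialSpace where
  obj : ℕ → TopCat.{u}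
  face : ∀ p : ℕ, Fin (p + 2) → obj (p + 1) → obj p
  degen : ∀ p : ℕ, Fin (p + 1) → obj p → obj (p + 1)

/-- The gluing relation of the (thin) geometric realisation. -/
inductive SimplicialSpace.Glue (X : SimplicialSpace.{u}) :
    (Σ p : ℕ, stdSimplex ℝ (Fin (p + 1)) × X.obj p) →
    (Σ p : ℕ, stdSimplex ℝ (Fin (p + 1)) × X.obj p) → Prop
  | face (p : ℕ) (i : Fin (p + 2)) (t : stdSimplex ℝ (Fin (p + 1))) (x : X.obj (p + 1)) :
      Glue X ⟨p + 1, stdSimplex.map i.succAbove t, x⟩ ⟨p, t, X.face p i x⟩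
  | degen (p : ℕ) (i : Fin (p + 1)) (t : stdSimplex ℝ (Fin (p + 2))) (x : X.obj p) :
      Glue X ⟨p, stdSimplex.map i.predAbove t, x⟩ ⟨p + 1, t, X.degen p i x⟩

/-- The geometric realisation of a simplicial space. -/
def SimplicialSpace.realisation (X : SimplicialSpace.{u}) : TopCat.{u} :=
  TopCat.of (Quot X.Glue)

/-- Levelwise maps that commute with all faces and degeneracies. -/
structure SimplicialSpace.Hom (X Y : SimplicialSpace.{u}) where
  app : ∀ p : ℕ, X.obj p → Y.obj p
  face : ∀ p i x, app p (X.face p i x) = Y.face p i (app (p + 1) x)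
  degen : ∀ p i x, app (p + 1) (X.degen p i x) = Y.degen p i (app p x)

/-- The map induced on realisations. -/
def SimplicialSpace.Hom.realise {X Y : SimplicialSpace.{u}} (f : X.Hom Y) :
    X.realisation → Y.realisation :=
  Quot.map (fun z => ⟨z.1, z.2.1, f.app z.1 z.2.2⟩) (by
    rintro _ _ (⟨p, i, t, x⟩ | ⟨p, i, t, x⟩)
    · simpa only [f.face] using Glue.face (X := Y) p i t (f.app _ x)
    · simpa only [f.degen] using Glue.degen (X := Y) p i t (f.app _ x))

/-- The inclusion of the space of `0`-simplices. -/
def SimplicialSpace.vertex (X : SimplicialSpace.{u}) (x : X.obj 0) : X.realisation :=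
  Quot.mk _ ⟨0, stdSimplex.vertex 0, x⟩

/-- The map induced by an augmentation, i.e. a family of maps to a fixed set that is invariant
under faces and degeneracies. -/
def SimplicialSpace.augment (X : SimplicialSpace.{u}) {Y : Type u} (f : ∀ p : ℕ, X.obj p → Y)
    (hface : ∀ p i x, f p (X.face p i x) = f (p + 1) x)
    (hdegen : ∀ p i x, f (p + 1) (X.degen p i x) = f p x) : X.realisation → Y :=
  Quot.lift (fun z => f z.1 z.2.2) (by
    rintro _ _ (⟨p, i, t, x⟩ | ⟨p, i, t, x⟩)
    · exact (hface p i x).symm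
    · exact (hdegen p i x).symm)

/-- The data of a monad on spaces that enter bar constructions. -/
structure MonadData where
  obj : TopCat.{u} → TopCat.{u}
  map : ∀ {X Y : TopCat.{u}}, (X → Y) → obj X → obj Y
  unit : ∀ X : TopCat.{u}, X → obj X
  mult : ∀ X : TopCat.{u}, obj (obj X) → obj X

/-- The data of a right functor over a monad that enter bar constructions. -/
structure RightFunctorData (T : MonadData.{u}) where
  obj : TopCat.{u} → TopCat.{u}
  map : ∀ {X Y : TopCat.{u}}, (X → Y) → obj X → obj Y
  act : ∀ X : TopCat.{u}, obj (T.obj X) → obj X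

namespace MonadData

variable (T : MonadData.{u})

/-- `T^p A`. -/
def iter (A : TopCat.{u}) : ℕ → TopCat.{u}
  | 0 => A
  | p + 1 => T.obj (iter A p)

/-- The `p + 1` maps `T^(p+1) A → T^p A`: the last one applies the action on `A`, the others
apply the multiplication of the monad. -/
def iterFace {A : TopCat.{u}} (a : T.obj A → A) :
    ∀ p : ℕ, Fin (p + 1) → T.iter A (p + 1) → T.iter A p
  | 0, _ => a
  | p + 1, i => Fin.cases (T.mult (T.iter A p)) (fun j => T.map (iterFace a p j)) i

/-- The `p + 1` maps `T^p A → T^(p+1) A` given by the unit of the monad. -/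
def iterDegen (A : TopCat.{u}) : ∀ p : ℕ, Fin (p + 1) → T.iter A p → T.iter A (p + 1)
  | 0, _ => T.unit A
  | p + 1, i => Fin.cases (T.unit (T.iter A (p + 1))) (fun j => T.map (iterDegen A p j)) i

/-- The two-sided bar construction `[p] ↦ S T^p A`. -/
def bar {T : MonadData.{u}} (S : RightFunctorData T) {A : TopCat.{u}} (a : T.obj A → A) :
    SimplicialSpace.{u} where
  obj p := S.obj (T.iter A p)
  face p i := Fin.cases (S.act (T.iter A p)) (fun j => S.map (T.iterFace a p j)) i
  degen p i := S.map (T.iterDegen A p i)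

end MonadData

/-- Transformations of right functors. -/
structure RightFunctorData.Hom {T : MonadData.{u}} (S S' : RightFunctorData T) where
  app : ∀ X : TopCat.{u}, S.obj X → S'.obj X
  map : ∀ {X Y : TopCat.{u}} (f : X → Y) (z : S.obj X), app Y (S.map f z) = S'.map f (app X z)
  act : ∀ (X : TopCat.{u}) (z : S.obj (T.obj X)), app X (S.act X z) = S'.act X (app (T.obj X) z)

/-- The map of bar constructions induced by a transformation of right functors. -/
def RightFunctorData.Hom.bar {T : MonadData.{u}} {S S' : RightFunctorData T} (f : S.Hom S')
    {A : TopCat.{u}} (a : T.obj A → A) : (MonadData.bar S a).Hom (MonadData.bar S' a) where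
  app p := f.app (T.iter A p)
  face p i x := by
    refine Fin.cases ?_ (fun j => ?_) i
    · exact f.act _ x
    · exact f.map _ x
  degen p i x := f.map _ x

/-! ### Homotopy quotients -/

section HomotopyQuotient

variable (G : Type u) [TopologicalSpace G] [Group G]

/-- The monad `X ↦ G × X`. -/
def groupMonad : MonadData.{u} where
  obj X := TopCat.of (Kify (G × X))
  map f z := (z.1, f z.2)
  unit _ x := ((1 : G), x)
  mult _ z := (z.1 * z.2.1, z.2.2)

/-- The identity functor, as a right functor over `X ↦ G × X` by projecting to `X`. -/
def trivialRightFunctor : RightFunctorData (groupMonad G) where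
  obj X := X
  map f := f
  act _ z := z.2

/-- The bar construction `B(1, G, Y)`. -/
def groupBar (Y : Type u) [TopologicalSpace Y] [MulAction G Y] : SimplicialSpace.{u} :=
  MonadData.bar (A := TopCat.of Y) (trivialRightFunctor G) (fun z => (z.1 • z.2 : Y))

/-- The homotopy quotient of `Y` by `G`. -/
def HomotopyQuotient (Y : Type u) [TopologicalSpace Y] [MulAction G Y] : TopCat.{u} :=
  (groupBar G Y).realisation

variable {G} {Y Y' : Type u} [TopologicalSpace Y] [MulAction G Y] [TopologicalSpace Y']
  [MulAction G Y']

/-- The map on `p`-simplices of `B(1, G, -)` induced by a map `f`: apply `f` to the last entry. -/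
def groupBarMap (f : Y → Y') : ∀ p : ℕ,
    (groupMonad G).iter (TopCat.of Y) p → (groupMonad G).iter (TopCat.of Y') p
  | 0 => f
  | p + 1 => (groupMonad G).map (groupBarMap f p)

/-- The map of bar constructions induced by an equivariant map. -/
def groupBarHom (f : Y → Y') (hf : ∀ (g : G) (y : Y), f (g • y) = g • f y) :
    (groupBar G Y).Hom (groupBar G Y') where
  app := groupBarMap f
  face p i x := by
    have key : ∀ (p : ℕ) (j : Fin (p + 1)) (x : (groupMonad G).iter (TopCat.of Y) (p + 1)),
        groupBarMap f p ((groupMonad G).iterFace (A := TopCat.of Y)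
          (fun z => (z.1 • z.2 : Y)) p j x) =
        (groupMonad G).iterFace (A := TopCat.of Y') (fun z => (z.1 • z.2 : Y')) p j
          (groupBarMap f (p + 1) x) := by
      intro p
      induction p with
      | zero => exact fun _ x => hf x.1 x.2
      | succ p ih =>
        intro j x
        refine Fin.cases rfl (fun k => ?_) j
        exact congrArg (Prod.mk x.1) (ih k x.2)
    refine Fin.cases rfl (fun j => ?_) i
    exact key p j x
  degen p i x := by
    have key : ∀ (p : ℕ) (j : Fin (p + 1)) (x : (groupMonad G).iter (TopCat.of Y) p),
        groupBarMap f (p + 1) ((groupMonad G).iterDegen (TopCat.of Y) p j x) =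
        (groupMonad G).iterDegen (TopCat.of Y') p j (groupBarMap f p x) := by
      intro p
      induction p with
      | zero => exact fun _ _ => rfl
      | succ p ih =>
        intro j x
        refine Fin.cases rfl (fun k => ?_) j
        exact congrArg (Prod.mk x.1) (ih k x.2)
    exact key p i x

/-- The map of homotopy quotients induced by an equivariant map. -/
def homotopyQuotientMap (f : Y → Y') (hf : ∀ (g : G) (y : Y), f (g • y) = g • f y) :
    HomotopyQuotient G Y → HomotopyQuotient G Y' :=
  (groupBarHom f hf).realise

theorem homotopyQuotientMap_comp_eq {Y'' : Type u} [TopologicalSpace Y''] [MulAction G Y'']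
    (f : Y → Y') (hf : ∀ (g : G) (y : Y), f (g • y) = g • f y)
    (f' : Y' → Y'') (hf' : ∀ (g : G) (y : Y'), f' (g • y) = g • f' y)
    (k : Y → Y'') (hk : ∀ (g : G) (y : Y), k (g • y) = g • k y) (h : ∀ y, f' (f y) = k y)
    (z : HomotopyQuotient G Y) :
    homotopyQuotientMap f' hf' (homotopyQuotientMap f hf z) = homotopyQuotientMap k hk z := by
  have key : ∀ (p : ℕ) (x : (groupMonad G).iter (TopCat.of Y) p),
      groupBarMap f' p (groupBarMap f p x) = groupBarMap k p x := by
    intro p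
    induction p with
    | zero => exact h
    | succ p ih => exact fun x => congrArg (Prod.mk x.1) (ih x.2)
  obtain ⟨p, t, x⟩ := z
  exact congrArg (fun x' => Quot.mk (groupBar G Y'').Glue (Sigma.mk p (t, x'))) (key p x)

end HomotopyQuotient

/-! ### Operads, algebras, and the functors of decorated operations -/

/-- Symmetric sequences of spaces, indexed by (finite) sets instead of natural numbers. The
symmetric group of a set `J` acts on `obj J` by `reindex`. -/
structure SymSeq where
  obj : Type → Type u
  top : ∀ J : Type, TopologicalSpace (obj J)
  reindex : ∀ {J K : Type}, (J ≃ K) → obj K → obj J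
  reindex_refl : ∀ {J : Type} (s : obj J), reindex (Equiv.refl J) s = s
  reindex_trans : ∀ {J K M : Type} (e : J ≃ K) (f : K ≃ M) (s : obj M),
    reindex (e.trans f) s = reindex e (reindex f s)

attribute [instance] SymSeq.top

namespace SymSeq

/-- Operations of some arity `r`, with inputs labelled by points of `X`. -/
def Labelled (S : SymSeq.{u}) (X : Type u) [TopologicalSpace X] : Type u :=
  Σ r : ℕ, Kify (S.obj (Fin r) × (Fin r → X))

instance (S : SymSeq.{u}) (X : Type u) [TopologicalSpace X] : TopologicalSpace (S.Labelled X) :=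
  inferInstanceAs (TopologicalSpace (Σ r : ℕ, Kify (S.obj (Fin r) × (Fin r → X))))

/-- Two labelled operations are identified if they differ by a permutation of the inputs. -/
def Rel (S : SymSeq.{u}) (X : Type u) [TopologicalSpace X] (a b : S.Labelled X) : Prop :=
  ∃ e : Fin b.1 ≃ Fin a.1, b.2 = (S.reindex e a.2.1, a.2.2 ∘ e)

/-- The functor `X ↦ ∐ r, S(r) ×_{𝔖_r} X^r`. -/
def free (S : SymSeq.{u}) (X : TopCat.{u}) : TopCat.{u} :=
  TopCat.of (Quot (S.Rel X))

/-- Functoriality of `free` in the labels. -/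
def freeMap (S : SymSeq.{u}) {X Y : TopCat.{u}} (f : X → Y) : S.free X → S.free Y :=
  Quot.map (fun z => ⟨z.1, z.2.1, f ∘ z.2.2⟩) (by
    rintro ⟨r, s, x⟩ ⟨r', b⟩ ⟨e, h⟩
    exact ⟨e, by rw [show b = _ from h]; rfl⟩)

/-- Right actions of the operations in `O` on those in `S`, given by inserting for each input `j`
of an element of `S` an element of `O`. -/
structure RightAction (S O : SymSeq.{u}) where
  comp : ∀ {J : Type} {K : J → Type}, S.obj J → (∀ j, O.obj (K j)) → S.obj (Σ j, K j)
  comp_reindex_left : ∀ {J J' : Type} {K : J → Type} (e : J' ≃ J) (s : S.obj J)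
    (o : ∀ j, O.obj (K j)), comp (S.reindex e s) (fun j' => o (e j')) =
      S.reindex (Equiv.sigmaCongrLeft e) (comp s o)
  comp_reindex_right : ∀ {J : Type} {K K' : J → Type} (e : ∀ j, K' j ≃ K j) (s : S.obj J)
    (o : ∀ j, O.obj (K j)), comp s (fun j => O.reindex (e j) (o j)) =
      S.reindex (Equiv.sigmaCongrRight e) (comp s o)

/-- Insert labelled operations in `O` into an operation in `S`. -/
def RightAction.insert {S O : SymSeq.{u}} (m : RightAction S O) {X : Type u} [TopologicalSpace X]
    {r : ℕ} (s : S.obj (Fin r)) (b : Fin r → O.Labelled X) : S.Labelled X :=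
  ⟨∑ i, (b i).1,
    S.reindex finSigmaFinEquiv.symm (m.comp s (fun i => (b i).2.1)),
    fun k => (b (finSigmaFinEquiv.symm k).1).2.2 (finSigmaFinEquiv.symm k).2⟩

theorem RightAction.insert_reindex {S O : SymSeq.{u}} (m : RightAction S O) {X : Type u}
    [TopologicalSpace X] {r r' : ℕ} (e : Fin r' ≃ Fin r) (s : S.obj (Fin r))
    (b : Fin r → O.Labelled X) :
    S.Rel X (m.insert s b) (m.insert (S.reindex e s) (fun i => b (e i))) := by
  let E : Fin (∑ i, (b (e i)).1) ≃ Fin (∑ i, (b i).1) :=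
    finSigmaFinEquiv.symm.trans ((Equiv.sigmaCongrLeft (β := fun i => Fin (b i).1) e).trans
      finSigmaFinEquiv)
  have hE : ∀ k, finSigmaFinEquiv.symm (E k) =
      Equiv.sigmaCongrLeft (β := fun i => Fin (b i).1) e (finSigmaFinEquiv.symm k) :=
    fun k => by simp [E]
  have hE' : E.trans finSigmaFinEquiv.symm = finSigmaFinEquiv.symm.trans
      (Equiv.sigmaCongrLeft (β := fun i => Fin (b i).1) e) := Equiv.ext hE
  have h₁ : S.reindex finSigmaFinEquiv.symm
      (m.comp (S.reindex e s) (fun i => (b (e i)).2.1)) =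
      S.reindex E (S.reindex finSigmaFinEquiv.symm (m.comp s (fun i => (b i).2.1))) := by
    rw [← S.reindex_trans, hE', m.comp_reindex_left e s (fun i => (b i).2.1), S.reindex_trans]
  have h₂ : (fun k => (b (e (finSigmaFinEquiv.symm k).1)).2.2 (finSigmaFinEquiv.symm k).2) =
      (fun k => (b (finSigmaFinEquiv.symm k).1).2.2 (finSigmaFinEquiv.symm k).2) ∘ E := by
    funext k
    simp only [comp_apply]
    rw [hE]
    rfl
  exact ⟨E, Prod.ext h₁ h₂⟩

/-- The transformation `S(O(X)) → S(X)`. Since the action is equivariant, the choice of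
representatives of the labels in `O(X)` is irrelevant. -/
def RightAction.act {S O : SymSeq.{u}} (m : RightAction S O) (X : TopCat.{u}) :
    S.free (O.free X) → S.free X :=
  Quot.lift (fun z => Quot.mk _ (m.insert z.2.1 (fun i => Quot.out (z.2.2 i)))) (by
    rintro ⟨r, s, x⟩ ⟨r', b⟩ ⟨e, h⟩
    change Fin r' ≃ Fin r at e
    obtain rfl : b = (S.reindex e s, x ∘ e) := h
    exact Quot.sound (m.insert_reindex e s (fun i => Quot.out (x i))))

end SymSeq

/-- The data of a symmetric operad that enter its algebras and its monad. -/
structure OperadData extends SymSeq.{u} where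
  one : obj (Fin 1)
  mult : SymSeq.RightAction toSymSeq toSymSeq

namespace OperadData

variable (O : OperadData.{u})

/-- The monad associated with an operad. -/
def monad : MonadData.{u} where
  obj := O.free
  map := O.freeMap
  unit _ x := Quot.mk _ ⟨1, O.one, fun _ => x⟩
  mult := O.mult.act

/-- Algebras over an operad. -/
structure Algebra (A : Type u) [TopologicalSpace A] where
  act : ∀ r : ℕ, O.obj (Fin r) → (Fin r → A) → A
  continuous_act : ∀ r : ℕ,
    Continuous (fun z : Kify (O.obj (Fin r) × (Fin r → A)) => act r z.1 z.2)
  act_reindex : ∀ {r r' : ℕ} (e : Fin r' ≃ Fin r) (o : O.obj (Fin r)) (a : Fin r → A),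
    act r' (O.reindex e o) (a ∘ e) = act r o a
  act_one : ∀ a : A, act 1 O.one (fun _ => a) = a
  act_comp : ∀ {r : ℕ} (n : Fin r → ℕ) (o : O.obj (Fin r)) (b : ∀ i, O.obj (Fin (n i)))
    (a : ∀ i, Fin (n i) → A),
    act (∑ i, n i) (O.reindex finSigmaFinEquiv.symm (O.mult.comp o b))
      (fun k => a (finSigmaFinEquiv.symm k).1 (finSigmaFinEquiv.symm k).2) =
    act r o (fun i => act (n i) (b i) (a i))

variable {O}

/-- The structure map `∐ r, O(r) ×_{𝔖_r} A^r → A` of an algebra. -/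
def Algebra.structureMap {A : Type u} [TopologicalSpace A]
    (α : O.Algebra A) : O.monad.obj (TopCat.of A) → TopCat.of A :=
  Quot.lift (fun z => α.act z.1 z.2.1 z.2.2) (by
    rintro ⟨r, s, x⟩ ⟨r', b⟩ ⟨e, h⟩
    change Fin r' ≃ Fin r at e
    obtain rfl : b = (O.reindex e s, x ∘ e) := h
    exact (α.act_reindex e s x).symm)

/-- The right functor over the monad of `O` associated with a right action. -/
def rightFunctor (S : SymSeq.{u}) (m : S.RightAction O.toSymSeq) :
    RightFunctorData O.monad where
  obj := S.free
  map := S.freeMap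
  act := m.act

end OperadData

/-! ### The classifying space `BO(d)`, tangential structures, bundle maps -/

/-- `ℝ^∞`, the union of all `ℝ^n`. -/
def RInf : Type := ℕ →₀ ℝ

instance : AddCommGroup RInf := inferInstanceAs (AddCommGroup (ℕ →₀ ℝ))

instance : Module ℝ RInf := inferInstanceAs (Module ℝ (ℕ →₀ ℝ))

/-- The inclusion of `ℝ^n` into `ℝ^∞`. -/
def RInf.incl (n : ℕ) (x : Fin n → ℝ) : RInf := ∑ i : Fin n, Finsupp.single (i : ℕ) (x i)

/-- The colimit topology: a set is open if its intersection with each `ℝ^n` is open. -/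
instance : TopologicalSpace RInf := ⨆ n : ℕ, coinduced (RInf.incl n) inferInstance

/-- The space of `d`-frames in `ℝ^∞`. -/
def Frames (d : ℕ) : Type := {f : Fin d → RInf // LinearIndependent ℝ f}

instance (d : ℕ) : TopologicalSpace (Frames d) :=
  inferInstanceAs (TopologicalSpace {f : Fin d → RInf // LinearIndependent ℝ f})

/-- The Grassmannian of `d`-dimensional subspaces of `ℝ^∞`, as a model for `BO(d)`. Its universal
vector bundle consists of all pairs of a subspace and a vector in it. -/
def BO (d : ℕ) : Type :=
  {P : Submodule ℝ RInf // Module.Finite ℝ P ∧ Module.finrank ℝ P = d}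

/-- The subspace spanned by a frame. -/
def Frames.span {d : ℕ} (f : Frames d) : BO d :=
  ⟨Submodule.span ℝ (range f.1), Module.Finite.span_of_finite ℝ (finite_range f.1), by
    simpa using finrank_span_eq_card f.2⟩

/-- The quotient topology from the space of frames. -/
instance (d : ℕ) : TopologicalSpace (BO d) := coinduced Frames.span inferInstance

/-- Tangential structures: fibrations `θ : L → BO(d)` with path-connected `L`. As for all spaces
here, `L` is compactly generated; it is Hausdorff, so that the operation spaces of the operad of
`θ`-framed discs are Hausdorff. -/
structure TangentialStructure (d : ℕ) where
  L : Type u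
  [topL : TopologicalSpace L]
  [compactlyGenerated : CompactlyGeneratedSpace L]
  [hausdorff : T2Space L]
  [pathConnected : PathConnectedSpace L]
  toMap : C(L, BO d)
  isFibration : IsSerreFibration toMap

attribute [instance] TangentialStructure.topL TangentialStructure.compactlyGenerated
  TangentialStructure.hausdorff TangentialStructure.pathConnected

variable {d : ℕ}

/-- The fibre of `θ^* V_d` over `x`. -/
def TangentialStructure.fibre (θ : TangentialStructure.{u} d) (x : θ.L) : Submodule ℝ RInf :=
  (θ.toMap x).1

/-- The total space of the vector bundle `θ^* V_d` over `L`. -/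
def TangentialStructure.Total (θ : TangentialStructure.{u} d) : Type u :=
  {p : θ.L × RInf // p.2 ∈ θ.fibre p.1}

instance (θ : TangentialStructure.{u} d) : TopologicalSpace θ.Total :=
  inferInstanceAs (TopologicalSpace {p : θ.L × RInf // p.2 ∈ θ.fibre p.1})

/-- Euclidean `d`-space. -/
abbrev Euc (d : ℕ) : Type := EuclideanSpace ℝ (Fin d)

/-- The space of bundle maps from a vector bundle `V` of rank `d` to `θ^* V_d`, i.e. continuous
maps between total spaces that map each fibre by a linear isomorphism to some fibre, with the
compact-open topology. -/
def BundleMap (θ : TangentialStructure.{u} d) {B : Type v} (V : B → Type)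
    [∀ b, AddCommGroup (V b)] [∀ b, Module ℝ (V b)] [TopologicalSpace (TotalSpace (Euc d) V)] :
    Type (max u v) :=
  {F : C(TotalSpace (Euc d) V, θ.Total) // ∀ b : B, ∃ (x : θ.L) (φ : V b ≃ₗ[ℝ] θ.fibre x),
    ∀ y : V b, (F ⟨b, y⟩).1 = (x, (φ y : RInf))}

instance (θ : TangentialStructure.{u} d) {B : Type v} (V : B → Type)
    [∀ b, AddCommGroup (V b)] [∀ b, Module ℝ (V b)] [TopologicalSpace (TotalSpace (Euc d) V)] :
    TopologicalSpace (BundleMap θ V) :=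
  inferInstanceAs (TopologicalSpace {F : C(TotalSpace (Euc d) V, θ.Total) //
    ∀ b : B, ∃ (x : θ.L) (φ : V b ≃ₗ[ℝ] θ.fibre x), ∀ y : V b, (F ⟨b, y⟩).1 = (x, (φ y : RInf))})

/-- The space `Fr^θ(M)` of `θ`-framings of a `d`-dimensional manifold `M`. -/
abbrev Fr (θ : TangentialStructure.{u} d) {H : Type w} [TopologicalSpace H]
    (I : ModelWithCorners ℝ (Euc d) H) (M : Type v) [TopologicalSpace M] [ChartedSpace H M]
    [IsManifold I ∞ M] : Type (max u v) :=
  BundleMap θ (TangentSpace I : M → Type)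

/-! ### The topology on spaces of smooth maps -/

/-- Smooth manifolds, possibly with boundary (or corners), with all their data. -/
structure Mfd where
  E : Type
  [normedE : NormedAddCommGroup E]
  [spaceE : NormedSpace ℝ E]
  H : Type w
  [topH : TopologicalSpace H]
  I : ModelWithCorners ℝ E H
  M : Type v
  [topM : TopologicalSpace M]
  [charted : ChartedSpace H M]
  [smooth : IsManifold I ∞ M]

attribute [instance] Mfd.normedE Mfd.spaceE Mfd.topH Mfd.topM Mfd.charted Mfd.smooth

/-- The tangent bundle, as a manifold. -/
def Mfd.tangent (X : Mfd.{v, w}) : Mfd.{v, w} where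
  E := X.E × X.E
  H := ModelProd X.H X.E
  I := X.I.tangent
  M := TangentBundle X.I X.M

/-- The `k`-fold iterated tangent bundle. -/
def Mfd.iterTangent : ℕ → Mfd.{v, w} → Mfd.{v, w}
  | 0, X => X
  | k + 1, X => Mfd.iterTangent k X.tangent

/-- The restriction of the `k`-fold iterated tangent bundle to a subset. -/
def Mfd.iterTangentSet : ∀ (k : ℕ) (X : Mfd.{v, w}), Set X.M → Set (X.iterTangent k).M
  | 0, _, s => s
  | k + 1, X, s => Mfd.iterTangentSet k X.tangent
      ((fun p : TangentBundle X.I X.M => p.proj) ⁻¹' s)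

universe v' w'

/-- The `k`-fold iterated tangent map of `f` within `s`. -/
def Mfd.iterTangentMap : ∀ (k : ℕ) (X : Mfd.{v, w}) (Y : Mfd.{v', w'}), Set X.M → (X.M → Y.M) →
    (X.iterTangent k).M → (Y.iterTangent k).M
  | 0, _, _, _, f => f
  | k + 1, X, Y, s, f => Mfd.iterTangentMap k X.tangent Y.tangent
      ((fun p : TangentBundle X.I X.M => p.proj) ⁻¹' s) (tangentMapWithin X.I Y.I f s)

/-- The `C^∞`-topology for maps that are smooth on `s`: the coarsest topology for which all
iterated tangent maps depend continuously on the map, with respect to the compact-open topology. -/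
@[reducible]
def smoothTopology (X : Mfd.{v, w}) (Y : Mfd.{v', w'}) (s : Set X.M) :
    TopologicalSpace (X.M → Y.M) :=
  generateFrom {U | ∃ (k : ℕ) (K : Set (X.iterTangent k).M) (V : Set (Y.iterTangent k).M),
    IsCompact K ∧ K ⊆ Mfd.iterTangentSet k X s ∧ IsOpen V ∧
    U = {f | MapsTo (Mfd.iterTangentMap k X Y s f) K V}}

/-! ### Embedded discs -/

/-- The closed unit ball, as a subset of Euclidean space. -/
def ballSet (d : ℕ) : Set (Euc d) := Metric.closedBall 0 1

/-- The closed unit disc `D^d`. -/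
abbrev Disc (d : ℕ) : Type := ballSet d

/-- An extension of a map on `D^d` to Euclidean space; its values outside of `D^d` play no role. -/
def extendDisc {M : Type v} (f : Disc d → M) (x : Euc d) : M :=
  open Classical in
  if h : x ∈ ballSet d then f ⟨x, h⟩ else f ⟨0, Metric.mem_closedBall_self zero_le_one⟩

theorem extendDisc_of_mem {M : Type v} (f : Disc d → M) {x : Euc d} (h : x ∈ ballSet d) :
    extendDisc f x = f ⟨x, h⟩ := by
  simp [extendDisc, h]

theorem uniqueMDiffOn_ballSet : UniqueMDiffOn 𝓘(ℝ, Euc d) (ballSet d) := by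
  refine UniqueDiffOn.uniqueMDiffOn (uniqueDiffOn_convex (convex_closedBall 0 1) ?_)
  exact ⟨0, Metric.ball_subset_interior_closedBall (Metric.mem_ball_self one_pos)⟩

section Discs

variable {H : Type w} [TopologicalSpace H] (I : ModelWithCorners ℝ (Euc d) H)
  (M : Type v) [TopologicalSpace M] [ChartedSpace H M] [IsManifold I ∞ M]

/-- Smooth embeddings `D^d → M`, i.e. injective immersions. -/
structure IsDiscEmb {M : Type v} [TopologicalSpace M] [ChartedSpace H M] (f : Disc d → M) :
    Prop where
  injective : Injective f
  smooth : ContMDiffOn 𝓘(ℝ, Euc d) I ∞ (extendDisc f) (ballSet d)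
  immersive : ∀ x ∈ ballSet d,
    Injective (mfderivWithin 𝓘(ℝ, Euc d) I (extendDisc f) (ballSet d) x)

/-- The space `Emb(D^d, M)`. -/
def DiscEmb : Type v := {f : Disc d → M // IsDiscEmb I f}

/-- Euclidean space as a manifold. -/
def eucMfd (d : ℕ) : Mfd.{0, 0} where
  E := Euc d
  H := Euc d
  I := 𝓘(ℝ, Euc d)
  M := Euc d

/-- A manifold with its data. -/
def toMfd : Mfd.{v, w} where
  E := Euc d
  H := H
  I := I
  M := M

instance : TopologicalSpace (DiscEmb I M) :=
  induced (fun f => extendDisc f.1) (smoothTopology (eucMfd d) (toMfd I M) (ballSet d))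

/-- The space of bundle maps `T D^d → θ^* V_d`. -/
abbrev FrDisc (θ : TangentialStructure.{u} d) : Type u :=
  BundleMap θ (Bundle.Trivial (Disc d) (Euc d))

variable {I M}

/-- A tangent vector of the disc, as a tangent vector of Euclidean space. -/
def discVec (p : TotalSpace (Euc d) (Bundle.Trivial (Disc d) (Euc d))) :
    TangentBundle 𝓘(ℝ, Euc d) (Euc d) := ⟨p.1.1, p.2⟩

theorem continuous_discVec : Continuous (discVec (d := d)) := by
  have h : Continuous (fun p : TotalSpace (Euc d) (Bundle.Trivial (Disc d) (Euc d)) =>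
      ((p.1.1, p.2) : Euc d × Euc d)) := by
    have := (Bundle.Trivial.homeomorphProd (Disc d) (Euc d)).continuous
    exact (continuous_subtype_val.comp (continuous_fst.comp this)).prodMk
      (continuous_snd.comp this)
  exact (tangentBundleModelSpaceHomeomorph 𝓘(ℝ, Euc d)).symm.continuous.comp h

/-- The tangent map `T D^d → TM` of an embedded disc. -/
def DiscEmb.tangent (f : DiscEmb I M) (p : TotalSpace (Euc d) (Bundle.Trivial (Disc d) (Euc d))) :
    TangentBundle I M :=
  tangentMapWithin 𝓘(ℝ, Euc d) I (extendDisc f.1) (ballSet d) (discVec p)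

theorem DiscEmb.continuous_tangent (f : DiscEmb I M) : Continuous f.tangent := by
  have h := f.2.smooth.continuousOn_tangentMapWithin (by simp) uniqueMDiffOn_ballSet
  exact h.comp_continuous continuous_discVec (fun p => p.1.2)

/-- The derivative of an embedded disc at a point, which is a linear isomorphism. -/
def DiscEmb.tangentEquiv (f : DiscEmb I M) (x : Disc d) : Euc d ≃ₗ[ℝ] Euc d :=
  LinearEquiv.ofInjectiveEndo
    (show Euc d →L[ℝ] Euc d from
      mfderivWithin 𝓘(ℝ, Euc d) I (extendDisc f.1) (ballSet d) x.1).toLinearMap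
    (f.2.immersive x.1 x.2)

variable {θ : TangentialStructure.{u} d}

/-- The pullback `ℓ ∘ Tf` of a `θ`-framing along an embedded disc. -/
def Fr.pull (ℓ : Fr θ I M) (f : DiscEmb I M) : FrDisc θ :=
  ⟨ℓ.1.comp ⟨f.tangent, f.continuous_tangent⟩, fun b => by
    obtain ⟨x, φ, h⟩ := ℓ.2 (extendDisc f.1 b.1)
    let φ' : Euc d ≃ₗ[ℝ] θ.fibre x := φ
    exact ⟨x, (f.tangentEquiv b).trans φ', fun y => h (f.tangent ⟨b, y⟩).2⟩⟩

variable (d) in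
/-- The space `Emb(D^d, D^d)`. -/
abbrev DiscSelfEmb : Type :=
  {f : DiscEmb 𝓘(ℝ, Euc d) (Euc d) // ∀ x, f.1 x ∈ ballSet d}

/-- The inclusion of `D^d` into Euclidean space. -/
def discIncl : DiscEmb 𝓘(ℝ, Euc d) (Euc d) :=
  ⟨Subtype.val, Subtype.val_injective,
    contMDiffOn_id.congr (fun _ h => extendDisc_of_mem _ h), fun x hx => by
      rw [mfderivWithin_congr_of_mem (f := id) (fun _ h => extendDisc_of_mem _ h) hx,
        mfderivWithin_id (uniqueMDiffOn_ballSet x hx)]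
      exact injective_id⟩

/-- The map `T D^d → T D^d` induced by an embedding `D^d → D^d`. -/
def DiscSelfEmb.tangent (f : DiscSelfEmb d)
    (p : TotalSpace (Euc d) (Bundle.Trivial (Disc d) (Euc d))) :
    TotalSpace (Euc d) (Bundle.Trivial (Disc d) (Euc d)) :=
  ⟨⟨f.1.1 p.1, f.2 p.1⟩, (f.1.tangent p).2⟩

theorem discVec_tangent (f : DiscSelfEmb d)
    (p : TotalSpace (Euc d) (Bundle.Trivial (Disc d) (Euc d))) :
    discVec (DiscSelfEmb.tangent f p) = f.1.tangent p :=
  TotalSpace.ext (extendDisc_of_mem f.1.1 p.1.2).symm HEq.rfl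

theorem DiscSelfEmb.continuous_tangent (f : DiscSelfEmb d) :
    Continuous (DiscSelfEmb.tangent f) := by
  have h₁ : Continuous (fun p => discVec (DiscSelfEmb.tangent f p)) := by
    simp only [discVec_tangent]
    exact f.1.continuous_tangent
  have h₂ : Continuous (fun p => (((DiscSelfEmb.tangent f p).1.1,
      (DiscSelfEmb.tangent f p).2) : Euc d × Euc d)) :=
    (tangentBundleModelSpaceHomeomorph 𝓘(ℝ, Euc d)).continuous.comp h₁
  exact (Bundle.Trivial.homeomorphProd (Disc d) (Euc d)).symm.continuous.comp
    (((continuous_fst.comp h₂).subtype_mk (fun p => (DiscSelfEmb.tangent f p).1.2)).prodMk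
      (continuous_snd.comp h₂))

/-- The precomposition `F ∘ Tf` of a bundle map `F` with the tangent map of an embedding
`f : D^d → D^d`. -/
def FrDisc.pull (F : FrDisc θ) (f : DiscSelfEmb d) : FrDisc θ :=
  ⟨F.1.comp ⟨DiscSelfEmb.tangent f, DiscSelfEmb.continuous_tangent f⟩, fun b => by
    obtain ⟨x, φ, h⟩ := F.2 ⟨f.1.1 b, f.2 b⟩
    let φ' : Euc d ≃ₗ[ℝ] θ.fibre x := φ
    exact ⟨x, (f.1.tangentEquiv b).trans φ', fun y => h (f.1.tangent ⟨b, y⟩).2⟩⟩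

theorem extendDisc_comp {M : Type v} (a : Disc d → M) (b : DiscSelfEmb d) {x : Euc d}
    (hx : x ∈ ballSet d) : extendDisc (fun y => a ⟨b.1.1 y, b.2 y⟩) x =
      (extendDisc a ∘ extendDisc b.1.1) x := by
  simp only [comp_apply, extendDisc_of_mem _ hx]
  rw [extendDisc_of_mem _ (b.2 _)]

theorem DiscSelfEmb.mapsTo (b : DiscSelfEmb d) :
    MapsTo (extendDisc b.1.1) (ballSet d) (ballSet d) := fun x hx => by
  rw [extendDisc_of_mem _ hx]
  exact b.2 _

theorem mfderivWithin_extendDisc_comp (a : DiscEmb I M) (b : DiscSelfEmb d) {x : Euc d}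
    (hx : x ∈ ballSet d) :
    mfderivWithin 𝓘(ℝ, Euc d) I (extendDisc (fun y => a.1 ⟨b.1.1 y, b.2 y⟩)) (ballSet d) x =
      (mfderivWithin 𝓘(ℝ, Euc d) I (extendDisc a.1) (ballSet d) (extendDisc b.1.1 x)).comp
        (mfderivWithin 𝓘(ℝ, Euc d) 𝓘(ℝ, Euc d) (extendDisc b.1.1) (ballSet d) x) := by
  rw [mfderivWithin_congr_of_mem (fun _ h => extendDisc_comp a.1 b h) hx]
  exact mfderivWithin_comp x
    ((a.2.smooth _ (DiscSelfEmb.mapsTo b hx)).mdifferentiableWithinAt (by simp))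
    ((b.1.2.smooth _ hx).mdifferentiableWithinAt (by simp)) (DiscSelfEmb.mapsTo b)
    (uniqueMDiffOn_ballSet x hx)

/-- The composite of an embedding `D^d → D^d` with an embedded disc. -/
def DiscEmb.comp (a : DiscEmb I M) (b : DiscSelfEmb d) : DiscEmb I M :=
  ⟨fun x => a.1 ⟨b.1.1 x, b.2 x⟩,
    fun x y h => b.1.2.injective (congrArg Subtype.val (a.2.injective h)),
    (a.2.smooth.comp b.1.2.smooth (DiscSelfEmb.mapsTo b)).congr
      (fun _ h => extendDisc_comp a.1 b h),
    fun x hx => by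
      rw [mfderivWithin_extendDisc_comp a b hx]
      exact (a.2.immersive _ (DiscSelfEmb.mapsTo b hx)).comp (b.1.2.immersive x hx)⟩

theorem DiscEmb.tangent_comp (a : DiscEmb I M) (b : DiscSelfEmb d)
    (p : TotalSpace (Euc d) (Bundle.Trivial (Disc d) (Euc d))) :
    (a.comp b).tangent p = a.tangent (DiscSelfEmb.tangent b p) := by
  have hx : p.1.1 ∈ ballSet d := p.1.2
  have h₁ : tangentMapWithin 𝓘(ℝ, Euc d) I (extendDisc a.1 ∘ extendDisc b.1.1) (ballSet d)
      (discVec p) = tangentMapWithin 𝓘(ℝ, Euc d) I (extendDisc a.1) (ballSet d)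
        (b.1.tangent p) :=
    tangentMapWithin_comp_at (discVec p)
      ((a.2.smooth _ (DiscSelfEmb.mapsTo b hx)).mdifferentiableWithinAt (by simp))
      ((b.1.2.smooth _ hx).mdifferentiableWithinAt (by simp)) (DiscSelfEmb.mapsTo b)
      (uniqueMDiffOn_ballSet _ hx)
  rw [DiscEmb.tangent, DiscEmb.tangent, discVec_tangent, ← h₁]
  exact tangentMapWithin_congr (fun _ h => extendDisc_comp a.1 b h) (discVec p) hx

theorem Fr.pull_comp (ℓ : Fr θ I M) (a : DiscEmb I M) (b : DiscSelfEmb d) :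
    Fr.pull ℓ (a.comp b) = FrDisc.pull (Fr.pull ℓ a) b :=
  Subtype.ext (ContinuousMap.ext fun p => congrArg ℓ.1 (a.tangent_comp b p))

theorem FrDisc.continuous_pull (b : DiscSelfEmb d) :
    Continuous (fun F : FrDisc θ => FrDisc.pull F b) :=
  ((ContinuousMap.continuous_precomp _).comp continuous_subtype_val).subtype_mk _

end Discs

/-! ### Framed embeddings of discs -/

/-- A `θ`-framing of `ℝ^d` that only depends on the fibre factor of `Tℝ^d = ℝ^d × ℝ^d`. -/
structure StdFraming (θ : TangentialStructure.{u} d) where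
  framing : Fr θ 𝓘(ℝ, Euc d) (Euc d)
  translation_invariant : ∀ x y v : Euc d, framing.1 ⟨x, v⟩ = framing.1 ⟨y, v⟩

/-- The restriction of the standard framing to `D^d`. -/
def StdFraming.disc {θ : TangentialStructure.{u} d} (ℓ₀ : StdFraming θ) : FrDisc θ :=
  Fr.pull ℓ₀.framing discIncl

section FramedEmbeddings

variable {θ : TangentialStructure.{u} d} (ℓ₀ : StdFraming θ)
  {H : Type w} [TopologicalSpace H] {I : ModelWithCorners ℝ (Euc d) H}
  {M : Type v} [TopologicalSpace M] [ChartedSpace H M] [IsManifold I ∞ M]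

/-- Triples `(α, t, γ)` of a `J`-tuple of embedded discs in `M`, and for each disc a length and a
path of `θ`-framings of `D^d`. -/
abbrev RawEmb (θ : TangentialStructure.{u} d) (I : ModelWithCorners ℝ (Euc d) H)
    (M : Type v) [TopologicalSpace M] [ChartedSpace H M] [IsManifold I ∞ M] (J : Type) :
    Type (max u v) :=
  (J → DiscEmb I M) × (J → ℝ≥0) × (J → C(ℝ≥0, FrDisc θ))

/-- `(α, t, γ)` is a `θ`-framed embedding of `J × D^d` into `(M, ℓ)`: the discs are disjoint, and
on each disc, `γ` is a Moore path of length `t` from the standard framing to `ℓ ∘ Tα`. -/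
structure IsFramedEmb (ℓ : Fr θ I M) {J : Type} (a : RawEmb θ I M J) : Prop where
  injective : Injective (fun p : J × Disc d => (a.1 p.1).1 p.2)
  start : ∀ j, a.2.2 j 0 = ℓ₀.disc
  finish : ∀ j s, a.2.1 j ≤ s → a.2.2 j s = Fr.pull ℓ (a.1 j)

/-- The space `Emb^θ(J × D^d, M)`. -/
abbrev FramedEmb (ℓ : Fr θ I M) (J : Type) : Type (max u v) :=
  {a : RawEmb θ I M J // IsFramedEmb ℓ₀ ℓ a}

/-- The space `E^θ_d(J) = Emb^θ(J × D^d, D^d)`. -/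
abbrev DiscOp (J : Type) : Type u :=
  {a : RawEmb θ 𝓘(ℝ, Euc d) (Euc d) J //
    IsFramedEmb ℓ₀ ℓ₀.framing a ∧ ∀ j x, (a.1 j).1 x ∈ ballSet d}

/-- Permutation of discs. -/
def RawEmb.reindex {J K : Type} (e : J ≃ K) (a : RawEmb θ I M K) : RawEmb θ I M J :=
  (a.1 ∘ e, a.2.1 ∘ e, a.2.2 ∘ e)

variable {ℓ₀}

theorem IsFramedEmb.reindex {ℓ : Fr θ I M} {J K : Type} (e : J ≃ K) {a : RawEmb θ I M K}
    (h : IsFramedEmb ℓ₀ ℓ a) : IsFramedEmb ℓ₀ ℓ (a.reindex e) where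
  injective p q hpq := by
    have := h.injective (a₁ := (e p.1, p.2)) (a₂ := (e q.1, q.2)) hpq
    rw [Prod.mk.injEq, e.injective.eq_iff] at this
    exact Prod.ext this.1 this.2
  start j := h.start (e j)
  finish j := h.finish (e j)

/-- The composite Moore path: first `γ'`, of length `t'`, and then `γ ∘ Tb`. -/
def mooreComp (γ : C(ℝ≥0, FrDisc θ)) (t' : ℝ≥0) (γ' : C(ℝ≥0, FrDisc θ)) (b : DiscSelfEmb d)
    (h : γ' t' = FrDisc.pull (γ 0) b) : C(ℝ≥0, FrDisc θ) where
  toFun s := if s ≤ t' then γ' s else FrDisc.pull (γ (s - t')) b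
  continuous_toFun := by
    refine Continuous.if_le γ'.continuous ?_ continuous_id continuous_const ?_
    · exact (FrDisc.continuous_pull b).comp
        (γ.continuous.comp (continuous_id.sub continuous_const))
    · rintro s rfl
      simpa using h

/-- The `k`-th disc of an element of `E^θ_d(J)`. -/
def DiscOp.emb {J : Type} (b : DiscOp ℓ₀ J) (k : J) : DiscSelfEmb d :=
  ⟨b.1.1 k, b.2.2 k⟩

theorem DiscOp.finish {J : Type} (b : DiscOp ℓ₀ J) (k : J) (s : ℝ≥0) (hs : b.1.2.1 k ≤ s) :
    b.1.2.2 k s = FrDisc.pull ℓ₀.disc (b.emb k) := by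
  rw [b.2.1.finish k s hs, StdFraming.disc, ← Fr.pull_comp]
  rfl

/-- Composition of framed embeddings. -/
def RawEmb.comp {J : Type} {K : J → Type} (a : RawEmb θ I M J)
    (ha : ∀ j, a.2.2 j 0 = ℓ₀.disc) (b : ∀ j, DiscOp ℓ₀ (K j)) : RawEmb θ I M (Σ j, K j) :=
  (fun p => (a.1 p.1).comp ((b p.1).emb p.2),
    fun p => (b p.1).1.2.1 p.2 + a.2.1 p.1,
    fun p => mooreComp (a.2.2 p.1) ((b p.1).1.2.1 p.2) ((b p.1).1.2.2 p.2) ((b p.1).emb p.2)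
      (by rw [(b p.1).finish p.2 _ le_rfl, ha]))

theorem IsFramedEmb.comp {ℓ : Fr θ I M} {J : Type} {K : J → Type} {a : RawEmb θ I M J}
    (h : IsFramedEmb ℓ₀ ℓ a) (b : ∀ j, DiscOp ℓ₀ (K j)) :
    IsFramedEmb ℓ₀ ℓ (a.comp h.start b) where
  injective := by
    rintro ⟨⟨j, k⟩, x⟩ ⟨⟨j', k'⟩, x'⟩ hp
    have h₁ := h.injective (a₁ := (j, ⟨_, (b j).2.2 k x⟩)) (a₂ := (j', ⟨_, (b j').2.2 k' x'⟩)) hp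
    rw [Prod.mk.injEq] at h₁
    obtain ⟨rfl, h₁⟩ := h₁
    have h₂ := (b j).2.1.injective (a₁ := (k, x)) (a₂ := (k', x')) (congrArg Subtype.val h₁)
    rw [Prod.mk.injEq] at h₂
    obtain ⟨rfl, rfl⟩ := h₂
    rfl
  start p := by
    change (if (0 : ℝ≥0) ≤ _ then _ else _) = _
    rw [if_pos zero_le]
    exact (b p.1).2.1.start p.2
  finish p s hs := by
    change (b p.1).1.2.1 p.2 + a.2.1 p.1 ≤ s at hs
    change (if s ≤ (b p.1).1.2.1 p.2 then _ else _) = Fr.pull ℓ ((a.1 p.1).comp _)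
    rw [Fr.pull_comp]
    split_ifs with hs'
    · have h₁ : (b p.1).1.2.1 p.2 ≤ s := le_trans le_self_add hs
      have h₂ : a.2.1 p.1 = 0 := by
        have := hs.trans hs'
        simpa using this
      rw [(b p.1).finish p.2 s h₁, ← h.finish p.1 0 h₂.le, h.start]
    · rw [h.finish p.1 _ (le_tsub_of_add_le_left hs)]

variable (ℓ₀)

/-- The symmetric sequence `J ↦ Emb^θ(J × D^d, M)`. -/
def framedEmbSeq (ℓ : Fr θ I M) : SymSeq.{max u v} where
  obj := FramedEmb ℓ₀ ℓ
  top _ := inferInstance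
  reindex e a := ⟨a.1.reindex e, a.2.reindex e⟩
  reindex_refl _ := rfl
  reindex_trans _ _ _ := rfl

/-- The symmetric sequence `J ↦ Emb^θ(J × D^d, D^d)`. -/
def discSeq : SymSeq.{u} where
  obj := DiscOp ℓ₀
  top _ := inferInstance
  reindex e a := ⟨a.1.reindex e, a.2.1.reindex e, fun j => a.2.2 (e j)⟩
  reindex_refl _ := rfl
  reindex_trans _ _ _ := rfl

/-- The `θ`-framed `d`-discs operad `E^θ_d`. -/
def discOperad : OperadData.{u} where
  toSymSeq := discSeq ℓ₀
  one := ⟨(fun _ => discIncl, fun _ => 0, fun _ => ContinuousMap.const _ ℓ₀.disc),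
    ⟨fun _ _ h => Prod.ext (Subsingleton.elim _ _) (Subtype.ext h), fun _ => rfl,
      fun _ _ _ => rfl⟩, fun _ x => x.2⟩
  mult :=
    { comp := fun a b => ⟨a.1.comp a.2.1.start b, a.2.1.comp b, fun _ _ => a.2.2 _ _⟩
      comp_reindex_left := fun _ _ _ => rfl
      comp_reindex_right := fun _ _ _ => rfl }

end FramedEmbeddings

section Moduli

variable {θ : TangentialStructure.{u} d} (ℓ₀ : StdFraming θ)
  {H : Type w} [TopologicalSpace H] {I : ModelWithCorners ℝ (Euc d) H}
  {W : Type u} [TopologicalSpace W] [ChartedSpace H W] [IsManifold I ∞ W]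

/-- The right action of `E^θ_d` on `Emb^θ(J × D^d, W)` by composition. -/
def framedEmbAction (ℓ : Fr θ I W) :
    (framedEmbSeq ℓ₀ ℓ).RightAction (discOperad ℓ₀).toSymSeq where
  comp a b := ⟨a.1.comp a.2.start b, a.2.comp b⟩
  comp_reindex_left _ _ _ := rfl
  comp_reindex_right _ _ _ := rfl

/-- The right functor `X ↦ ∐ r, Emb^θ(r × D^d, W) ×_{𝔖_r} X^r`. -/
def embFunctor (ℓ : Fr θ I W) : RightFunctorData (discOperad ℓ₀).monad :=
  OperadData.rightFunctor (framedEmbSeq ℓ₀ ℓ) (framedEmbAction ℓ₀ ℓ)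

/-- The factorisation homology of `(W, ℓ)` with coefficients in an `E^θ_d`-algebra. -/
def FactorisationHomology (ℓ : Fr θ I W) {A : Type u} [TopologicalSpace A]
    (α : (discOperad ℓ₀).Algebra A) : TopCat.{u} :=
  (MonadData.bar (embFunctor ℓ₀ ℓ) α.structureMap).realisation

/-! ### Collars and diffeomorphisms -/

variable (I W) in
/-- Collars of the boundary of `W`: open subsets that are the image of a diffeomorphism defined on
`N × [0, 1)`, for a manifold `N` without boundary, that takes `N × {0}` to the boundary. -/
structure Collar where
  carrier : Set W
  isOpen : IsOpen carrier
  isCollar : ∃ (N : Type u) (_ : TopologicalSpace N) (_ : ChartedSpace (Euc (d - 1)) N)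
    (_ : IsManifold 𝓘(ℝ, Euc (d - 1)) ∞ N) (c : N × ℝ → W),
    ContMDiffOn (𝓘(ℝ, Euc (d - 1)).prod 𝓘(ℝ, ℝ)) I ∞ c (univ ×ˢ Ico 0 1) ∧
    InjOn c (univ ×ˢ Ico 0 1) ∧
    (∀ p ∈ (univ : Set N) ×ˢ Ico (0 : ℝ) 1,
      Injective (mfderivWithin (𝓘(ℝ, Euc (d - 1)).prod 𝓘(ℝ, ℝ)) I c (univ ×ˢ Ico 0 1) p)) ∧
    c '' (univ ×ˢ Ico 0 1) = carrier ∧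
    c '' (univ ×ˢ {0}) = I.boundary W

/-- The group of diffeomorphisms of `W` that fix the collar pointwise. -/
def DiffBd (C : Collar I W) : Type u :=
  {φ : Diffeomorph I I W W ∞ // ∀ x ∈ C.carrier, φ x = x}

namespace DiffBd

variable {C : Collar I W}

/-- The `C^∞`-topology on diffeomorphisms and their inverses. -/
instance : TopologicalSpace (DiffBd C) :=
  induced (fun φ => (φ.1 : W → W)) (smoothTopology (toMfd I W) (toMfd I W) univ) ⊓
  induced (fun φ => (φ.1.symm : W → W)) (smoothTopology (toMfd I W) (toMfd I W) univ)

instance : Group (DiffBd C) where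
  mul φ ψ := ⟨ψ.1.trans φ.1, fun x hx => by
    change φ.1 (ψ.1 x) = x
    rw [ψ.2 x hx, φ.2 x hx]⟩
  one := ⟨Diffeomorph.refl I W ∞, fun _ _ => rfl⟩
  inv φ := ⟨φ.1.symm, fun x hx => by
    conv_lhs => rw [← φ.2 x hx]
    exact φ.1.symm_apply_apply x⟩
  mul_assoc _ _ _ := rfl
  one_mul _ := rfl
  mul_one _ := rfl
  inv_mul_cancel φ := Subtype.ext (Diffeomorph.ext fun x => φ.1.symm_apply_apply x)

/-- The tangent map of the inverse of a diffeomorphism. -/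
def tangentInv (φ : DiffBd C) : C(TangentBundle I W, TangentBundle I W) :=
  ⟨tangentMap I I φ.1.symm, φ.1.symm.contMDiff.continuous_tangentMap (by simp)⟩

/-- The action of diffeomorphisms on `θ`-framings, `φ · ℓ = ℓ ∘ Tφ⁻¹`. -/
instance : MulAction (DiffBd C) (Fr θ I W) where
  smul φ ℓ := ⟨ℓ.1.comp φ.tangentInv, fun b => by
    obtain ⟨x, ψ, h⟩ := ℓ.2 (φ.1.symm b)
    exact ⟨x, ((φ.1.symm.mfderivToContinuousLinearEquiv (by simp) b).toLinearEquiv).trans ψ,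
      fun y => h _⟩⟩
  one_smul ℓ := Subtype.ext (ContinuousMap.ext fun p => by
    change ℓ.1 (tangentMap I I id p) = ℓ.1 p
    rw [tangentMap_id]
    rfl)
  mul_smul φ ψ ℓ := Subtype.ext (ContinuousMap.ext fun p => by
    change ℓ.1 (tangentMap I I (ψ.1.symm ∘ φ.1.symm) p) =
      ℓ.1 (tangentMap I I ψ.1.symm (tangentMap I I φ.1.symm p))
    rw [tangentMap_comp (ψ.1.symm.contMDiff.mdifferentiable (by simp))
      (φ.1.symm.contMDiff.mdifferentiable (by simp))]
    rfl)

end DiffBd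

/-! ### Moduli spaces -/

variable (ℓW : Fr θ I W) (C : Collar I W)

/-- The space `Fr^θ_∂(W)` of `θ`-framings that agree with `ℓW` on the collar. -/
def FrBd : Type u :=
  {ℓ : Fr θ I W // ∀ x ∈ C.carrier, ∀ y : TangentSpace I x, ℓ.1 ⟨x, y⟩ = ℓW.1 ⟨x, y⟩}

instance : TopologicalSpace (FrBd ℓW C) :=
  inferInstanceAs (TopologicalSpace
    {ℓ : Fr θ I W // ∀ x ∈ C.carrier, ∀ y : TangentSpace I x, ℓ.1 ⟨x, y⟩ = ℓW.1 ⟨x, y⟩})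

/-- `ℓW` itself, as a point of `Fr^θ_∂(W)`. -/
def FrBd.base : FrBd ℓW C := ⟨ℓW, fun _ _ _ => rfl⟩

variable {C} in
theorem DiffBd.tangentInv_of_mem (φ : DiffBd C) {x : W} (hx : x ∈ C.carrier)
    (y : TangentSpace I x) : φ.tangentInv ⟨x, y⟩ = ⟨x, y⟩ := by
  have h : (φ.1.symm : W → W) =ᶠ[𝓝 x] id := by
    filter_upwards [C.isOpen.mem_nhds hx] with z hz using (φ⁻¹).2 z hz
  refine TotalSpace.ext h.eq_of_nhds (heq_of_eq ?_)
  change mfderiv I I φ.1.symm x y = y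
  rw [h.mfderiv_eq, mfderiv_id]
  rfl

instance : MulAction (DiffBd C) (FrBd ℓW C) where
  smul φ ℓ := ⟨φ • ℓ.1, fun x hx y => by
    change ℓ.1.1 (φ.tangentInv ⟨x, y⟩) = _
    rw [φ.tangentInv_of_mem hx]
    exact ℓ.2 x hx y⟩
  one_smul ℓ := Subtype.ext (one_smul _ ℓ.1)
  mul_smul φ ψ ℓ := Subtype.ext (mul_smul φ ψ ℓ.1)

variable {ℓW C} in
theorem FrBd.continuous_smul (φ : DiffBd C) : Continuous (fun ℓ : FrBd ℓW C => φ • ℓ) :=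
  ((((ContinuousMap.continuous_precomp φ.tangentInv).comp continuous_subtype_val).subtype_mk
    (fun ℓ : Fr θ I W => (φ • ℓ).2)).comp continuous_subtype_val).subtype_mk _

/-- The space `Fr^θ_∂(W, ℓW)`: the path components of `Fr^θ_∂(W)` that meet the orbit of `ℓW`. -/
def FrOrbit : Type u := {ℓ : FrBd ℓW C // ∃ φ : DiffBd C, Joined ℓ (φ • FrBd.base ℓW C)}

instance : TopologicalSpace (FrOrbit ℓW C) :=
  inferInstanceAs (TopologicalSpace
    {ℓ : FrBd ℓW C // ∃ φ : DiffBd C, Joined ℓ (φ • FrBd.base ℓW C)})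

/-- `ℓW` itself, as a point of `Fr^θ_∂(W, ℓW)`. -/
def FrOrbit.base : FrOrbit ℓW C := ⟨FrBd.base ℓW C, 1, by rw [one_smul]⟩

instance : MulAction (DiffBd C) (FrOrbit ℓW C) where
  smul φ ℓ := ⟨φ • ℓ.1, by
    obtain ⟨ψ, ⟨h⟩⟩ := ℓ.2
    refine ⟨φ * ψ, ?_⟩
    rw [mul_smul]
    exact ⟨h.map (FrBd.continuous_smul φ)⟩⟩
  one_smul ℓ := Subtype.ext (one_smul _ ℓ.1)
  mul_smul φ ψ ℓ := Subtype.ext (mul_smul φ ψ ℓ.1)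

instance : MulAction (DiffBd C) (Kify (FrOrbit ℓW C)) :=
  inferInstanceAs (MulAction (DiffBd C) (FrOrbit ℓW C))

/-- The moduli space `M^θ_∂(W, ℓW)`: the homotopy quotient of `Fr^θ_∂(W, ℓW)` by the group of
diffeomorphisms. -/
def ModuliSpace : TopCat.{u} := HomotopyQuotient (DiffBd C) (Kify (FrOrbit ℓW C))

/-- The basepoint of the moduli space given by `ℓW`. -/
def ModuliSpace.base : ModuliSpace ℓW C :=
  (groupBar (DiffBd C) (Kify (FrOrbit ℓW C))).vertex (FrOrbit.base ℓW C)

/-- The space of framed embeddings of `J × D^d` into `W`, where the `θ`-framing of `W` is allowed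
to vary in `Fr^θ_∂(W, ℓW)`. -/
abbrev VarEmb (J : Type) : Type u :=
  {a : RawEmb θ I W J × FrOrbit ℓW C // IsFramedEmb ℓ₀ a.2.1.1 a.1}

/-- The symmetric sequence of framed embeddings with varying `θ`-framing. -/
def varEmbSeq : SymSeq.{u} where
  obj := VarEmb ℓ₀ ℓW C
  top _ := inferInstance
  reindex e a := ⟨(a.1.1.reindex e, a.1.2), a.2.reindex e⟩
  reindex_refl _ := rfl
  reindex_trans _ _ _ := rfl

/-- The right action of `E^θ_d` by composition. -/
def varEmbAction : (varEmbSeq ℓ₀ ℓW C).RightAction (discOperad ℓ₀).toSymSeq where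
  comp a b := ⟨(a.1.1.comp a.2.start b, a.1.2), a.2.comp b⟩
  comp_reindex_left _ _ _ := rfl
  comp_reindex_right _ _ _ := rfl

theorem extendDisc_postcomp {M M' : Type v} (φ : M → M') (a : Disc d → M) :
    extendDisc (fun x => φ (a x)) = φ ∘ extendDisc a := by
  funext x
  by_cases hx : x ∈ ballSet d <;> simp [extendDisc, hx]

/-- The composite of an embedded disc with a diffeomorphism. -/
def DiscEmb.postcomp {C : Collar I W} (φ : DiffBd C) (a : DiscEmb I W) : DiscEmb I W :=
  ⟨fun x => φ.1 (a.1 x), fun _ _ h => a.2.injective (φ.1.injective h), by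
    rw [extendDisc_postcomp]
    exact φ.1.contMDiff.comp_contMDiffOn a.2.smooth, fun x hx => by
    rw [extendDisc_postcomp, mfderiv_comp_mfderivWithin x
      (φ.1.contMDiff.mdifferentiable (by simp) _)
      ((a.2.smooth x hx).mdifferentiableWithinAt (by simp)) (uniqueMDiffOn_ballSet x hx)]
    exact ((φ.1.mfderivToContinuousLinearEquiv (by simp) _).injective).comp
      (a.2.immersive x hx)⟩

theorem Fr.pull_postcomp {C : Collar I W} (φ : DiffBd C) (ℓ : Fr θ I W) (a : DiscEmb I W) :
    Fr.pull (φ • ℓ) (a.postcomp φ) = Fr.pull ℓ a := by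
  refine Subtype.ext (ContinuousMap.ext fun p => congrArg ℓ.1 ?_)
  have hp : p.1.1 ∈ ballSet d := p.1.2
  have h₁ := tangentMapWithin_comp_at (I := 𝓘(ℝ, Euc d)) (I' := I) (I'' := I)
    (g := φ.1.symm) (f := extendDisc (a.postcomp φ).1) (s := ballSet d) (u := univ) (discVec p)
    (φ.1.symm.contMDiff.mdifferentiable (by simp) _).mdifferentiableWithinAt
    (((a.postcomp φ).2.smooth _ hp).mdifferentiableWithinAt (by simp)) (fun _ _ => mem_univ _)
    (uniqueMDiffOn_ballSet _ hp)
  have h₂ : φ.1.symm ∘ extendDisc (a.postcomp φ).1 = extendDisc a.1 := by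
    funext x
    change φ.1.symm (extendDisc (fun x => φ.1 (a.1 x)) x) = _
    rw [extendDisc_postcomp]
    exact φ.1.symm_apply_apply _
  rw [h₂, tangentMapWithin_univ] at h₁
  exact h₁.symm

/-- The action of diffeomorphisms on framed embeddings,
`φ · (α, t, γ, ℓ) = (φ ∘ α, t, γ, ℓ ∘ Tφ⁻¹)`. -/
instance (J : Type) : MulAction (DiffBd C) (VarEmb ℓ₀ ℓW C J) where
  smul φ a := ⟨((fun j => (a.1.1.1 j).postcomp φ, a.1.1.2), φ • a.1.2),
    { injective := φ.1.injective.comp a.2.injective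
      start := a.2.start
      finish := fun j s hs => (a.2.finish j s hs).trans (Fr.pull_postcomp φ _ _).symm }⟩
  one_smul a := Subtype.ext (Prod.ext rfl (one_smul _ a.1.2))
  mul_smul φ ψ a := Subtype.ext (Prod.ext rfl (mul_smul φ ψ a.1.2))

/-- The induced action on `∐ r, Emb(r × D^d, W) ×_{𝔖_r} X^r`. -/
instance (X : TopCat.{u}) : MulAction (DiffBd C) ((varEmbSeq ℓ₀ ℓW C).free X) where
  smul φ := Quot.map
    (fun z => ⟨z.1, (HSMul.hSMul (β := VarEmb ℓ₀ ℓW C (Fin z.1)) φ z.2.1, z.2.2)⟩) (by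
    rintro ⟨r, s, x⟩ ⟨r', b⟩ ⟨e, h⟩
    change Fin r' ≃ Fin r at e
    obtain rfl : b = ((varEmbSeq ℓ₀ ℓW C).reindex e s, x ∘ e) := h
    exact ⟨e, rfl⟩)
  one_smul := by
    rintro ⟨r, s, x⟩
    exact congrArg (fun s' : VarEmb ℓ₀ ℓW C (Fin r) =>
      Quot.mk ((varEmbSeq ℓ₀ ℓW C).Rel X) (Sigma.mk r (s', x)))
      (one_smul (DiffBd C) (α := VarEmb ℓ₀ ℓW C (Fin r)) s)
  mul_smul φ ψ := by
    rintro ⟨r, s, x⟩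
    exact congrArg (fun s' : VarEmb ℓ₀ ℓW C (Fin r) =>
      Quot.mk ((varEmbSeq ℓ₀ ℓW C).Rel X) (Sigma.mk r (s', x)))
      (mul_smul (β := VarEmb ℓ₀ ℓW C (Fin r)) φ ψ s)

/-- The right functor `X ↦ (∐ r, Emb(r × D^d, W) ×_{𝔖_r} X^r) // Diff_∂(W)`. -/
def moduliFunctor : RightFunctorData (discOperad ℓ₀).monad where
  obj X := HomotopyQuotient (DiffBd C) ((varEmbSeq ℓ₀ ℓW C).free X)
  map f := homotopyQuotientMap ((varEmbSeq ℓ₀ ℓW C).freeMap f) (by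
    rintro φ ⟨z⟩
    rfl)
  act X := homotopyQuotientMap ((varEmbAction ℓ₀ ℓW C).act X) (by
    rintro φ ⟨z⟩
    rfl)

variable {A : Type u} [TopologicalSpace A] (α : (discOperad ℓ₀).Algebra A)

/-- The moduli space `W^θ[A]` of manifolds of type `W` with decorations in `A`. -/
def DecoratedModuliSpace : TopCat.{u} :=
  (MonadData.bar (moduliFunctor ℓ₀ ℓW C) α.structureMap).realisation

/-- The inclusion of framed embeddings with fixed `θ`-framing `ℓW`. -/
def fixedToVar (X : TopCat.{u}) :
    (framedEmbSeq ℓ₀ ℓW).free X → (varEmbSeq ℓ₀ ℓW C).free X :=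
  Quot.map (fun z => ⟨z.1, ⟨(z.2.1.1, FrOrbit.base ℓW C), z.2.1.2⟩, z.2.2⟩) (by
    rintro ⟨r, s, x⟩ ⟨r', b⟩ ⟨e, h⟩
    change Fin r' ≃ Fin r at e
    obtain rfl : b = ((framedEmbSeq ℓ₀ ℓW).reindex e s, x ∘ e) := h
    exact ⟨e, rfl⟩)

/-- The inclusion of framed embeddings with fixed `θ`-framing into the homotopy quotient. -/
def embToModuli : (embFunctor ℓ₀ ℓW).Hom (moduliFunctor ℓ₀ ℓW C) where
  app X z := (groupBar (DiffBd C) ((varEmbSeq ℓ₀ ℓW C).free X)).vertex (fixedToVar ℓ₀ ℓW C X z)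
  map f := by
    rintro ⟨z⟩
    rfl
  act X := by
    rintro ⟨z⟩
    rfl

/-- The map `∫^θ_W A → W^θ[A]`. -/
def fibreInclusion : FactorisationHomology ℓ₀ ℓW α → DecoratedModuliSpace ℓ₀ ℓW C α :=
  ((embToModuli ℓ₀ ℓW C).bar α.structureMap).realise

/-- The map that forgets the embedded discs and only remembers the `θ`-framing of `W`. -/
def forgetDiscs (X : TopCat.{u}) : (varEmbSeq ℓ₀ ℓW C).free X → Kify (FrOrbit ℓW C) :=
  Quot.lift (fun z => z.2.1.1.2) (by
    rintro ⟨r, s, x⟩ ⟨r', b⟩ ⟨e, h⟩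
    change Fin r' ≃ Fin r at e
    obtain rfl : b = ((varEmbSeq ℓ₀ ℓW C).reindex e s, x ∘ e) := h
    rfl)

/-- The map induced by `forgetDiscs` on homotopy quotients. -/
def forgetModuli (X : TopCat.{u}) : (moduliFunctor ℓ₀ ℓW C).obj X → ModuliSpace ℓW C :=
  homotopyQuotientMap (forgetDiscs ℓ₀ ℓW C X) (by
    rintro φ ⟨z⟩
    rfl)

theorem forgetModuli_map {X Y : TopCat.{u}} (f : X → Y) (z : (moduliFunctor ℓ₀ ℓW C).obj X) :
    forgetModuli ℓ₀ ℓW C Y ((moduliFunctor ℓ₀ ℓW C).map f z) = forgetModuli ℓ₀ ℓW C X z := by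
  refine homotopyQuotientMap_comp_eq _ _ _ _ _ _ ?_ z
  rintro ⟨y⟩
  rfl

theorem forgetModuli_act (X : TopCat.{u})
    (z : (moduliFunctor ℓ₀ ℓW C).obj ((discOperad ℓ₀).monad.obj X)) :
    forgetModuli ℓ₀ ℓW C X ((moduliFunctor ℓ₀ ℓW C).act X z) = forgetModuli ℓ₀ ℓW C _ z := by
  refine homotopyQuotientMap_comp_eq _ _ _ _ _ _ ?_ z
  rintro ⟨y⟩
  rfl

/-- The map `W^θ[A] → M^θ_∂(W, ℓW)` that forgets the decorations. -/
def moduliProjection : DecoratedModuliSpace ℓ₀ ℓW C α → ModuliSpace ℓW C :=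
  (MonadData.bar (moduliFunctor ℓ₀ ℓW C) α.structureMap).augment
    (fun _ => forgetModuli ℓ₀ ℓW C _)
    (fun p i x => by
      refine Fin.cases ?_ (fun j => ?_) i
      · exact forgetModuli_act ℓ₀ ℓW C _ x
      · exact forgetModuli_map ℓ₀ ℓW C _ x)
    (fun p i x => forgetModuli_map ℓ₀ ℓW C _ x)

end Moduli

end DecoratedModuli

end

open DecoratedModuli

noncomputable section

set_option autoImplicit false

open Topology

namespace DecoratedModuli

/-! The projection `q` is a fibration in the sense needed for homotopy groups, and its strict fibre
over `[ℓ_W]` is `∫_W A`. More precisely, `q` lifts homotopies parametrised by compact metric spaces,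
and `ι` is a homeomorphism onto the fibre. The first fact allows the comparison map from the fibre
to the homotopy fibre to be inverted up to deformation, relative to the boundary of a cube
(`isHomotopyFibreSequence_of_lifting`). Homotopy lifting is local in the base
(`exists_lift_of_cover`), so it suffices to lift over the members of an open cover of the moduli
space (`liftsOver_moduliChart`).

The cover comes from the universal bundle of `G = Diff_∂(W)`. A point of a homotopy quotient is
given by barycentric weights, homogeneous group coordinates and a point of the `G`-space. After
discarding zero weights and merging equal neighbours, the weighted coordinates are well defined up
to right translation. Well-pointedness presents `1 ∈ G` as a neighbourhood deformation retract
(`nonempty_unitNDR`). With it, a sequence close to a degenerate one can be pushed, equivariantly,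
onto a shorter one. The `n`-th chart consists of the points that are pushed in this way onto
nondegenerate sequences with `n + 1` entries, and the last entry of the result is an equivariant
local section. Its continuity, and the openness of its domain, is `goodAt_red`.

Over such a chart, `untwist` reads off a point of the `G`-space and `twist` puts it back over a
given base point. Both are natural, so they can be applied levelwise to the bar construction with
coefficients in `A` (`twistAll_untwistAll`). A decorated manifold over the chart thus becomes a
point of the base together with a decorated framed embedding whose framing is the one prescribed by
the base point. To lift a homotopy, the framing has to be moved along a path while the discs stay in
place. This is done by appending the path of framings to the Moore path of every disc. Discs are
inserted at the start of the Moore paths and framings are moved at their end, and Moore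
concatenation is strictly associative, so transport strictly commutes with the operad action
(`transportEmb_comp`) and passes to realisations.

The section equips every framing with the empty configuration of discs, which is an equivariant
choice (`exists_section`).

Products are k-ified, and some maps, such as transport, are continuous only on a closed subset.
Continuity is therefore tested throughout on maps from compact Hausdorff spaces into open or closed
subsets. -/

/-! ### Testing continuity on compact Hausdorff spaces -/

section Kification

/-- The product of a quotient map with a locally compact space is a quotient map. -/
theorem isQuotientMap_prodMap_id {X : Type*} {Y : Type*} {K : Type*} [TopologicalSpace X]
    [TopologicalSpace Y] [TopologicalSpace K] [LocallyCompactSpace K] {pr : X → Y}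
    (hpr : IsQuotientMap pr) : IsQuotientMap (Prod.map pr (id : K → K)) := by
  refine ⟨isCoinducing_iff.2 fun s => ⟨fun hs => ?_, fun hs =>
    hs.preimage (hpr.continuous.prodMap continuous_id)⟩, hpr.surjective.prodMap surjective_id⟩
  -- Open sets are regarded as continuous maps to the Sierpiński space `Prop`, to which the descent
  -- of maps along `pr × id` applies.
  exact isOpen_iff_continuous_mem.2
    (hpr.continuous_lift_prod_left (g := fun z => z ∈ s) (isOpen_iff_continuous_mem.1 hs))

/-- A compactly generated `X` is a quotient of the disjoint union `E` of its test spaces.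
Multiplying by the locally compact `K` keeps this a quotient map, and the summands become compact
Hausdorff. Hence products with simplices need no k-ification. -/
instance {X : Type u} [TopologicalSpace X] [CompactlyGeneratedSpace X] {K : Type v}
    [TopologicalSpace K] [CompactSpace K] [T2Space K] :
    UCompactlyGeneratedSpace.{max u v} (X × K) := by
  refine uCompactlyGeneratedSpace_of_isOpen fun s hs => ?_
  let E : Type _ := Σ i : (Σ S : CompHaus.{u}, C(S, X)), i.1
  let pr : E → X := fun z => z.1.2 z.2
  have hpr : IsQuotientMap pr := by
    refine ⟨isCoinducing_iff.2 fun t => ?_, fun x => ?_⟩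
    · refine ⟨fun h => ?_, fun h => isOpen_sigma_iff.2 fun i => h.preimage i.2.continuous⟩
      exact UCompactlyGeneratedSpace.isOpen fun S g => isOpen_sigma_iff.1 h ⟨S, g⟩
    · exact ⟨⟨⟨CompHaus.of PUnit, ContinuousMap.const _ x⟩, PUnit.unit⟩, rfl⟩
  rw [← (isQuotientMap_prodMap_id (K := K) hpr).isOpen_preimage]
  rw [← (Homeomorph.sigmaProdDistrib).symm.isOpen_preimage]
  refine isOpen_sigma_iff.2 fun i => ?_
  have h := hs (CompHaus.of (ULift.{max u v} (i.1 × K)))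
    ⟨fun z => (i.2 z.down.1, z.down.2), by fun_prop⟩
  exact h.preimage continuous_uliftUp

instance {X : Type u} [TopologicalSpace X] [CompactlyGeneratedSpace X] {K : Type v}
    [TopologicalSpace K] [CompactSpace K] [T2Space K] :
    UCompactlyGeneratedSpace.{max u v} (K × X) := by
  refine uCompactlyGeneratedSpace_of_coinduced (X := X × K) (f := Prod.swap) continuous_swap ?_
  exact (Homeomorph.prodComm X K).isQuotientMap.eq_coinduced

/-- The identity, as a map from the k-ification. -/
def ofKify {X : Type u} (x : Kify X) : X := x

/-- The identity, as a map to the k-ification. -/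
def toKify {X : Type u} (x : X) : Kify X := x

/-- Every test map into `X` stays continuous as a map into `Kify X`, so both spaces have the same
test maps. -/
instance (X : Type u) [TopologicalSpace X] : CompactlyGeneratedSpace (Kify X) := by
  refine uCompactlyGeneratedSpace_of_isOpen fun s hs => ?_
  refine isOpen_coinduced.2 (isOpen_sigma_iff.2 fun i => ?_)
  refine hs i.1 ⟨fun z => toKify (i.2 z), ?_⟩
  refine continuous_def.2 fun t ht => ?_
  exact isOpen_sigma_iff.1 (isOpen_coinduced.1 ht) i

theorem continuous_ofKify {X : Type u} [TopologicalSpace X] :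
    Continuous (ofKify : Kify X → X) := by
  refine continuous_def.2 fun t ht => isOpen_coinduced.2 (isOpen_sigma_iff.2 fun i => ?_)
  exact ht.preimage i.2.continuous

/-- Continuity of maps into a k-ification can be checked before k-ifying. -/
theorem continuous_kify_iff {X : Type u} {S : Type v} [TopologicalSpace X] [TopologicalSpace S]
    [UCompactlyGeneratedSpace.{u} S] {f : S → Kify X} :
    Continuous f ↔ Continuous (fun s => ofKify (f s)) := by
  refine ⟨fun h => continuous_ofKify.comp h, fun h => ?_⟩
  refine continuous_from_uCompactlyGeneratedSpace _ fun T g => continuous_def.2 fun t ht => ?_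
  exact isOpen_sigma_iff.1 (isOpen_coinduced.1 ht) ⟨T, ⟨fun x => ofKify (f (g x)), h.comp g.2⟩⟩

instance {X : Type u} [TopologicalSpace X] [T2Space X] : T2Space (Kify X) :=
  T2Space.of_injective_continuous (f := (ofKify : Kify X → X)) injective_id continuous_ofKify

instance {X : Type u} [TopologicalSpace X] [CompactlyGeneratedSpace X] (r : X → X → Prop) :
    CompactlyGeneratedSpace (Quot r) :=
  uCompactlyGeneratedSpace_of_coinduced continuous_quot_mk rfl

end Kification

section Test

variable {X : Type u} [TopologicalSpace X] {Z : Type v} [TopologicalSpace Z]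

/-- On an open or closed subset of a compactly generated space, continuity can be tested on maps
from compact Hausdorff spaces into the subset. -/
theorem continuousOn_of_test [CompactlyGeneratedSpace X] {R : Set X} (hR : IsOpen R ∨ IsClosed R)
    {f : X → Z} (h : ∀ (S : Type u) [TopologicalSpace S] [CompactSpace S] [T2Space S] (g : S → X),
      Continuous g → (∀ s, g s ∈ R) → Continuous (fun s => f (g s))) : ContinuousOn f R := by
  rcases hR with hR | hR
  · rw [continuousOn_open_iff hR]
    intro t ht
    refine CompactlyGeneratedSpace.isOpen' fun S _ _ _ g hg => ?_
    rw [isOpen_iff_mem_nhds]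
    intro s hs
    -- The preimage of an open `R` need not be compact, but each of its points has a compact
    -- neighbourhood inside it, which serves as a test space. For closed `R` the whole preimage is
    -- compact.
    obtain ⟨K, hK, hKs, hKR⟩ := local_compact_nhds ((hR.preimage hg).mem_nhds hs.1)
    have := isCompact_iff_compactSpace.1 hKR
    have h' := h K (fun s => g s) (hg.comp continuous_subtype_val) (fun s => hKs s.2)
    have h'' : ContinuousOn (fun s => f (g s)) K := continuousOn_iff_continuous_domRestrict.2 h'
    have h₃ : ContinuousAt (fun s => f (g s)) s := h''.continuousAt hK
    exact Filter.inter_mem ((hR.preimage hg).mem_nhds hs.1) (h₃ (ht.mem_nhds hs.2))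
  · rw [continuousOn_iff_isClosed]
    intro t ht
    refine ⟨f ⁻¹' t ∩ R, ?_, by rw [inter_assoc, inter_self]⟩
    refine CompactlyGeneratedSpace.isClosed' fun S _ _ _ g hg => ?_
    have hc : IsClosed (g ⁻¹' R) := hR.preimage hg
    have := isCompact_iff_compactSpace.1 hc.isCompact
    have h' := h (g ⁻¹' R) (fun s => g s) (hg.comp continuous_subtype_val) (fun s => s.2)
    have h₂ := hc.isClosedEmbedding_subtypeVal.isClosedMap _ (ht.preimage h')
    convert h₂ using 1
    ext s
    constructor
    · exact fun hs => ⟨⟨s, hs.2⟩, hs.1, rfl⟩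
    · rintro ⟨s, hs, rfl⟩
      exact ⟨hs, s.2⟩

/-- A quotient map restricts to a quotient map over open and over closed subsets, though not over
arbitrary ones; this explains the assumption on `R`. -/
theorem continuousOn_of_isQuotientMap {D : Type w} [TopologicalSpace D] {pr : D → X}
    (hpr : IsQuotientMap pr) {R : Set X} (hR : IsOpen R ∨ IsClosed R) {f : X → Z}
    (h : ContinuousOn (f ∘ pr) (pr ⁻¹' R)) : ContinuousOn f R := by
  rcases hR with hR | hR
  · rw [continuousOn_open_iff hR]
    intro t ht
    rw [← hpr.isOpen_preimage]
    exact (continuousOn_open_iff (hR.preimage hpr.continuous)).1 h t ht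
  · rw [continuousOn_iff_isClosed] at h ⊢
    intro t ht
    refine ⟨f ⁻¹' t ∩ R, ?_, by rw [inter_assoc, inter_self]⟩
    rw [← hpr.isClosed_preimage]
    obtain ⟨c, hc, hc'⟩ := h t ht
    have : pr ⁻¹' (f ⁻¹' t ∩ R) = c ∩ pr ⁻¹' R := by rw [← hc']; rfl
    rw [this]
    exact hc.inter (hR.preimage hpr.continuous)

/-- Let `X` be a quotient of a disjoint union of compactly generated spaces `D i`. On an open or
closed subset of `X × S`, continuity can be tested on maps from compact Hausdorff spaces to the
products `D i × S`. -/
theorem continuousOn_quotient_test {ι : Type} {D : ι → Type u} [∀ i, TopologicalSpace (D i)]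
    [∀ i, CompactlyGeneratedSpace (D i)] {pr : ∀ i, D i → X}
    (hpr : IsQuotientMap (fun z : Σ i, D i => pr z.1 z.2)) {S : Type u} [TopologicalSpace S]
    [CompactSpace S] [T2Space S] {R : Set (X × S)} (hR : IsOpen R ∨ IsClosed R) {f : X × S → Z}
    (h : ∀ (i : ι) (T : Type u) [TopologicalSpace T] [CompactSpace T] [T2Space T] (d : T → D i)
      (σ : T → S), Continuous d → Continuous σ → (∀ x, (pr i (d x), σ x) ∈ R) →
      Continuous (fun x => f (pr i (d x), σ x))) : ContinuousOn f R := by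
  refine continuousOn_of_isQuotientMap (isQuotientMap_prodMap_id (K := S) hpr) hR ?_
  refine continuousOn_of_isQuotientMap
    (Homeomorph.sigmaProdDistrib (X := D) (Y := S)).symm.isQuotientMap ?_ ?_
  · exact hR.imp (fun h => h.preimage (hpr.continuous.prodMap continuous_id))
      (fun h => h.preimage (hpr.continuous.prodMap continuous_id))
  have hc : Continuous (fun z : Σ i, D i × S => ((pr z.1 z.2.1, z.2.2) : X × S)) := by
    have := (hpr.continuous.prodMap (continuous_id (X := S))).comp
      (Homeomorph.sigmaProdDistrib (X := D) (Y := S)).symm.continuous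
    exact this
  have hci : ∀ i, Continuous (fun z : D i × S => ((pr i z.1, z.2) : X × S)) := fun i =>
    hc.comp (continuous_sigmaMk (σ := fun i => D i × S) (i := i))
  have key : ∀ i, ContinuousOn (fun z : D i × S => f (pr i z.1, z.2))
      ((fun z : D i × S => (pr i z.1, z.2)) ⁻¹' R) := fun i => by
    refine continuousOn_of_test ?_ fun T _ _ _ g hg hgR => ?_
    · exact hR.imp (fun h => h.preimage (hci i)) (fun h => h.preimage (hci i))
    · exact h i T (fun x => (g x).1) (fun x => (g x).2) (continuous_fst.comp hg)
        (continuous_snd.comp hg) hgR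
  -- Each summand is open in the disjoint union, so continuity within the preimage of `R` can be
  -- checked on it.
  rintro ⟨i, z⟩ hz
  have h₁ := key i z hz
  have he := (IsOpenEmbedding.sigmaMk (σ := fun i => D i × S) (i := i))
  have hr : range (Sigma.mk (β := fun i => D i × S) i) ∈ 𝓝 ⟨i, z⟩ :=
    he.isOpen_range.mem_nhds ⟨z, rfl⟩
  rw [ContinuousWithinAt, ← nhdsWithin_inter_of_mem' (mem_nhdsWithin_of_mem_nhds hr),
    ← image_preimage_eq_inter_range, ← he.isEmbedding.map_nhdsWithin_eq]
  exact h₁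

end Test

/-! ### Lifting of homotopies -/

section Lifting

/-- By the tube lemma, `e` is close to `b` on all of `{s} × K` for `s` near `s₀`. The second
coordinate `θ` may therefore be discontinuous. This handles ratios whose denominator vanishes at
`s₀`. -/
theorem tendsto_of_forall_slice_eq {S K B α : Type*} [TopologicalSpace S] [TopologicalSpace K]
    [CompactSpace K] [TopologicalSpace B] {e : S × K → B} (he : Continuous e) {s₀ : S} {b : B}
    (hb : ∀ r, e (s₀, r) = b) {l : Filter α} {g : α → S} (hg : Filter.Tendsto g l (𝓝 s₀))
    (θ : α → K) : Filter.Tendsto (fun x => e (g x, θ x)) l (𝓝 b) := by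
  intro V hV
  obtain ⟨V', hV', hoV, hbV⟩ := mem_nhds_iff.1 hV
  obtain ⟨N, M, hN, -, hsN, hM, hNM⟩ := generalized_tube_lemma (isCompact_singleton (x := s₀))
    (isCompact_univ (X := K)) (hoV.preimage he) (by
      rintro ⟨s, r⟩ ⟨hs, -⟩
      obtain rfl : s = s₀ := hs
      change e (s, r) ∈ V'
      rwa [hb])
  have hev : ∀ᶠ x in l, g x ∈ N := hg (hN.mem_nhds (hsN rfl))
  exact Filter.mem_map.2 (hev.mono fun x hx =>
    hV' (hNM (a := (g x, θ x)) ⟨hx, hM (mem_univ _)⟩))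

variable {X : Type u} {B : Type v} [TopologicalSpace X] [TopologicalSpace B]

/-- The homotopy lifting property of `q` with respect to compact Hausdorff spaces, for homotopies
with values in `U`. -/
def LiftsOver (q : X → B) (U : Set B) : Prop :=
  ∀ (K : Type) [TopologicalSpace K] [CompactSpace K] [T2Space K] (f : K → X) (H : K × ℝ → B),
    Continuous f → Continuous H → (∀ k, H (k, 0) = q (f k)) → (∀ z, H z ∈ U) →
    ∃ L : K × ℝ → X, Continuous L ∧ (∀ k, L (k, 0) = f k) ∧
      ∀ k, ∀ s ∈ Icc (0 : ℝ) 1, q (L (k, s)) = H (k, s)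

/-- Over `k`, the time interval is cut into pieces whose lengths are the values at `k` of a finite
partition of unity. The piece of `ρ j` is nontrivial only on the support of `ρ j`, where the
homotopy stays inside a single `U i` and can be lifted. -/
theorem exists_lift_of_locally {ι : Type*} {q : X → B} {U : ι → Set B}
    (hU : ∀ i, LiftsOver q (U i)) {K : Type} [TopologicalSpace K] [CompactSpace K] [T2Space K]
    {f : K → X} {H : K × ℝ → B} (hf : Continuous f) (hH : Continuous H)
    (hfH : ∀ k, H (k, 0) = q (f k))
    (hloc : ∀ k, ∃ i, ∃ V ∈ 𝓝 k, ∀ k' ∈ V, ∀ s ∈ Icc (0 : ℝ) 1, H (k', s) ∈ U i) :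
    ∃ L : K × ℝ → X, Continuous L ∧ (∀ k, L (k, 0) = f k) ∧
      ∀ k, ∀ s ∈ Icc (0 : ℝ) 1, q (L (k, s)) = H (k, s) := by
  classical
  choose i V hV hVU using hloc
  obtain ⟨t, ht⟩ := isCompact_univ.elim_nhds_subcover (fun k => interior (V k))
    (fun k _ => interior_mem_nhds.2 (hV k))
  obtain ⟨ρ, hρ⟩ := PartitionOfUnity.exists_isSubordinate (ι := t) isClosed_univ
    (fun k => interior (V k)) (fun _ => isOpen_interior) (by
      simpa only [iUnion_subtype] using ht.2)
  have hnn : ∀ (T : Finset t) k, 0 ≤ ∑ j ∈ T, ρ j k := fun T k =>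
    Finset.sum_nonneg fun j _ => ρ.nonneg j k
  have hle : ∀ (T : Finset t) k, ∑ j ∈ T, ρ j k ≤ 1 := fun T k => by
    have h1 := ρ.sum_eq_one (mem_univ k)
    rw [finsum_eq_sum_of_fintype] at h1
    rw [← h1]
    exact Finset.sum_le_sum_of_subset_of_nonneg (Finset.subset_univ _) fun j _ _ => ρ.nonneg j k
  -- At stage `T` the lift follows `H` only until time `∑ j ∈ T, ρ j k`, and covers a stationary
  -- homotopy afterwards.
  have key : ∀ T : Finset t, ∃ L : K × ℝ → X, Continuous L ∧ (∀ k, L (k, 0) = f k) ∧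
      ∀ k, ∀ s ∈ Icc (0 : ℝ) 1, q (L (k, s)) = H (k, min s (∑ j ∈ T, ρ j k)) := by
    intro T
    induction T using Finset.induction_on with
    | empty =>
      refine ⟨fun z => f z.1, hf.comp continuous_fst, fun _ => rfl, fun k s hs => ?_⟩
      rw [Finset.sum_empty, min_eq_right hs.1, hfH]
    | insert j T hj ih =>
      obtain ⟨L, hL, hL0, hLq⟩ := ih
      set σ : K → ℝ := fun k => ∑ j ∈ T, ρ j k with hσ
      have hσc : Continuous σ := continuous_finsetSum _ fun j _ => (ρ j).continuous
      have hρc : Continuous (ρ j) := (ρ j).continuous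
      have hle' : ∀ k, σ k + ρ j k ≤ 1 := fun k => by
        have := hle (insert j T) k
        rw [Finset.sum_insert hj] at this
        linarith
      set C : Set K := tsupport (ρ j) with hC
      have hCc : IsClosed C := isClosed_tsupport _
      have : CompactSpace C := isCompact_iff_compactSpace.1 hCc.isCompact
      have hCV : ∀ k ∈ C, k ∈ V j := fun k hk => interior_subset (hρ j hk)
      -- The homotopy is restarted at time `σ k` and stopped at `σ k + ρ j k`. The clamping keeps it
      -- in `U (i j)` for all real times, as `LiftsOver` requires.
      obtain ⟨M, hM, hM0, hMq⟩ := hU (i j) C (fun k => L (k, σ k))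
        (fun z => H (z.1, max 0 (min (σ z.1 + z.2) (σ z.1 + ρ j z.1))))
        (by fun_prop) (by fun_prop) (fun k => by
          rw [hLq _ _ ⟨hnn T k, hle T k⟩, min_self, add_zero,
            min_eq_left (le_add_of_nonneg_right (ρ.nonneg j _)), max_eq_right (hnn T k)])
        (fun z => hVU j _ (hCV _ z.1.2) _ ⟨le_max_left _ _, max_le zero_le_one
          ((min_le_right _ _).trans (hle' _))⟩)
      -- The support of `ρ j` and the zero set of `ρ j` are closed and cover `K`; on their overlap
      -- no time is available, so both formulas give `L (k, σ k)`.
      let N : K × ℝ → X := fun z => if h : z.1 ∈ C then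
        M (⟨z.1, h⟩, min (max (z.2 - σ z.1) 0) (ρ j z.1)) else L (z.1, σ z.1)
      have hN0 : ∀ z : K × ℝ, ρ j z.1 = 0 → N z = L (z.1, σ z.1) := fun z hz => by
        by_cases h : z.1 ∈ C
        · simp only [N, dif_pos h]
          rw [hz, min_eq_right (le_max_right _ _), hM0]
        · simp only [N, dif_neg h]
      have hN1 : ∀ z : K × ℝ, z.2 ≤ σ z.1 → N z = L (z.1, σ z.1) := fun z hz => by
        by_cases h : z.1 ∈ C
        · simp only [N, dif_pos h]
          rw [max_eq_right (by linarith), min_eq_left (ρ.nonneg j _), hM0]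
        · simp only [N, dif_neg h]
      have hNc : Continuous N := by
        have h₁ : ContinuousOn N (Prod.fst ⁻¹' C) := by
          rw [continuousOn_iff_continuous_domRestrict]
          have : Continuous (fun z : (Prod.fst ⁻¹' C : Set (K × ℝ)) =>
              M (⟨z.1.1, z.2⟩, min (max (z.1.2 - σ z.1.1) 0) (ρ j z.1.1))) := by fun_prop
          refine this.congr fun z => ?_
          simp only [domRestrict_apply, N]
          rw [dif_pos (show z.1.1 ∈ C from z.2)]
        have h₂ : ContinuousOn N (Prod.fst ⁻¹' (ρ j ⁻¹' {0})) := by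
          refine ContinuousOn.congr (f := fun z => L (z.1, σ z.1)) (by fun_prop) fun z hz => hN0 z hz
        rw [← continuousOn_univ]
        have := h₁.union_of_isClosed h₂ (hCc.preimage continuous_fst)
          ((isClosed_singleton.preimage hρc).preimage continuous_fst)
        convert this using 1
        symm
        rw [eq_univ_iff_forall]
        intro z
        by_cases h : z.1 ∈ C
        · exact Or.inl h
        · exact Or.inr (image_eq_zero_of_notMem_tsupport h)
      refine ⟨fun z => if z.2 ≤ σ z.1 then L z else N z, ?_, fun k => ?_, fun k s hs => ?_⟩
      · refine Continuous.if_le hL hNc continuous_snd (hσc.comp continuous_fst) fun z hz => ?_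
        rw [hN1 z hz.le, ← hz]
      · exact (if_pos (hnn T k)).trans (hL0 k)
      · rw [Finset.sum_insert hj, add_comm]
        dsimp only
        by_cases h : s ≤ σ k
        · rw [if_pos h, hLq k s hs, min_eq_left h, min_eq_left]
          exact h.trans (le_add_of_nonneg_right (ρ.nonneg j _))
        · rw [if_neg h]
          push Not at h
          by_cases hk : k ∈ C
          · simp only [N, dif_pos hk]
            have hρ1 : ρ j k ≤ 1 := by linarith [hle' k, hnn T k]
            rw [hMq _ _ ⟨le_min (le_max_right _ _) (ρ.nonneg j _), (min_le_right _ _).trans hρ1⟩]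
            congr 2
            dsimp only
            rw [max_eq_left (a := s - σ k) (by linarith), ← min_add_add_left, add_sub_cancel, min_assoc, min_self,
              max_eq_right]
            exact le_min hs.1 (add_nonneg (hnn T k) (ρ.nonneg j k))
          · have h0 : ρ j k = 0 := image_eq_zero_of_notMem_tsupport hk
            rw [hN0 _ h0, hLq _ _ ⟨hnn T k, hle T k⟩, h0, add_zero, min_self, min_eq_right h.le]
  obtain ⟨L, hL, hL0, hLq⟩ := key Finset.univ
  refine ⟨L, hL, hL0, fun k s hs => ?_⟩
  have h1 := ρ.sum_eq_one (mem_univ k)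
  rw [finsum_eq_sum_of_fintype] at h1
  rw [hLq k s hs, h1, min_eq_left hs.2]

/-- The homotopy lifting property with respect to compact metric spaces is local in the base. -/
theorem exists_lift_of_cover {ι : Type*} {q : X → B} {U : ι → Set B}
    (hU : ∀ i, LiftsOver q (U i)) (hopen : ∀ i, IsOpen (U i)) (hcov : ∀ b, ∃ i, b ∈ U i)
    {K : Type} [MetricSpace K] [CompactSpace K]
    {f : K → X} {H : K × ℝ → B} (hf : Continuous f) (hH : Continuous H)
    (hfH : ∀ k, H (k, 0) = q (f k)) :
    ∃ L : K × ℝ → X, Continuous L ∧ (∀ k, L (k, 0) = f k) ∧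
      ∀ k, ∀ s ∈ Icc (0 : ℝ) 1, q (L (k, s)) = H (k, s) := by
  -- With time steps `1 / (N + 1) < δ`, each product of a `δ`-ball and a time step is mapped into
  -- one member of the cover.
  obtain ⟨δ, hδ, hball⟩ := lebesgue_number_lemma_of_metric
    ((isCompact_univ (X := K)).prod (isCompact_Icc (a := (0 : ℝ)) (b := 1)))
    (fun i => (hopen i).preimage hH) (fun z _ => by
      obtain ⟨i, hi⟩ := hcov (H z)
      exact mem_iUnion.2 ⟨i, hi⟩)
  obtain ⟨N, hN⟩ := exists_nat_one_div_lt hδ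
  have hN0 : (0 : ℝ) < N + 1 := by positivity
  have key : ∀ j : ℕ, j ≤ N + 1 → ∃ L : K × ℝ → X, Continuous L ∧ (∀ k, L (k, 0) = f k) ∧
      ∀ k, ∀ s ∈ Icc (0 : ℝ) (j / (N + 1)), q (L (k, s)) = H (k, s) := by
    intro j hj
    induction j with
    | zero =>
      refine ⟨fun z => f z.1, hf.comp continuous_fst, fun _ => rfl, fun k s hs => ?_⟩
      obtain rfl : s = 0 := le_antisymm (by simpa using hs.2) hs.1
      exact (hfH k).symm
    | succ j ih =>
      obtain ⟨L, hL, hL0, hLq⟩ := ih (by omega)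
      have hj0 : (0 : ℝ) ≤ j / (N + 1) := by positivity
      have hj1 : (j + 1 : ℝ) ≤ N + 1 := by exact_mod_cast hj
      -- The `j`-th time step, rescaled to `[0, 1]`, starting where the lift constructed so far
      -- ends.
      obtain ⟨M, hM, hM0, hMq⟩ := exists_lift_of_locally hU (f := fun k => L (k, j / (N + 1)))
        (H := fun z => H (z.1, (j + z.2) / (N + 1))) (by fun_prop) (by fun_prop) (fun k => by
          rw [add_zero, hLq k _ ⟨hj0, le_rfl⟩]) (fun k => by
          obtain ⟨i, hi⟩ := hball (k, j / (N + 1)) ⟨mem_univ _, hj0, by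
            rw [div_le_one hN0]
            linarith⟩
          refine ⟨i, Metric.ball k δ, Metric.ball_mem_nhds k hδ, fun k' hk' s hs => ?_⟩
          refine hi (a := (k', (j + s) / (N + 1))) ?_
          rw [Metric.mem_ball, Prod.dist_eq]
          refine max_lt hk' ?_
          rw [Real.dist_eq, ← sub_div, add_sub_cancel_left, abs_of_nonneg (by
            have := hs.1
            positivity)]
          refine lt_of_le_of_lt ?_ hN
          gcongr
          exact hs.2)
      refine ⟨fun z => if z.2 ≤ j / (N + 1) then L z else M (z.1, (N + 1) * z.2 - j), ?_,
        fun k => ?_, fun k s hs => ?_⟩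
      · refine Continuous.if_le hL (by fun_prop) continuous_snd continuous_const fun z hz => ?_
        rw [hz, mul_div_cancel₀ _ hN0.ne', sub_self, hM0, ← hz]
      · exact (if_pos hj0).trans (hL0 k)
      · dsimp only
        by_cases h : s ≤ j / (N + 1)
        · rw [if_pos h, hLq k s ⟨hs.1, h⟩]
        · rw [if_neg h]
          push Not at h
          have h1 : (j : ℝ) < (N + 1) * s := by
            rw [div_lt_iff₀ hN0] at h
            linarith
          have h2 : (N + 1) * s ≤ j + 1 := by
            have := hs.2
            rw [le_div_iff₀ hN0] at this
            push_cast at this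
            linarith
          rw [hMq k _ ⟨by linarith, by linarith⟩]
          congr 2
          field_simp
          ring
  obtain ⟨L, hL, hL0, hLq⟩ := key (N + 1) le_rfl
  refine ⟨L, hL, hL0, fun k s hs => hLq k s ?_⟩
  rwa [Nat.cast_add, Nat.cast_one, div_self (ne_of_gt hN0)]

/-- Deform a family of points of the homotopy fibre into the fibre, relative to the zero set of
`m`, on which the paths are assumed to be constant. -/
theorem HoFib.exists_deformation {q : X → B} {b : B}
    (hq : ∀ (K : Type) [MetricSpace K] [CompactSpace K] (f : K → X) (H : K × ℝ → B),
      Continuous f → Continuous H → (∀ k, H (k, 0) = q (f k)) →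
      ∃ L : K × ℝ → X, Continuous L ∧ (∀ k, L (k, 0) = f k) ∧
        ∀ k, ∀ s ∈ Icc (0 : ℝ) 1, q (L (k, s)) = H (k, s))
    {K : Type} [MetricSpace K] [CompactSpace K] (c : C(K, HoFib q b)) (m : K → ℝ)
    (hm : Continuous m) (hm0 : ∀ k, m k ∈ Icc (0 : ℝ) 1)
    (hc : ∀ k, m k = 0 → ∀ s, (c k).1.2 s = b) :
    ∃ Γ : C(unitInterval × K, HoFib q b), (∀ k, Γ (0, k) = c k) ∧
      (∀ s k, m k = 0 → Γ (s, k) = c k) ∧ ∀ k s, (Γ (1, k)).1.2 s = b := by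
  have hc₁ : Continuous (fun k => (c k).1.1) :=
    continuous_fst.comp (continuous_subtype_val.comp c.continuous)
  have hc₂ : Continuous (fun k => (c k).1.2) :=
    continuous_snd.comp (continuous_subtype_val.comp c.continuous)
  have he : Continuous (fun z : K × unitInterval => (c z.1).1.2 z.2) := by fun_prop
  -- The path from `b` to `q x` is traversed backwards and reaches `b` at time `m k`. Where `m k =
  -- 0` it is constant, so the value assigned to the division by `0` is irrelevant, and continuity
  -- there follows from the tube lemma.
  let θ : K × ℝ → unitInterval := fun z => projIcc 0 1 zero_le_one (1 - z.2 / m z.1)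
  let H : K × ℝ → B := fun z => (c z.1).1.2 (θ z)
  have hH : Continuous H := by
    rw [continuous_iff_continuousAt]
    rintro ⟨k, s⟩
    by_cases h : m k = 0
    · have hH0 : H (k, s) = b := hc k h _
      rw [ContinuousAt, hH0]
      exact tendsto_of_forall_slice_eq he (hc k h) (continuous_fst.tendsto (k, s)) θ
    · refine he.continuousAt.comp (f := fun z : K × ℝ => (z.1, θ z)) ?_
      refine continuousAt_fst.prodMk (continuous_projIcc.continuousAt.comp ?_)
      exact continuousAt_const.sub (continuousAt_snd.div
        (hm.continuousAt.comp continuousAt_fst) h)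
  obtain ⟨L, hL, hL0, hLq⟩ := hq K (fun k => (c k).1.1) H hc₁ hH (fun k => by
    have h1 : θ (k, 0) = 1 := by
      simp only [θ, zero_div, sub_zero]
      exact projIcc_right (h := zero_le_one)
    simp only [H, h1]
    exact (c k).2.2)
  have hLm : ∀ (k : K) (s : unitInterval),
      q (L (k, s * m k)) = (c k).1.2 (unitInterval.symm s) := fun k s => by
    rw [hLq k _ ⟨mul_nonneg s.2.1 (hm0 k).1, mul_le_one₀ s.2.2 (hm0 k).1 (hm0 k).2⟩]
    by_cases h : m k = 0
    · simp only [H]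
      rw [hc k h, hc k h]
    · have h1 : θ (k, s * m k) = unitInterval.symm s := by
        simp only [θ, mul_div_cancel_right₀ _ h]
        exact projIcc_of_mem zero_le_one (unitInterval.symm s).2
      simp only [H, h1]
  -- While the point is lifted backwards, the path is cut off at time `1 - s`, so that it always
  -- ends below the lifted point.
  let P : unitInterval × K → C(unitInterval, B) := fun z =>
    ⟨fun r => (c z.2).1.2 (r * unitInterval.symm z.1), by fun_prop⟩
  have hP : Continuous P := by
    refine ContinuousMap.continuous_of_continuous_uncurry _ ?_
    have : Continuous (fun z : (unitInterval × K) × unitInterval =>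
        ((z.1.2, z.2 * unitInterval.symm z.1.1) : K × unitInterval)) := by fun_prop
    exact he.comp this
  refine ⟨⟨fun z => ⟨(L (z.2, z.1 * m z.2), P z), ?_, ?_⟩, ?_⟩, fun k => ?_, fun s k hk => ?_,
    fun k s => ?_⟩
  · change (c z.2).1.2 (0 * unitInterval.symm z.1) = b
    rw [zero_mul, (c z.2).2.1]
  · change (c z.2).1.2 (1 * unitInterval.symm z.1) = _
    rw [one_mul, hLm]
  · exact Continuous.subtype_mk ((hL.comp (by fun_prop)).prodMk hP) _
  · refine Subtype.ext (Prod.ext ?_ (ContinuousMap.ext fun r => ?_))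
    · change L (k, (0 : unitInterval) * m k) = _
      rw [Set.Icc.coe_zero, zero_mul, hL0]
    · change (c k).1.2 (r * unitInterval.symm 0) = _
      rw [unitInterval.symm_zero, mul_one]
  · refine Subtype.ext (Prod.ext ?_ (ContinuousMap.ext fun r => ?_))
    · change L (k, s * m k) = _
      rw [hk, mul_zero, hL0]
    · change (c k).1.2 _ = _
      rw [hc k hk, hc k hk]
  · change (c k).1.2 (s * unitInterval.symm 1) = b
    rw [unitInterval.symm_one, mul_zero, (c k).2.1]

/-- A map with the homotopy lifting property for compact metric spaces and its fibre form a
homotopy fibre sequence. -/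
theorem isHomotopyFibreSequence_of_lifting {F : Type w} [TopologicalSpace F] {q : X → B} {b : B}
    {i : F → X} {ρ : X → F} (hi : Continuous i) (hqc : Continuous q)
    (hqi : ∀ z, q (i z) = b) (hρ : ContinuousOn ρ (q ⁻¹' {b})) (hρi : ∀ z, ρ (i z) = z)
    (hiρ : ∀ x, q x = b → i (ρ x) = x)
    (hq : ∀ (K : Type) [MetricSpace K] [CompactSpace K] (f : K → X) (H : K × ℝ → B),
      Continuous f → Continuous H → (∀ k, H (k, 0) = q (f k)) →
      ∃ L : K × ℝ → X, Continuous L ∧ (∀ k, L (k, 0) = f k) ∧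
        ∀ k, ∀ s ∈ Icc (0 : ℝ) 1, q (L (k, s)) = H (k, s)) :
    IsHomotopyFibreSequence i q b := by
  refine ⟨hi, hqc, hqi, ?_⟩
  set e : F → HoFib q b := fun z => ⟨(i z, ContinuousMap.const _ b), rfl, (hqi z).symm⟩ with he
  have hec : Continuous e := (hi.prodMk continuous_const).subtype_mk _
  -- the deformation, with its end in the image of the fibre
  have key : ∀ (K : Type) [MetricSpace K] [CompactSpace K] (c : C(K, HoFib q b)) (m : K → ℝ),
      Continuous m → (∀ k, m k ∈ Icc (0 : ℝ) 1) → (∀ k, m k = 0 → ∃ z, c k = e z) →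
      ∃ Γ : C(unitInterval × K, HoFib q b), ∃ a : C(K, F), (∀ k, Γ (0, k) = c k) ∧
        (∀ s k, m k = 0 → Γ (s, k) = c k) ∧ ∀ k, Γ (1, k) = e (a k) := by
    intro K _ _ c m hm hm0 hmc
    obtain ⟨Γ, h0, hrel, h1⟩ := HoFib.exists_deformation hq c m hm hm0 (fun k hk s => by
      obtain ⟨z, hz⟩ := hmc k hk
      rw [hz]
      rfl)
    have hb : ∀ k, q (Γ (1, k)).1.1 = b := fun k => by rw [← (Γ (1, k)).2.2, h1]
    refine ⟨Γ, ⟨fun k => ρ (Γ (1, k)).1.1, ?_⟩, h0, hrel, fun k => ?_⟩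
    · refine hρ.comp_continuous ?_ hb
      exact continuous_fst.comp (continuous_subtype_val.comp
        (Γ.continuous.comp (by fun_prop)))
    · refine Subtype.ext (Prod.ext (hiρ _ (hb k)).symm (ContinuousMap.ext fun s => h1 k s))
  have hinj : Injective e := fun z z' h => by
    have := congrArg (fun y : HoFib q b => ρ y.1.1) h
    simpa only [he, hρi] using this
  -- `μ` vanishes exactly at the ends of the interval and `ν` exactly on the boundary of the cube.
  -- As the function `m` in `key`, they make the deformation relative to these subsets.
  let μ : unitInterval → ℝ := fun s => s * unitInterval.symm s
  have hμ : Continuous μ := by fun_prop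
  have hμ0 : ∀ s, μ s ∈ Icc (0 : ℝ) 1 := fun s =>
    ⟨mul_nonneg s.2.1 (unitInterval.symm s).2.1,
      mul_le_one₀ s.2.2 (unitInterval.symm s).2.1 (unitInterval.symm s).2.2⟩
  have hμz : ∀ s, μ s = 0 ↔ s = 0 ∨ s = 1 := fun s => by
    simp only [μ, mul_eq_zero]
    refine or_congr Set.Icc.coe_eq_zero ?_
    rw [unitInterval.coe_symm_eq, sub_eq_zero, eq_comm]
    exact Set.Icc.coe_eq_one
  let ν : ∀ {n : ℕ}, (Fin n → unitInterval) → ℝ := fun {n} k => ∏ j : Fin n, μ (k j)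
  have hν : ∀ {n : ℕ}, Continuous (ν (n := n)) := fun {n} =>
    continuous_finsetProd _ fun j _ => hμ.comp (continuous_apply j)
  have hν0 : ∀ {n : ℕ} (k : Fin n → unitInterval), ν k ∈ Icc (0 : ℝ) 1 := fun {n} k =>
    ⟨Finset.prod_nonneg fun j _ => (hμ0 _).1,
      Finset.prod_le_one (fun j _ => (hμ0 _).1) fun j _ => (hμ0 _).2⟩
  have hνz : ∀ {n : ℕ} (k : Fin n → unitInterval), ν k = 0 ↔ k ∈ Cube.boundary (Fin n) :=
    fun {n} k => by
      simp only [ν, Finset.prod_eq_zero_iff, Finset.mem_univ, true_and, hμz]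
      rfl
  refine ⟨hec, fun y => ?_, ?_, fun n x => ⟨?_, ?_⟩⟩
  -- No relative condition is needed for a single point, so the deformation speed is constant.
  · obtain ⟨Γ, a, h0, -, h1⟩ := key PUnit (ContinuousMap.const _ y) (fun _ => 1) continuous_const
      (fun _ => ⟨zero_le_one, le_rfl⟩) (fun _ h => absurd h one_ne_zero)
    refine ⟨a PUnit.unit, Joined.symm ⟨⟨⟨fun s => Γ (s, PUnit.unit),
      Γ.continuous.comp (by fun_prop)⟩, ?_, ?_⟩⟩⟩
    · exact h0 _
    · exact h1 _
  · rintro z z' ⟨p⟩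
    obtain ⟨Γ, a, h0, hrel, h1⟩ := key unitInterval p.toContinuousMap μ hμ hμ0 (fun s hs => by
      rcases (hμz s).1 hs with rfl | rfl
      · exact ⟨z, p.source⟩
      · exact ⟨z', p.target⟩)
    refine ⟨⟨a, hinj ?_, hinj ?_⟩⟩
    · exact ((h1 0).symm.trans (hrel 1 0 ((hμz 0).2 (Or.inl rfl)))).trans p.source
    · exact ((h1 1).symm.trans (hrel 1 1 ((hμz 1).2 (Or.inr rfl)))).trans p.target
  -- Injectivity: a homotopy in the homotopy fibre is deformed into the fibre, relative to the
  -- boundary of `I × I^(n+1)`, where it already lies in the image of `e`.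
  · rintro ⟨f⟩ ⟨g⟩ hfg
    obtain ⟨p⟩ := Quotient.exact hfg
    obtain ⟨Γ, a, h0, hrel, h1⟩ := key (unitInterval × (Fin (n + 1) → unitInterval))
      p.toContinuousMap (fun z => μ z.1 * ν z.2) (by fun_prop)
      (fun z => ⟨mul_nonneg (hμ0 _).1 (hν0 _).1,
        mul_le_one₀ (hμ0 _).2 (hν0 _).1 (hν0 _).2⟩) (fun z hz => by
        rcases mul_eq_zero.1 hz with h | h
        · rcases (hμz _).1 h with h | h
          · refine ⟨f.1 z.2, ?_⟩
            obtain ⟨z₁, z₂⟩ := z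
            obtain rfl : z₁ = 0 := h
            exact p.apply_zero z₂
          · refine ⟨g.1 z.2, ?_⟩
            obtain ⟨z₁, z₂⟩ := z
            obtain rfl : z₁ = 1 := h
            exact p.apply_one z₂
        · refine ⟨x, ?_⟩
          refine (p.eq_fst z.1 ((hνz _).1 h)).trans ?_
          exact congrArg e (f.2 _ ((hνz _).1 h)))
    have ha : ∀ z, μ z.1 * ν z.2 = 0 → e (a z) = p z := fun z hz =>
      (h1 z).symm.trans (hrel 1 z hz)
    refine Quotient.sound ⟨⟨⟨a, fun k => hinj ?_, fun k => hinj ?_⟩, fun s k hk => hinj ?_⟩⟩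
    · refine (ha _ ?_).trans (p.apply_zero k)
      simp only [(hμz 0).2 (Or.inl rfl), zero_mul]
    · refine (ha _ ?_).trans (p.apply_one k)
      simp only [(hμz 1).2 (Or.inr rfl), zero_mul]
    · refine (ha _ ?_).trans (p.eq_fst s hk)
      simp only [(hνz k).2 hk, mul_zero]
  -- Surjectivity: the deformation of a representative into the fibre is itself a homotopy relative
  -- to the boundary of the cube.
  · rintro ⟨g⟩
    obtain ⟨Γ, a, h0, hrel, h1⟩ := key (Fin (n + 1) → unitInterval) g.1 ν hν hν0
      (fun k hk => ⟨x, g.2 k ((hνz k).1 hk)⟩)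
    have ha : ∀ k ∈ Cube.boundary (Fin (n + 1)), a k = x := fun k hk => hinj
      (((h1 k).symm.trans (hrel 1 k ((hνz k).2 hk))).trans (g.2 k hk))
    refine ⟨Quotient.mk _ ⟨a, ha⟩, Eq.symm (Quotient.sound ⟨⟨⟨Γ, h0, h1⟩, fun s k hk => ?_⟩⟩)⟩
    exact hrel s k ((hνz k).2 hk)

end Lifting

/-! ### Well-pointed groups -/

/-- A presentation of the unit of a group as a neighbourhood deformation retract, with continuity
tested on compact Hausdorff spaces. -/
structure UnitNDR (G : Type u) [TopologicalSpace G] [Group G] where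
  dist : G → ℝ≥0
  contr : G → unitInterval → G
  continuous_dist : ∀ (S : Type u) [TopologicalSpace S] [CompactSpace S] [T2Space S] (g : S → G),
    Continuous g → Continuous (fun s => dist (g s))
  continuous_contr : ∀ (S : Type u) [TopologicalSpace S] [CompactSpace S] [T2Space S] (g : S → G),
    Continuous g → Continuous (fun z : S × unitInterval => contr (g z.1) z.2)
  dist_one : dist 1 = 0
  eq_one_of_dist : ∀ g, dist g = 0 → g = 1
  contr_zero : ∀ g, contr g 0 = g
  contr_one_left : ∀ s, contr 1 s = 1
  contr_end : ∀ g, dist g < 1 → contr g 1 = 1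

/-- Homotopy extension into `G × {0} ∪ {1} × I` yields a retraction `r` of `G × I` onto this
subspace. The contraction is the first coordinate of `r`, and the distance is the supremum over `s`
of the deviation of the second coordinate of `r (g, s)` from `s`. -/
theorem nonempty_unitNDR {G : Type u} [TopologicalSpace G] [Group G] [T1Space G]
    (hG : WellPointed (Kify G) 1) : Nonempty (UnitNDR G) := by
  obtain ⟨r, hr0, hr1⟩ := hG {z : Kify G × unitInterval // z.2 = 0 ∨ z.1 = 1}
    ⟨fun g => ⟨(g, 0), Or.inl rfl⟩, by fun_prop⟩
    ⟨fun s => ⟨(1, s), Or.inr rfl⟩, by fun_prop⟩ rfl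
  let D : C(Kify G, C(unitInterval, ℝ)) :=
    ContinuousMap.curry ⟨fun z => (z.2 : ℝ) - (r z).1.2, by fun_prop⟩
  have hD : ∀ (g : Kify G) (s : unitInterval), D g s = (s : ℝ) - (r (g, s)).1.2 := fun _ _ => rfl
  refine ⟨{
    dist := fun g => ‖D (toKify g)‖₊
    contr := fun g s => ofKify (r (toKify g, s)).1.1
    continuous_dist := fun S _ _ _ g hg => ?_
    continuous_contr := fun S _ _ _ g hg => ?_
    dist_one := ?_
    eq_one_of_dist := fun g hg => ?_
    contr_zero := fun g => ?_
    contr_one_left := fun s => ?_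
    contr_end := fun g hg => ?_ }⟩
  · have : Continuous (fun s => toKify (g s)) := continuous_kify_iff.2 hg
    fun_prop
  · have : Continuous (fun s => toKify (g s)) := continuous_kify_iff.2 hg
    exact continuous_ofKify.comp (continuous_fst.comp (continuous_subtype_val.comp
      (r.continuous.comp ((this.comp continuous_fst).prodMk continuous_snd))))
  · rw [nnnorm_eq_zero]
    ext s
    rw [hD]
    change (s : ℝ) - (r ((1 : Kify G), s)).1.2 = 0
    rw [hr1]
    exact sub_self _
  · rw [nnnorm_eq_zero] at hg
    -- At distance `0` the second coordinate is `s`, so for `s > 0` the point lies on `{1} × I`.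
    -- Letting `s` tend to `0`, where `r` returns `g`, gives `g = 1`.
    have h1 : ∀ s : unitInterval, s ∈ Ioi 0 → ofKify (r (toKify g, s)).1.1 = 1 := fun s hs => by
      have h2 := congrArg (fun F : C(unitInterval, ℝ) => F s) hg
      simp only [hD, ContinuousMap.zero_apply, sub_eq_zero] at h2
      rcases (r (toKify g, s)).2 with h | h
      · rw [h] at h2
        exact absurd (Subtype.ext h2) (ne_of_gt hs)
      · exact h
    have hc : Continuous (fun s => ofKify (r (toKify g, s)).1.1) :=
      continuous_ofKify.comp (by fun_prop)
    have hcl : IsClosed {s : unitInterval | ofKify (r (toKify g, s)).1.1 = 1} :=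
      isClosed_singleton.preimage hc
    have h0 : (0 : unitInterval) ∈ closure (Ioi (0 : unitInterval)) := by
      rw [closure_Ioi' ⟨1, zero_lt_one⟩]
      exact self_mem_Ici
    have := hcl.closure_subset_iff.2 h1 h0
    rw [mem_ofPred_eq, hr0] at this
    exact this
  · rw [hr0]
    rfl
  · change ofKify (r ((1 : Kify G), s)).1.1 = 1
    rw [hr1]
    rfl
  -- If `r (g, 1)` had height `0`, the deviation at `s = 1` would be `1`.
  · rcases (r (toKify g, 1)).2 with h | h
    · have h2 : ‖D (toKify g) 1‖₊ < 1 := lt_of_le_of_lt ((D (toKify g)).norm_coe_le_norm 1) hg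
      rw [hD, h] at h2
      simp at h2
    · exact h

/-! ### Weighted sequences of group elements -/

section Reduction

variable {G : Type u}

open Classical in
/-- Prepend an element with a weight to a sequence, omitting elements of weight `0` and collecting
equal elements. -/
def redCons (p : ℝ≥0 × G) (l : List (ℝ≥0 × G)) : List (ℝ≥0 × G) :=
  if p.1 = 0 then l else
    match l with
    | [] => [p]
    | q :: m => if p.2 = q.2 then (p.1 + q.1, p.2) :: m else p :: q :: m

/-- The normal form of a weighted sequence. -/
def reduce (l : List (ℝ≥0 × G)) : List (ℝ≥0 × G) := l.foldr redCons []

theorem redCons_zero (g : G) (l : List (ℝ≥0 × G)) : redCons (0, g) l = l := if_pos rfl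

/-- This rule lets neighbouring entries that agree be merged before normalising; `red_merge` reduces
to it. -/
theorem redCons_redCons (s t : ℝ≥0) (g : G) (l : List (ℝ≥0 × G)) :
    redCons (s, g) (redCons (t, g) l) = redCons (s + t, g) l := by
  rcases eq_or_ne s 0 with rfl | hs
  · rw [redCons_zero, zero_add]
  rcases eq_or_ne t 0 with rfl | ht
  · rw [redCons_zero, add_zero]
  have hst : s + t ≠ 0 := fun h => hs (add_eq_zero.1 h).1
  rcases l with _ | ⟨p, l⟩
  · simp [redCons, hs, ht]
  · by_cases h : g = p.2
    · simp [redCons, hs, ht, h, add_assoc]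
    · simp [redCons, hs, ht, h]

theorem redCons_eq_nil {p : ℝ≥0 × G} {l : List (ℝ≥0 × G)} (h : redCons p l = []) :
    p.1 = 0 ∧ l = [] := by
  unfold redCons at h
  split_ifs at h with h0
  · exact ⟨h0, h⟩
  · rcases l with _ | ⟨p', l⟩
    · simp at h
    · dsimp only at h
      split_ifs at h

theorem reduce_ne_nil {l : List (ℝ≥0 × G)} {p : ℝ≥0 × G} (hp : p ∈ l) (h0 : p.1 ≠ 0) :
    reduce l ≠ [] := by
  induction l with
  | nil => simp at hp
  | cons a l ih =>
    intro h
    obtain ⟨h1, h2⟩ := redCons_eq_nil h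
    rcases List.mem_cons.1 hp with rfl | hp
    · exact h0 h1
    · exact ih hp h2

theorem length_redCons_le (p : ℝ≥0 × G) (l : List (ℝ≥0 × G)) :
    (redCons p l).length ≤ l.length + 1 := by
  unfold redCons
  split_ifs
  · exact Nat.le_succ _
  · rcases l with _ | ⟨p', l⟩
    · simp
    · dsimp only
      split_ifs <;> simp

theorem length_reduce_le (l : List (ℝ≥0 × G)) : (reduce l).length ≤ l.length := by
  induction l with
  | nil => exact le_rfl
  | cons a l ih => exact (length_redCons_le _ _).trans (Nat.succ_le_succ ih)

/-- The normal form of the sequence with weights `t` and entries `v`. -/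
def red {n : ℕ} (t : Fin n → ℝ≥0) (v : Fin n → G) : List (ℝ≥0 × G) :=
  reduce (List.ofFn fun i => (t i, v i))

theorem red_succ {n : ℕ} (t : Fin (n + 1) → ℝ≥0) (v : Fin (n + 1) → G) :
    red t v = redCons (t 0, v 0) (red (fun i => t i.succ) (fun i => v i.succ)) := by
  rw [red, List.ofFn_succ]
  rfl

/-- The counterpart of gluing along faces: a vertex of weight zero may be omitted. -/
theorem red_succAbove {n : ℕ} (t : Fin (n + 1) → ℝ≥0) (v : Fin (n + 1) → G) (i : Fin (n + 1))
    (h : t i = 0) : red t v = red (fun j => t (i.succAbove j)) (fun j => v (i.succAbove j)) := by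
  induction n with
  | zero =>
    obtain rfl : i = 0 := Fin.ext (by omega)
    rw [red_succ, h, redCons_zero]
    rfl
  | succ n ih =>
    induction i using Fin.cases with
    | zero =>
      rw [red_succ, h, redCons_zero]
      rfl
    | succ i =>
      rw [red_succ, ih _ _ i h, red_succ (n := n)]
      simp only [Fin.succ_succAbove_zero, Fin.succ_succAbove_succ]

/-- Collect the weights at `i` and `i + 1`. -/
def mergeWeights {n : ℕ} (i : Fin (n + 1)) (t : Fin (n + 2) → ℝ≥0) (j : Fin (n + 1)) : ℝ≥0 :=
  t (i.succ.succAbove j) + if j = i then t i.succ else 0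

/-- The counterpart of collapsing degeneracies: a repeated entry is omitted and its weight passes to
the preceding vertex. -/
theorem red_merge {n : ℕ} (t : Fin (n + 2) → ℝ≥0) (v : Fin (n + 2) → G) (i : Fin (n + 1))
    (h : v i.castSucc = v i.succ) :
    red t v = red (mergeWeights i t) (fun j => v (i.succ.succAbove j)) := by
  induction n with
  | zero =>
    obtain rfl : i = 0 := Fin.ext (by omega)
    rw [red_succ, red_succ, red_succ]
    have h' : v 0 = v (Fin.succ 0) := h
    rw [← h', redCons_redCons]
    simp [mergeWeights]
  | succ n ih =>
    induction i using Fin.cases with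
    | zero =>
      rw [red_succ, red_succ, red_succ (n := n + 1)]
      have h' : v 0 = v (Fin.succ 0) := h
      rw [← h', redCons_redCons]
      congr 1
      simp [mergeWeights]
    | succ i =>
      rw [red_succ, ih _ _ i (by simpa using h), red_succ (n := n + 1)]
      have h0 : (0 : Fin (n + 2)) ≠ i.succ := (Fin.succ_ne_zero i).symm
      have h1 : mergeWeights i.succ t 0 = t 0 := by
        rw [mergeWeights, if_neg h0, add_zero, Fin.succ_succAbove_zero]
      have h2 : (fun j : Fin (n + 1) => mergeWeights i.succ t j.succ) =
          mergeWeights i (fun j => t j.succ) := by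
        funext j
        simp only [mergeWeights, Fin.succ_succAbove_succ, Fin.succ_inj]
      rw [h1, h2]
      simp only [Fin.succ_succAbove_zero, Fin.succ_succAbove_succ]

theorem length_red_le {n : ℕ} (t : Fin n → ℝ≥0) (v : Fin n → G) : (red t v).length ≤ n := by
  exact (length_reduce_le _).trans List.length_ofFn.le

theorem ofFn_prod_inj {n : ℕ} {t t' : Fin n → ℝ≥0} {v v' : Fin n → G}
    (h : (List.ofFn fun i => (t i, v i)) = List.ofFn fun i => (t' i, v' i)) : t = t' ∧ v = v' := by
  have h' := List.ofFn_injective h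
  exact ⟨funext fun i => congrArg Prod.fst (congrFun h' i),
    funext fun i => congrArg Prod.snd (congrFun h' i)⟩

variable [Group G]

/-- Right translation of a weighted sequence. -/
def translate (a : G) (l : List (ℝ≥0 × G)) : List (ℝ≥0 × G) := l.map fun p => (p.1, p.2 * a)

theorem redCons_translate (a : G) (p : ℝ≥0 × G) (l : List (ℝ≥0 × G)) :
    redCons (p.1, p.2 * a) (translate a l) = translate a (redCons p l) := by
  rcases l with _ | ⟨p', l⟩
  · by_cases h : p.1 = 0 <;> simp [redCons, translate, h]
  · by_cases h : p.1 = 0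
    · simp [redCons, translate, h]
    · by_cases h' : p.2 = p'.2 <;> simp [redCons, translate, h, h']

/-- Right translation keeps weights and preserves and reflects equality of neighbours, which is all
that the normal form looks at. -/
theorem reduce_translate (a : G) (l : List (ℝ≥0 × G)) :
    reduce (translate a l) = translate a (reduce l) := by
  induction l with
  | nil => rfl
  | cons p l ih =>
    change redCons _ (reduce (translate a l)) = translate a (redCons p (reduce l))
    rw [ih, redCons_translate]

theorem red_mul {n : ℕ} (t : Fin n → ℝ≥0) (v : Fin n → G) (a : G) :
    red t (fun i => v i * a) = translate a (red t v) := by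
  rw [red, red, ← reduce_translate, translate, List.map_ofFn]
  rfl

theorem translate_translate (a b : G) (l : List (ℝ≥0 × G)) :
    translate b (translate a l) =
      translate (a * b) l := by
  simp [translate, mul_assoc]

end Reduction

/-! ### Local sections of the universal bundle -/

namespace UnitNDR

variable {G : Type u} [TopologicalSpace G] [Group G] (N : UnitNDR G)

/-- The distance of a weighted sequence from the degenerate ones. -/
def gap : ∀ n : ℕ, (Fin (n + 1) → ℝ≥0) → (Fin (n + 1) → G) → ℝ≥0
  | 0, t, _ => t 0
  | n + 1, t, v => min (min (t 0) (N.dist (v 0 * (v 1)⁻¹)))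
      (gap n (fun i => t i.succ) (fun i => v i.succ))

/-- Contract `g` to the unit, to the extent given by `m`. -/
def shrink (m : ℝ≥0) (g : G) : G := N.contr g (projIcc 0 1 zero_le_one ((m : ℝ) / N.dist g))

/-- Contract the quotients of consecutive entries. -/
def shrinkSeq (m : ℝ≥0) : ∀ n : ℕ, (Fin (n + 1) → G) → Fin (n + 1) → G
  | 0, v => v
  | n + 1, v => Fin.cons (N.shrink m (v 0 * (v 1)⁻¹) * shrinkSeq m n (fun i => v i.succ) 0)
      (shrinkSeq m n (fun i => v i.succ))

theorem shrink_zero (g : G) : N.shrink 0 g = g := by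
  rw [shrink, NNReal.coe_zero, zero_div, projIcc_left]
  exact N.contr_zero g

/-- The contraction parameter is `m / m`. It equals `1` unless `m = 0`, and in that case `g` is
already the unit. -/
theorem shrink_eq_one {m : ℝ≥0} {g : G} (h : N.dist g = m) (hm : m < 1) : N.shrink m g = 1 := by
  rcases eq_or_ne m 0 with rfl | h0
  · rw [N.eq_one_of_dist g h, shrink, N.contr_one_left]
  · rw [shrink, h, div_self (NNReal.coe_ne_zero.2 h0), projIcc_right]
    exact N.contr_end g (h ▸ hm)

theorem shrinkSeq_zero (n : ℕ) (v : Fin (n + 1) → G) : N.shrinkSeq 0 n v = v := by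
  induction n with
  | zero => rfl
  | succ n ih =>
    rw [shrinkSeq, ih, shrink_zero]
    funext i
    induction i using Fin.cases with
    | zero => simp
    | succ i => simp

/-- The sequence is rebuilt from its last entry, which stays fixed, with every consecutive quotient
contracted by the same amount. -/
theorem shrinkSeq_castSucc (m : ℝ≥0) (n : ℕ) (v : Fin (n + 2) → G) (i : Fin (n + 1)) :
    N.shrinkSeq m (n + 1) v i.castSucc =
      N.shrink m (v i.castSucc * (v i.succ)⁻¹) * N.shrinkSeq m (n + 1) v i.succ := by
  induction n with
  | zero =>
    obtain rfl : i = 0 := Fin.ext (by omega)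
    rfl
  | succ n ih =>
    induction i using Fin.cases with
    | zero => rfl
    | succ i => exact ih (fun i => v i.succ) i

/-- The quotients `v i * (v (i + 1))⁻¹` do not see right translation, so the whole construction is
equivariant. -/
theorem shrinkSeq_mul (m : ℝ≥0) (n : ℕ) (v : Fin (n + 1) → G) (a : G) :
    N.shrinkSeq m n (fun i => v i * a) = fun i => N.shrinkSeq m n v i * a := by
  induction n with
  | zero => rfl
  | succ n ih =>
    funext i
    rw [shrinkSeq, shrinkSeq, ih (fun i => v i.succ)]
    induction i using Fin.cases with
    | zero => simp [mul_assoc]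
    | succ i => simp

theorem gap_mul (n : ℕ) (t : Fin (n + 1) → ℝ≥0) (v : Fin (n + 1) → G) (a : G) :
    N.gap n t (fun i => v i * a) = N.gap n t v := by
  induction n with
  | zero => rfl
  | succ n ih =>
    rw [gap, gap, ih (fun i => t i.succ) (fun i => v i.succ)]
    simp [mul_assoc]

theorem exists_eq_gap (n : ℕ) (t : Fin (n + 1) → ℝ≥0) (v : Fin (n + 1) → G) :
    (∃ i, t i = N.gap n t v) ∨
      ∃ i : Fin n, N.dist (v i.castSucc * (v i.succ)⁻¹) = N.gap n t v := by
  induction n with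
  | zero => exact Or.inl ⟨0, rfl⟩
  | succ n ih =>
    rw [gap]
    rcases min_choice (min (t 0) (N.dist (v 0 * (v 1)⁻¹)))
      (N.gap n (fun i => t i.succ) (fun i => v i.succ)) with h | h
    · rw [h]
      rcases min_choice (t 0) (N.dist (v 0 * (v 1)⁻¹)) with h' | h'
      · exact Or.inl ⟨0, h'.symm⟩
      · exact Or.inr ⟨0, h'.symm⟩
    · rw [h]
      rcases ih (fun i => t i.succ) (fun i => v i.succ) with ⟨i, hi⟩ | ⟨i, hi⟩
      · exact Or.inl ⟨i.succ, hi⟩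
      · exact Or.inr ⟨i.succ, hi⟩

/-- The gap is a minimum of weights and distances. Lowering weights and contracting quotients by
this amount kills the one that attains it. The bound by `1` is the range in which the contraction
reaches the unit. -/
theorem exists_degenerate {n : ℕ} {t : Fin (n + 1) → ℝ≥0} {v : Fin (n + 1) → G}
    (h : N.gap n t v < 1) : (∃ i, t i - N.gap n t v = 0) ∨ ∃ i : Fin n,
      N.shrinkSeq (N.gap n t v) n v i.castSucc = N.shrinkSeq (N.gap n t v) n v i.succ := by
  rcases N.exists_eq_gap n t v with ⟨i, hi⟩ | ⟨i, hi⟩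
  · exact Or.inl ⟨i, by rw [hi, tsub_self]⟩
  · refine Or.inr ⟨i, ?_⟩
    cases n with
    | zero => exact i.elim0
    | succ n => rw [shrinkSeq_castSucc, N.shrink_eq_one hi h, one_mul]

theorem length_red_of_gap {n : ℕ} {t : Fin (n + 1) → ℝ≥0} {v : Fin (n + 1) → G}
    (h : N.gap n t v = 0) : (red t v).length ≤ n := by
  rcases N.exists_eq_gap n t v with ⟨i, hi⟩ | ⟨i, hi⟩
  · rw [red_succAbove t v i (hi.trans h)]
    exact length_red_le _ _
  · cases n with
    | zero => exact i.elim0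
    | succ n =>
      rw [red_merge t v i (mul_inv_eq_one.1 (N.eq_one_of_dist _ (hi.trans h)))]
      exact length_red_le _ _

/-- A positive gap rules out both zero weights and equal neighbours, so nothing is left to reduce.
-/
theorem red_of_gap_pos {n : ℕ} {t : Fin (n + 1) → ℝ≥0} {v : Fin (n + 1) → G}
    (h : 0 < N.gap n t v) : red t v = List.ofFn fun i => (t i, v i) := by
  induction n with
  | zero =>
    have h' : t 0 ≠ 0 := h.ne'
    simp [red, reduce, redCons, h']
  | succ n ih =>
    rw [gap, lt_min_iff, lt_min_iff] at h
    have hne : v 0 ≠ v 1 := fun h' => h.1.2.ne' (by rw [h', mul_inv_cancel, N.dist_one])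
    rw [red_succ, ih h.2, List.ofFn_succ, List.ofFn_succ (f := fun i => (t i, v i)),
      List.ofFn_succ (f := fun i : Fin (n + 1) => (t i.succ, v i.succ))]
    exact (if_neg h.1.1.ne').trans (if_neg hne)

/-- `N.Value n l a`: the reduced sequence `l` lies in the open set obtained by thickening the
sequences of length `n + 1`, and `a` is the value there of the local section that is given by the
last entry on sequences of length `n + 1`. -/
inductive Value (n : ℕ) : List (ℝ≥0 × G) → G → Prop
  | base (l : List (ℝ≥0 × G)) (t : Fin (n + 1) → ℝ≥0) (v : Fin (n + 1) → G)
      (hl : l = List.ofFn fun i => (t i, v i)) (h : 0 < N.gap n t v) : Value n l (v (Fin.last n))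
  | step (l : List (ℝ≥0 × G)) (k : ℕ) (hk : n ≤ k) (t : Fin (k + 2) → ℝ≥0) (v : Fin (k + 2) → G)
      (hl : l = List.ofFn fun i => (t i, v i)) (h : 0 < N.gap (k + 1) t v)
      (h' : N.gap (k + 1) t v < 1) (a : G)
      (ha : Value n (red (fun i => t i - N.gap (k + 1) t v)
        (N.shrinkSeq (N.gap (k + 1) t v) (k + 1) v)) a) : Value n l a

variable {N}

theorem Value.length_le {n : ℕ} {l : List (ℝ≥0 × G)} {a : G} (h : N.Value n l a) :
    n + 1 ≤ l.length := by
  induction h with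
  | base l t v hl h => rw [hl, List.length_ofFn]
  | step l k hk t v hl h h' a ha =>
    rw [hl, List.length_ofFn]
    omega

/-- The sequence need not be reduced here: with zero gap it has at most `n` entries after reduction,
which is too short to have a value. -/
theorem value_of_length {n : ℕ} {t : Fin (n + 1) → ℝ≥0} {v : Fin (n + 1) → G} {a : G} :
    N.Value n (red t v) a ↔ 0 < N.gap n t v ∧ a = v (Fin.last n) := by
  constructor
  · intro h
    have h0 : 0 < N.gap n t v := by
      rw [pos_iff_ne_zero]
      intro h0
      have := N.length_red_of_gap h0
      have := h.length_le
      omega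
    refine ⟨h0, ?_⟩
    rw [N.red_of_gap_pos h0] at h
    generalize hl' : (List.ofFn fun i => (t i, v i)) = l at h
    induction h with
    | base l t' v' hl h => rw [(ofFn_prod_inj (hl'.trans hl)).2]
    | step l k hk t' v' hl h h' a ha =>
      subst hl'
      have := congrArg List.length hl
      simp only [List.length_ofFn] at this
      omega
  · rintro ⟨h, rfl⟩
    exact Value.base _ t v (N.red_of_gap_pos h) h

/-- When the gap is zero, a step changes neither weights nor entries. The recursion therefore holds
for unreduced sequences as well, so in continuous families it applies without first distinguishing
the degenerate members. -/
theorem value_step {n k : ℕ} (hk : n ≤ k) {t : Fin (k + 2) → ℝ≥0} {v : Fin (k + 2) → G} {a : G} :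
    N.Value n (red t v) a ↔ N.gap (k + 1) t v < 1 ∧
      N.Value n (red (fun i => t i - N.gap (k + 1) t v)
        (N.shrinkSeq (N.gap (k + 1) t v) (k + 1) v)) a := by
  rcases eq_or_ne (N.gap (k + 1) t v) 0 with h0 | h0
  · rw [h0, shrinkSeq_zero]
    simp
  · rw [← pos_iff_ne_zero] at h0
    rw [N.red_of_gap_pos h0]
    constructor
    · intro h
      generalize hl' : (List.ofFn fun i => (t i, v i)) = l at h
      induction h with
      | base l t' v' hl h =>
        subst hl'
        have := congrArg List.length hl
        simp only [List.length_ofFn] at this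
        omega
      | step l k' hk' t' v' hl h h' a ha =>
        subst hl'
        obtain rfl : k = k' := by
          have := congrArg List.length hl
          simp only [List.length_ofFn] at this
          omega
        obtain ⟨rfl, rfl⟩ := ofFn_prod_inj hl
        exact ⟨h', ha⟩
    · rintro ⟨h, ha⟩
      exact Value.step _ k hk t v rfl h0 h a ha

/-- The length of `l` decides which constructor applies, and the entries of `l` determine its data.
-/
theorem Value.eq {n : ℕ} {l : List (ℝ≥0 × G)} {a b : G} (h : N.Value n l a)
    (h' : N.Value n l b) : a = b := by
  induction h with
  | base l t v hl h =>
    rw [hl, ← N.red_of_gap_pos h] at h'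
    exact (value_of_length.1 h').2.symm
  | step l k hk t v hl h h₁ a ha ih =>
    rw [hl, ← N.red_of_gap_pos h] at h'
    exact ih ((value_step hk).1 h').2

theorem Value.translate {n : ℕ} {l : List (ℝ≥0 × G)} {a : G} (h : N.Value n l a) (c : G) :
    N.Value n (translate c l) (a * c) := by
  induction h with
  | base l t v hl h =>
    rw [hl, ← N.red_of_gap_pos h, ← red_mul]
    exact value_of_length.2 ⟨by rwa [gap_mul], rfl⟩
  | step l k hk t v hl h h₁ a ha ih =>
    rw [hl, ← N.red_of_gap_pos h, ← red_mul]
    refine (value_step hk).2 ⟨by rwa [gap_mul], ?_⟩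
    rw [gap_mul, shrinkSeq_mul, red_mul]
    exact ih

variable (N)

/-- The domain of the `n`-th local section. -/
def Dom (n : ℕ) (l : List (ℝ≥0 × G)) : Prop := ∃ a, N.Value n l a

open Classical in
/-- The `n`-th local section, extended to an equivariant function. -/
def frame (n : ℕ) (l : List (ℝ≥0 × G)) : G :=
  if h : N.Dom n l then h.choose else (l.head?.map Prod.snd).getD 1

variable {N}

theorem frame_eq {n : ℕ} {l : List (ℝ≥0 × G)} {a : G} (h : N.Value n l a) : N.frame n l = a := by
  have h' : N.Dom n l := ⟨a, h⟩
  rw [frame, dif_pos h']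
  exact h'.choose_spec.eq h

theorem dom_translate {n : ℕ} {l : List (ℝ≥0 × G)} (c : G) :
    N.Dom n (translate c l) ↔ N.Dom n l := by
  refine ⟨fun ⟨a, h⟩ => ?_, fun ⟨a, h⟩ => ⟨_, h.translate c⟩⟩
  have := h.translate c⁻¹
  rw [translate_translate, mul_inv_cancel] at this
  exact ⟨_, by simpa [DecoratedModuli.translate] using this⟩

/-- Outside the domain the default value is the first entry, which is equivariant too.
Trivialisations thus descend to whole homotopy quotients as functions, and the chart matters only
for continuity. -/
theorem frame_translate {n : ℕ} {l : List (ℝ≥0 × G)} (hl : l ≠ []) (c : G) :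
    N.frame n (translate c l) = N.frame n l * c := by
  by_cases h : N.Dom n l
  · obtain ⟨a, ha⟩ := h
    rw [frame_eq ha, frame_eq (ha.translate c)]
  · have h' : ¬ N.Dom n (translate c l) := fun h' => h ((dom_translate c).1 h')
    rw [frame, frame, dif_neg h, dif_neg h']
    rcases l with _ | ⟨p, l⟩
    · exact absurd rfl hl
    · rfl

/-- Degenerate entries are removed until the gap is positive; the index is then read off from the
number of entries that remain. The nonzero weight keeps the sequence from becoming empty. -/
theorem exists_dom {k : ℕ} (t : Fin (k + 1) → ℝ≥0) (v : Fin (k + 1) → G) (i : Fin (k + 1))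
    (hi : t i ≠ 0) : ∃ n, N.Dom n (red t v) := by
  induction k with
  | zero =>
    obtain rfl : i = 0 := Fin.ext (by omega)
    exact ⟨0, v 0, value_of_length.2 ⟨pos_iff_ne_zero.2 hi, rfl⟩⟩
  | succ k ih =>
    rcases eq_or_ne (N.gap (k + 1) t v) 0 with h0 | h0
    · rcases N.exists_eq_gap (k + 1) t v with ⟨j, hj⟩ | ⟨j, hj⟩
      · rw [red_succAbove t v j (hj.trans h0)]
        have hij : i ≠ j := fun h => hi (by rw [h, hj, h0])
        obtain ⟨i', rfl⟩ := Fin.exists_succAbove_eq hij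
        exact ih _ _ i' hi
      · rw [red_merge t v j (mul_inv_eq_one.1 (N.eq_one_of_dist _ (hj.trans h0)))]
        -- Merging deletes the position `j.succ`. If the nonzero weight sits there, it is moved to
        -- `j`.
        by_cases hij : i = j.succ
        · refine ih _ _ j fun h => hi ?_
          rw [mergeWeights, if_pos rfl, add_eq_zero] at h
          rw [hij, h.2]
        · obtain ⟨i', rfl⟩ := Fin.exists_succAbove_eq hij
          exact ih _ _ i' fun h => hi (add_eq_zero.1 h).1
    · exact ⟨k + 1, _, value_of_length.2 ⟨pos_iff_ne_zero.2 h0, rfl⟩⟩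

/-! ### Continuity of the local sections along families -/

section Continuity

variable {S : Type u} [TopologicalSpace S] [CompactSpace S] [T2Space S]

theorem continuous_gap [IsTopologicalGroup G] {n : ℕ} {t : S → Fin (n + 1) → ℝ≥0} {v : S → Fin (n + 1) → G}
    (ht : Continuous t) (hv : Continuous v) : Continuous (fun s => N.gap n (t s) (v s)) := by
  induction n with
  | zero => exact (continuous_apply 0).comp ht
  | succ n ih =>
    refine ((((continuous_apply 0).comp ht).min (N.continuous_dist S _ ?_))).min
      (ih (t := fun s i => t s i.succ) (v := fun s i => v s i.succ) ?_ ?_)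
    · exact ((continuous_apply 0).comp hv).mul ((continuous_apply 1).comp hv).inv
    · exact continuous_pi fun i => (continuous_apply i.succ).comp ht
    · exact continuous_pi fun i => (continuous_apply i.succ).comp hv

/-- The ratio `m / dist` may be discontinuous where the distance vanishes. There `g = 1`, and the
contraction fixes the unit at all times, so the tube lemma applies. -/
theorem continuous_shrink {m : S → ℝ≥0} {g : S → G} (hm : Continuous m) (hg : Continuous g) :
    Continuous (fun s => N.shrink (m s) (g s)) := by
  have he := N.continuous_contr S g hg
  rw [continuous_iff_continuousAt]
  intro s₀
  by_cases h : N.dist (g s₀) = 0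
  · have h1 : N.shrink (m s₀) (g s₀) = 1 := by
      rw [N.eq_one_of_dist _ h, shrink, N.contr_one_left]
    rw [ContinuousAt, h1]
    refine tendsto_of_forall_slice_eq he (fun r => ?_) Filter.tendsto_id _
    rw [N.eq_one_of_dist _ h, N.contr_one_left]
  · refine he.continuousAt.comp (f := fun s => (s, projIcc 0 1 zero_le_one
      ((m s : ℝ) / N.dist (g s)))) (continuousAt_id.prodMk (continuous_projIcc.continuousAt.comp ?_))
    exact (NNReal.continuous_coe.comp hm).continuousAt.div
      (NNReal.continuous_coe.comp (N.continuous_dist S g hg)).continuousAt (NNReal.coe_ne_zero.2 h)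

theorem continuous_shrinkSeq [IsTopologicalGroup G] {n : ℕ} {m : S → ℝ≥0} {v : S → Fin (n + 1) → G}
    (hm : Continuous m) (hv : Continuous v) :
    Continuous (fun s => N.shrinkSeq (m s) n (v s)) := by
  induction n with
  | zero => exact hv
  | succ n ih =>
    have h := ih (v := fun s i => v s i.succ)
      (continuous_pi fun i => (continuous_apply i.succ).comp hv)
    refine continuous_pi fun i => ?_
    induction i using Fin.cases with
    | zero =>
      refine (continuous_shrink hm ?_).mul ((continuous_apply 0).comp h)
      exact ((continuous_apply 0).comp hv).mul ((continuous_apply 1).comp hv).inv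
    | succ i => exact (continuous_apply i).comp h

end Continuity

/-- Along a family of sequences, the `n`-th local section has a domain that is a neighbourhood of
`s₀`, and is continuous at `s₀`, if it is defined there. -/
def GoodAt (N : UnitNDR G) (n : ℕ) {S : Type u} [TopologicalSpace S]
    (l : S → List (ℝ≥0 × G)) (s₀ : S) : Prop :=
  N.Dom n (l s₀) → (∀ᶠ s in 𝓝 s₀, N.Dom n (l s)) ∧ ContinuousAt (fun s => N.frame n (l s)) s₀

/-- Finitely many closed pieces cover a neighbourhood of `s₀`. Those that miss `s₀` impose nothing
near it, and the conditions on the others can be intersected. -/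
theorem goodAt_of_pieces {S : Type u} [TopologicalSpace S] {n : ℕ} {l : S → List (ℝ≥0 × G)}
    {s₀ : S} {ι : Type*} [Finite ι] {P : ι → Set S} (hP : ∀ i, IsClosed (P i))
    (hcov : ∀ᶠ s in 𝓝 s₀, ∃ i, s ∈ P i)
    (h : ∀ i (hi : s₀ ∈ P i), N.GoodAt n (fun s : P i => l s) ⟨s₀, hi⟩) : N.GoodAt n l s₀ := by
  intro hs₀
  have key : ∀ i, (∀ᶠ s in 𝓝[P i] s₀, N.Dom n (l s)) ∧
      ContinuousWithinAt (fun s => N.frame n (l s)) (P i) s₀ := by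
    intro i
    by_cases hi : s₀ ∈ P i
    · obtain ⟨h₁, h₂⟩ := h i hi hs₀
      refine ⟨?_, (continuousWithinAt_iff_continuousAt_domRestrict _ hi).2 h₂⟩
      rw [nhdsWithin_eq_map_subtype_coe hi]
      exact h₁
    · have : s₀ ∉ closure (P i) := by rwa [(hP i).closure_eq]
      refine ⟨?_, continuousWithinAt_of_notMem_closure this⟩
      rw [mem_closure_iff_nhdsWithin_neBot, Filter.not_neBot] at this
      rw [this]
      exact Filter.eventually_bot
  have comb : ∀ Q : S → Prop, (∀ i, ∀ᶠ s in 𝓝[P i] s₀, Q s) → ∀ᶠ s in 𝓝 s₀, Q s := by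
    intro Q hQ
    have hall : ∀ᶠ s in 𝓝 s₀, ∀ i, s ∈ P i → Q s :=
      Filter.eventually_all.2 fun i => eventually_nhdsWithin_iff.1 (hQ i)
    filter_upwards [hcov, hall] with s ⟨i, hi⟩ hs
    exact hs i hi
  exact ⟨comb _ fun i => (key i).1, fun V hV => comb _ fun i => (key i).2 hV⟩

theorem goodAt_of_value {S : Type u} [TopologicalSpace S] {n : ℕ} {l : S → List (ℝ≥0 × G)}
    {s₀ : S} {v : S → G} (hv : ContinuousAt v s₀) (h : ∀ᶠ s in 𝓝 s₀, N.Value n (l s) (v s)) :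
    N.GoodAt n l s₀ :=
  fun _ => ⟨h.mono fun _ hs => ⟨_, hs⟩, hv.congr (h.mono fun _ hs => (frame_eq hs).symm)⟩

theorem goodAt_of_length [IsTopologicalGroup G] {S : Type u} [TopologicalSpace S] [CompactSpace S]
    [T2Space S] {n : ℕ} {t : S → Fin (n + 1) → ℝ≥0} {v : S → Fin (n + 1) → G} (ht : Continuous t)
    (hv : Continuous v) (s₀ : S) : N.GoodAt n (fun s => red (t s) (v s)) s₀ := by
  intro hs₀
  obtain ⟨a, ha⟩ := hs₀
  refine goodAt_of_value (v := fun s => v s (Fin.last n))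
    ((continuous_apply _).comp hv).continuousAt ?_ ⟨a, ha⟩
  filter_upwards [(isOpen_Ioi.preimage (continuous_gap (N := N) ht hv)).mem_nhds
    (value_of_length.1 ha).1] with s hs
  exact value_of_length.2 ⟨hs, rfl⟩

theorem not_dom_of_lt {n k : ℕ} (h : k < n) (t : Fin (k + 1) → ℝ≥0) (v : Fin (k + 1) → G) :
    ¬ N.Dom n (red t v) := by
  rintro ⟨a, ha⟩
  have h1 := ha.length_le
  have h2 := length_red_le t v
  omega

/-- This is the zero set of the continuous distance between the two entries, which detects equality.
-/
theorem isClosed_setOf_entry_eq [IsTopologicalGroup G] (N : UnitNDR G) {S : Type u}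
    [TopologicalSpace S] [CompactSpace S] [T2Space S] {v w : S → G} (hv : Continuous v)
    (hw : Continuous w) : IsClosed {s | v s = w s} := by
  have hc := N.continuous_dist S (fun s => v s * (w s)⁻¹) (hv.mul hw.inv)
  have : {s | v s = w s} = (fun s => N.dist (v s * (w s)⁻¹)) ⁻¹' {0} := by
    ext s
    refine ⟨fun h => ?_, fun h => mul_inv_eq_one.1 (N.eq_one_of_dist _ h)⟩
    change N.dist _ = 0
    rw [show v s = w s from h, mul_inv_cancel, N.dist_one]
  rw [this]
  exact isClosed_singleton.preimage hc

/-- Induction on the number of entries. One step of the pushing process makes the sequences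
degenerate near a point of the domain, and degenerate sequences can be written with one entry fewer
on finitely many closed pieces. -/
theorem goodAt_red [IsTopologicalGroup G] (n k : ℕ) : ∀ {S : Type u} [TopologicalSpace S]
    [CompactSpace S] [T2Space S] {t : S → Fin (k + 1) → ℝ≥0} {v : S → Fin (k + 1) → G},
    Continuous t → Continuous v → ∀ s₀, N.GoodAt n (fun s => red (t s) (v s)) s₀ := by
  induction k with
  | zero =>
    intro S _ _ _ t v ht hv s₀
    rcases Nat.eq_zero_or_pos n with rfl | hn
    · exact goodAt_of_length ht hv s₀
    · exact fun h => absurd h (not_dom_of_lt hn _ _)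
  | succ k ih =>
    -- The case of families that are degenerate near `s₀`: each piece fixes which weight vanishes or
    -- which neighbours agree, and the induction hypothesis applies to the shortened sequence.
    have hpieces : ∀ {S : Type u} [TopologicalSpace S] [CompactSpace S] [T2Space S]
        {t : S → Fin (k + 2) → ℝ≥0} {v : S → Fin (k + 2) → G} (s₀ : S),
        Continuous t → Continuous v →
        (∀ᶠ s in 𝓝 s₀, (∃ i, t s i = 0) ∨ ∃ i : Fin (k + 1), v s i.castSucc = v s i.succ) →
        N.GoodAt n (fun s => red (t s) (v s)) s₀ := by
      intro S _ _ _ t v s₀ ht hv hdeg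
      have ht' : ∀ i, Continuous fun s => t s i := fun i => (continuous_apply i).comp ht
      have hv' : ∀ i, Continuous fun s => v s i := fun i => (continuous_apply i).comp hv
      have hcl₁ : ∀ i, IsClosed {s | t s i = 0} := fun i => isClosed_singleton.preimage (ht' i)
      have hcl₂ : ∀ i : Fin (k + 1), IsClosed {s | v s i.castSucc = v s i.succ} :=
        fun i => N.isClosed_setOf_entry_eq (hv' _) (hv' _)
      refine goodAt_of_pieces (ι := Fin (k + 2) ⊕ Fin (k + 1)) (P := Sum.elim
        (fun i => {s | t s i = 0}) (fun i => {s | v s i.castSucc = v s i.succ})) ?_ ?_ ?_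
      · rintro (i | i)
        · exact hcl₁ i
        · exact hcl₂ i
      · filter_upwards [hdeg] with s hs
        rcases hs with ⟨i, hi⟩ | ⟨i, hi⟩
        · exact ⟨Sum.inl i, hi⟩
        · exact ⟨Sum.inr i, hi⟩
      · rintro (i | i) hi
        · have : CompactSpace {s | t s i = 0} := isCompact_iff_compactSpace.1 (hcl₁ i).isCompact
          have h := ih (S := {s | t s i = 0}) (t := fun s j => t s (i.succAbove j))
            (v := fun s j => v s (i.succAbove j))
            (continuous_pi fun j => (ht' _).comp continuous_subtype_val)
            (continuous_pi fun j => (hv' _).comp continuous_subtype_val) ⟨s₀, hi⟩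
          have e : (fun s : {s | t s i = 0} => red (t s) (v s)) = fun s : {s | t s i = 0} =>
              red (fun j => t s (i.succAbove j)) (fun j => v s (i.succAbove j)) :=
            funext fun s => red_succAbove _ _ i s.2
          rw [← e] at h
          exact h
        · have : CompactSpace {s | v s i.castSucc = v s i.succ} :=
            isCompact_iff_compactSpace.1 (hcl₂ i).isCompact
          have h := ih (S := {s | v s i.castSucc = v s i.succ})
            (t := fun s => mergeWeights i (t s)) (v := fun s j => v s (i.succ.succAbove j))
            (continuous_pi fun j => ?_)
            (continuous_pi fun j => (hv' _).comp continuous_subtype_val) ⟨s₀, hi⟩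
          · have e : (fun s : {s | v s i.castSucc = v s i.succ} => red (t s) (v s)) =
                fun s : {s | v s i.castSucc = v s i.succ} =>
                  red (mergeWeights i (t s)) (fun j => v s (i.succ.succAbove j)) :=
              funext fun s => red_merge _ _ i s.2
            rw [← e] at h
            exact h
          · refine ((ht' _).comp continuous_subtype_val).add ?_
            split_ifs
            · exact (ht' _).comp continuous_subtype_val
            · exact continuous_const
    intro S _ _ _ t v ht hv s₀
    rcases lt_trichotomy n (k + 1) with hn | rfl | hn
    -- The family itself need not be degenerate, but its pushed version is, and `value_step`
    -- identifies the values of the two.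
    · intro hs₀
      have hn' : n ≤ k := by omega
      have hmc : Continuous (fun s => N.gap (k + 1) (t s) (v s)) := continuous_gap ht hv
      obtain ⟨a, ha⟩ := hs₀
      obtain ⟨h1, ha'⟩ := (value_step hn').1 ha
      have hev : ∀ᶠ s in 𝓝 s₀, N.gap (k + 1) (t s) (v s) < 1 :=
        (isOpen_Iio.preimage hmc).mem_nhds h1
      obtain ⟨hd, hc⟩ := hpieces (t := fun s i => t s i - N.gap (k + 1) (t s) (v s))
        (v := fun s => N.shrinkSeq (N.gap (k + 1) (t s) (v s)) (k + 1) (v s)) s₀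
        (continuous_pi fun i => ((continuous_apply i).comp ht).sub hmc)
        (continuous_shrinkSeq hmc hv) (hev.mono fun s hs => N.exists_degenerate hs) ⟨a, ha'⟩
      refine ⟨?_, hc.congr ?_⟩
      · filter_upwards [hd, hev] with s ⟨b, hb⟩ hs
        exact ⟨b, (value_step hn').2 ⟨hs, hb⟩⟩
      · filter_upwards [hd, hev] with s ⟨b, hb⟩ hs
        rw [frame_eq hb, frame_eq ((value_step hn').2 ⟨hs, hb⟩)]
    · exact goodAt_of_length ht hv s₀
    · exact fun h => absurd h (not_dom_of_lt hn _ _)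

end UnitNDR

/-! ### Geometric realisations -/

theorem SimplicialSpace.isQuotientMap_realisation (X : SimplicialSpace.{u}) :
    IsQuotientMap (fun z : Σ p : ℕ, stdSimplex ℝ (Fin (p + 1)) × X.obj p =>
      (Quot.mk _ ⟨z.1, z.2⟩ : X.realisation)) :=
  isQuotientMap_quot_mk

theorem SimplicialSpace.compactlyGenerated_realisation (X : SimplicialSpace.{u})
    [∀ p, CompactlyGeneratedSpace (X.obj p)] : CompactlyGeneratedSpace X.realisation :=
  inferInstanceAs (CompactlyGeneratedSpace (Quot X.Glue))

theorem SimplicialSpace.continuous_mk {X : SimplicialSpace.{u}} {S : Type v} [TopologicalSpace S]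
    {p : ℕ} {t : S → stdSimplex ℝ (Fin (p + 1))} {x : S → X.obj p} (ht : Continuous t)
    (hx : Continuous x) : Continuous (fun s => (Quot.mk _ ⟨p, t s, x s⟩ : X.realisation)) :=
  continuous_quot_mk.comp (continuous_sigmaMk.comp (ht.prodMk hx))

theorem SimplicialSpace.Hom.continuous_realise {X Y : SimplicialSpace.{u}} (f : X.Hom Y)
    (hf : ∀ p, Continuous (f.app p)) : Continuous f.realise := by
  refine continuous_quot_lift _ (continuous_sigma fun p => ?_)
  exact SimplicialSpace.continuous_mk continuous_fst ((hf p).comp continuous_snd)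

/-- On an open or closed subset of `|X| × S`, continuity can be tested on families of simplices
that are parametrised by compact Hausdorff spaces. -/
theorem SimplicialSpace.continuousOn_realisation_prod (X : SimplicialSpace.{u})
    [∀ p, CompactlyGeneratedSpace (X.obj p)] {Y : Type v} [TopologicalSpace Y] {S : Type u}
    [TopologicalSpace S] [CompactSpace S] [T2Space S] {R : Set (X.realisation × S)}
    (hR : IsOpen R ∨ IsClosed R) {f : X.realisation × S → Y}
    (h : ∀ (p : ℕ) (T : Type u) [TopologicalSpace T] [CompactSpace T] [T2Space T]
      (t : T → stdSimplex ℝ (Fin (p + 1))) (x : T → X.obj p) (σ : T → S), Continuous t →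
      Continuous x → Continuous σ → (∀ y, (Quot.mk _ ⟨p, t y, x y⟩, σ y) ∈ R) →
      Continuous (fun y => f (Quot.mk _ ⟨p, t y, x y⟩, σ y))) : ContinuousOn f R :=
  continuousOn_quotient_test (D := fun p => stdSimplex ℝ (Fin (p + 1)) × X.obj p)
    (pr := fun p z => Quot.mk _ ⟨p, z⟩) X.isQuotientMap_realisation hR
    fun p T _ _ _ d σ hd hσ hdR => h p T (fun y => (d y).1) (fun y => (d y).2) σ
      (continuous_fst.comp hd) (continuous_snd.comp hd) hσ hdR

theorem SimplicialSpace.continuousOn_realisation (X : SimplicialSpace.{u})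
    [∀ p, CompactlyGeneratedSpace (X.obj p)] {Y : Type v} [TopologicalSpace Y]
    {R : Set X.realisation} (hR : IsOpen R ∨ IsClosed R) {f : X.realisation → Y}
    (h : ∀ (p : ℕ) (T : Type u) [TopologicalSpace T] [CompactSpace T] [T2Space T]
      (t : T → stdSimplex ℝ (Fin (p + 1))) (x : T → X.obj p), Continuous t →
      Continuous x → (∀ y, (Quot.mk _ ⟨p, t y, x y⟩ : X.realisation) ∈ R) →
      Continuous (fun y => f (Quot.mk _ ⟨p, t y, x y⟩))) : ContinuousOn f R := by
  have := X.continuousOn_realisation_prod (S := PUnit) (R := Prod.fst ⁻¹' R)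
    (f := fun z => f z.1) (hR.imp (fun h => h.preimage continuous_fst)
      (fun h => h.preimage continuous_fst))
    fun p T _ _ _ t x _ ht hx _ hR => h p T t x ht hx hR
  exact this.comp (f := fun x => (x, PUnit.unit)) (by fun_prop) fun x hx => hx

/-! ### The simplices of the bar construction of a group -/

/-- The weights of a point of a simplex. -/
def weights {n : ℕ} (t : stdSimplex ℝ (Fin n)) (i : Fin n) : ℝ≥0 := ⟨t i, t.2.1 i⟩

theorem continuous_weights {n : ℕ} : Continuous (weights (n := n)) :=
  continuous_pi fun i =>
    ((continuous_apply i).comp continuous_subtype_val).subtype_mk _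

theorem weights_map {n m : ℕ} (f : Fin n → Fin m) (t : stdSimplex ℝ (Fin n)) (j : Fin m) :
    weights (stdSimplex.map f t) j = ∑ i with f i = j, weights t i := by
  refine NNReal.coe_injective ?_
  rw [NNReal.coe_sum]
  change stdSimplex.map f t j = _
  rw [stdSimplex.map_coe, FunOnFinite.linearMap_apply_apply]
  rfl

theorem exists_weights_ne_zero {n : ℕ} (t : stdSimplex ℝ (Fin n)) : ∃ i, weights t i ≠ 0 := by
  by_contra! h
  have h1 : ∑ i, t i = 1 := t.2.2
  rw [Finset.sum_eq_zero fun i _ => show t i = 0 from congrArg NNReal.toReal (h i)] at h1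
  exact zero_ne_one h1

theorem red_weights_ne_nil {G : Type u} {n : ℕ} (t : stdSimplex ℝ (Fin n)) (v : Fin n → G) :
    red (weights t) v ≠ [] := by
  obtain ⟨i, hi⟩ := exists_weights_ne_zero t
  exact reduce_ne_nil (p := (weights t i, v i)) (List.mem_ofFn.2 ⟨i, rfl⟩) hi

theorem red_map_succAbove {G : Type u} {n : ℕ} (i : Fin (n + 1)) (t : stdSimplex ℝ (Fin n))
    (v : Fin (n + 1) → G) : red (weights (stdSimplex.map i.succAbove t)) v =
      red (weights t) (fun j => v (i.succAbove j)) := by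
  rw [red_succAbove _ v i]
  · congr 1
    funext j
    rw [weights_map, Finset.sum_eq_single_of_mem j (by simp)]
    intro k hk hkj
    exact absurd (Fin.succAbove_right_injective (Finset.mem_filter.1 hk).2) hkj
  · rw [weights_map]
    refine Finset.sum_eq_zero fun k hk => ?_
    exact absurd (Finset.mem_filter.1 hk).2 (Fin.succAbove_ne i k)

theorem predAbove_succ_succAbove {n : ℕ} (i j : Fin (n + 1)) :
    i.predAbove (i.succ.succAbove j) = j := by
  rcases le_or_gt j i with h | h
  · rw [Fin.succAbove_of_castSucc_lt _ _ (Fin.castSucc_lt_succ_iff.2 h),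
      Fin.predAbove_castSucc_of_le _ _ h]
  · rw [Fin.succAbove_of_le_castSucc _ _ (Fin.succ_le_castSucc_iff.2 h),
      Fin.predAbove_succ_of_le _ _ h.le]

theorem red_map_predAbove {G : Type u} {n : ℕ} (i : Fin (n + 1)) (t : stdSimplex ℝ (Fin (n + 2)))
    (v : Fin (n + 1) → G) : red (weights (stdSimplex.map i.predAbove t)) v =
      red (weights t) (fun j => v (i.predAbove j)) := by
  -- The codegeneracy takes the same value at `i.castSucc` and `i.succ`, so these entries merge.
  rw [red_merge (weights t) _ i (by simp)]
  have h1 : (fun j => v (i.predAbove (i.succ.succAbove j))) = v := by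
    funext j
    rw [predAbove_succ_succAbove]
  rw [h1]
  congr 1
  funext j
  rw [weights_map, mergeWeights, Finset.sum_filter, Fin.sum_univ_succAbove _ i.succ, add_comm]
  congr 1
  · rw [Finset.sum_eq_single j]
    · rw [if_pos (predAbove_succ_succAbove i j)]
    · intro k _ hk
      rw [if_neg]
      rwa [predAbove_succ_succAbove]
    · simp
  · rw [Fin.predAbove_succ_self]
    simp [eq_comm]

section GroupBar

variable {G : Type u} [TopologicalSpace G] [Group G]

section Coordinates

variable {Z : Type u} [TopologicalSpace Z]

/-- The first group element of a simplex of positive dimension. -/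
def headEntry {q : ℕ} (x : (groupMonad G).iter (TopCat.of Z) (q + 1)) : G := x.1

/-- The simplex without its first group element. -/
def tailEntries {q : ℕ} (x : (groupMonad G).iter (TopCat.of Z) (q + 1)) :
    (groupMonad G).iter (TopCat.of Z) q := x.2

/-- Prepend a group element to a simplex. -/
def consEntry {q : ℕ} (g : G) (x : (groupMonad G).iter (TopCat.of Z) q) :
    (groupMonad G).iter (TopCat.of Z) (q + 1) := (g, x)

theorem continuous_headEntry {q : ℕ} : Continuous (headEntry (G := G) (Z := Z) (q := q)) :=
  continuous_fst.comp continuous_ofKify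

theorem continuous_tailEntries {q : ℕ} : Continuous (tailEntries (G := G) (Z := Z) (q := q)) :=
  continuous_snd.comp continuous_ofKify

theorem continuous_consEntry {S : Type v} [TopologicalSpace S] [UCompactlyGeneratedSpace.{u} S]
    {q : ℕ} {g : S → G} {x : S → (groupMonad G).iter (TopCat.of Z) q} (hg : Continuous g)
    (hx : Continuous x) : Continuous (fun s => consEntry (g s) (x s)) :=
  (continuous_kify_iff (X := G × (groupMonad G).iter (TopCat.of Z) q)).2 (hg.prodMk hx)

/-- The homogeneous coordinates of the group elements of a simplex. -/
def gverts : ∀ q : ℕ, (groupMonad G).iter (TopCat.of Z) q → Fin (q + 1) → G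
  | 0, _ => fun _ => 1
  | q + 1, x => Fin.cons (headEntry x * gverts q (tailEntries x) 0) (gverts q (tailEntries x))

/-- The last entry of a simplex. -/
def lastEntry : ∀ q : ℕ, (groupMonad G).iter (TopCat.of Z) q → Z
  | 0, x => x
  | q + 1, x => lastEntry q (tailEntries x)

/-- For `x = (g₁, …, g_q, z)` the coordinates are `(g₁⋯g_q, …, g_q, 1)`; inserting a unit repeats
one of them. -/
theorem gverts_iterDegen (q : ℕ) (i : Fin (q + 1)) (x : (groupMonad G).iter (TopCat.of Z) q) :
    gverts (q + 1) ((groupMonad G).iterDegen (TopCat.of Z) q i x) =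
        (fun j => gverts q x (i.predAbove j)) ∧
      lastEntry (q + 1) ((groupMonad G).iterDegen (TopCat.of Z) q i x) = lastEntry q x := by
  induction q with
  | zero =>
    refine ⟨funext fun j => ?_, rfl⟩
    induction j using Fin.cases with
    | zero => exact one_mul _
    | succ j => rfl
  | succ q ih =>
    induction i using Fin.cases with
    | zero =>
      refine ⟨funext fun j => ?_, rfl⟩
      induction j using Fin.cases with
      | zero => exact one_mul _
      | succ j => rfl
    | succ i =>
      obtain ⟨h1, h2⟩ := ih i (tailEntries x)
      refine ⟨funext fun j => ?_, h2⟩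
      induction j using Fin.cases with
      | zero =>
        change headEntry x *
          gverts (q + 1) ((groupMonad G).iterDegen (TopCat.of Z) q i (tailEntries x)) 0 = _
        rw [h1]
        simp only [Fin.predAbove_right_zero]
        rfl
      | succ j =>
        change gverts (q + 1) ((groupMonad G).iterDegen (TopCat.of Z) q i (tailEntries x)) j = _
        rw [h1, Fin.succ_predAbove_succ]
        rfl

theorem continuous_gverts {q : ℕ} [IsTopologicalGroup G] :
    Continuous (gverts (G := G) (Z := Z) q) := by
  induction q with
  | zero => exact continuous_const
  | succ q ih =>
    have h := ih.comp continuous_tailEntries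
    refine continuous_pi fun i => ?_
    induction i using Fin.cases with
    | zero => exact continuous_headEntry.mul ((continuous_apply 0).comp h)
    | succ i => exact (continuous_apply i).comp h

theorem continuous_lastEntry {q : ℕ} : Continuous (lastEntry (G := G) (Z := Z) q) := by
  induction q with
  | zero => exact continuous_id
  | succ q ih => exact ih.comp continuous_tailEntries

theorem compactlyGenerated_iter_succ (q : ℕ) :
    CompactlyGeneratedSpace ((groupMonad G).iter (TopCat.of Z) (q + 1)) :=
  inferInstanceAs (CompactlyGeneratedSpace (Kify (G × (groupMonad G).iter (TopCat.of Z) q)))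

theorem compactlyGenerated_iter [CompactlyGeneratedSpace Z] (q : ℕ) :
    CompactlyGeneratedSpace ((groupMonad G).iter (TopCat.of Z) q) := by
  cases q with
  | zero => exact inferInstanceAs (CompactlyGeneratedSpace Z)
  | succ q => exact compactlyGenerated_iter_succ q

variable {Z' Z'' : Type u} [TopologicalSpace Z'] [TopologicalSpace Z'']

theorem gverts_groupBarMap [MulAction G Z] [MulAction G Z'] (f : Z → Z') (q : ℕ)
    (x : (groupMonad G).iter (TopCat.of Z) q) : gverts q (groupBarMap f q x) = gverts q x := by
  induction q with
  | zero => rfl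
  | succ q ih =>
    have h := ih (tailEntries x)
    funext j
    induction j using Fin.cases with
    | zero => exact congrArg (headEntry x * ·) (congrFun h 0)
    | succ j => exact congrFun h j

theorem lastEntry_groupBarMap [MulAction G Z] [MulAction G Z'] (f : Z → Z') (q : ℕ)
    (x : (groupMonad G).iter (TopCat.of Z) q) :
    lastEntry q (groupBarMap f q x) = f (lastEntry q x) := by
  induction q with
  | zero => rfl
  | succ q ih => exact ih (tailEntries x)

theorem groupBarMap_comp [MulAction G Z] [MulAction G Z'] [MulAction G Z''] (f : Z → Z')
    (f' : Z' → Z'') (q : ℕ) (x : (groupMonad G).iter (TopCat.of Z) q) :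
    groupBarMap f' q (groupBarMap f q x) = groupBarMap (fun z => f' (f z)) q x := by
  induction q with
  | zero => rfl
  | succ q ih => exact congrArg (consEntry (headEntry x)) (ih (tailEntries x))

/-- `groupBarMap` of a constant map is used as replacement of the last entry, possibly by a point of
another `G`-space. -/
theorem groupBarMap_lastEntry [MulAction G Z] (q : ℕ)
    (x : (groupMonad G).iter (TopCat.of Z) q) : groupBarMap (fun _ => lastEntry q x) q x = x := by
  induction q with
  | zero => rfl
  | succ q ih => exact congrArg (consEntry (headEntry x)) (ih (tailEntries x))

theorem continuous_setLastEntry [MulAction G Z] [MulAction G Z'] {S : Type u} [TopologicalSpace S]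
    [CompactSpace S] [T2Space S] {q : ℕ} {x : S → (groupMonad G).iter (TopCat.of Z) q} {z : S → Z'}
    (hx : Continuous x) (hz : Continuous z) :
    Continuous (fun s => groupBarMap (G := G) (fun _ => z s) q (x s)) := by
  induction q with
  | zero => exact hz
  | succ q ih =>
    exact continuous_consEntry (continuous_headEntry.comp hx)
      (ih (continuous_tailEntries.comp hx))

theorem continuous_groupBarMap [MulAction G Z] [MulAction G Z'] {f : Z → Z'} (hf : Continuous f)
    (q : ℕ) : Continuous (groupBarMap (G := G) f q) := by
  induction q with
  | zero => exact hf
  | succ q ih =>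
    have := compactlyGenerated_iter_succ (G := G) (Z := Z) q
    exact continuous_consEntry continuous_headEntry (ih.comp continuous_tailEntries)

/-- All faces but the last only drop a coordinate, and `a = 1`. The last face drops the final
coordinate `1`, so the others are renormalised by the last group element `a`, which at the same time
acts on the point of `Z`. -/
theorem exists_face_eq [MulAction G Z] [MulAction G Z'] (q : ℕ) (i : Fin (q + 2))
    (x : (groupMonad G).iter (TopCat.of Z) (q + 1)) :
    ∃ a : G, (∀ j, gverts q ((groupBar G Z).face q i x) j * a =
        gverts (q + 1) x (i.succAbove j)) ∧
      lastEntry q ((groupBar G Z).face q i x) = a • lastEntry (q + 1) x ∧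
      ∀ z : Z', (groupBar G Z').face q i (groupBarMap (fun _ => z) (q + 1) x) =
        groupBarMap (fun _ => a • z) q ((groupBar G Z).face q i x) := by
  have key : ∀ (q : ℕ) (i : Fin (q + 1)) (x : (groupMonad G).iter (TopCat.of Z) (q + 1)),
      ∃ a : G, (∀ j, gverts q ((groupMonad G).iterFace (A := TopCat.of Z)
          (fun z => (z.1 • z.2 : Z)) q i x) j * a = gverts (q + 1) x (i.succ.succAbove j)) ∧
        lastEntry q ((groupMonad G).iterFace (A := TopCat.of Z)
          (fun z => (z.1 • z.2 : Z)) q i x) = a • lastEntry (q + 1) x ∧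
        ∀ z : Z', (groupMonad G).iterFace (A := TopCat.of Z') (fun z => (z.1 • z.2 : Z')) q i
            (groupBarMap (fun _ => z) (q + 1) x) =
          groupBarMap (fun _ => a • z) q ((groupMonad G).iterFace (A := TopCat.of Z)
            (fun z => (z.1 • z.2 : Z)) q i x) := by
    intro q
    induction q with
    | zero =>
      intro i x
      refine ⟨headEntry x, fun j => ?_, rfl, fun z => rfl⟩
      obtain rfl : i = 0 := Fin.ext (by omega)
      obtain rfl : j = 0 := Fin.ext (by omega)
      exact (one_mul _).trans (mul_one _).symm
    | succ q ih =>
      intro i x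
      induction i using Fin.cases with
      | zero =>
        refine ⟨1, fun j => ?_, (one_smul _ _).symm, fun z => ?_⟩
        · rw [mul_one]
          induction j using Fin.cases with
          | zero => exact mul_assoc _ _ _
          | succ j => rfl
        · rw [one_smul]
          rfl
      | succ i =>
        obtain ⟨a, h1, h2, h3⟩ := ih i (tailEntries x)
        refine ⟨a, fun j => ?_, h2, fun z => congrArg (consEntry (headEntry x)) (h3 z)⟩
        induction j using Fin.cases with
        | zero =>
          refine (mul_assoc _ _ _).trans ((congrArg (headEntry x * ·) (h1 0)).trans ?_)
          rw [Fin.succ_succAbove_zero, Fin.succ_succAbove_zero]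
          rfl
        | succ j =>
          rw [Fin.succ_succAbove_succ]
          exact h1 j
  induction i using Fin.cases with
  | zero => exact ⟨1, fun j => mul_one _, (one_smul _ _).symm, fun z => by rw [one_smul]; rfl⟩
  | succ i => exact key q i x

theorem groupBarMap_degen [MulAction G Z] [MulAction G Z'] (f : Z → Z') (q : ℕ) (i : Fin (q + 1))
    (x : (groupMonad G).iter (TopCat.of Z) q) :
    groupBarMap f (q + 1) ((groupBar G Z).degen q i x) =
      (groupBar G Z').degen q i (groupBarMap f q x) := by
  have key : ∀ (q : ℕ) (i : Fin (q + 1)) (x : (groupMonad G).iter (TopCat.of Z) q),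
      groupBarMap f (q + 1) ((groupMonad G).iterDegen (TopCat.of Z) q i x) =
      (groupMonad G).iterDegen (TopCat.of Z') q i (groupBarMap f q x) := by
    intro q
    induction q with
    | zero => exact fun _ _ => rfl
    | succ q ih =>
      intro i x
      refine Fin.cases rfl (fun j => ?_) i
      exact congrArg (consEntry (headEntry x)) (ih j (tailEntries x))
  exact key q i x

end Coordinates

/-- Continuity of an action, tested on compact Hausdorff spaces. -/
def ContAction (G : Type u) [TopologicalSpace G] [Group G] (Z : Type u) [TopologicalSpace Z]
    [MulAction G Z] : Prop :=
  ∀ (S : Type u) [TopologicalSpace S] [CompactSpace S] [T2Space S] (g : S → G) (z : S → Z),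
    Continuous g → Continuous z → Continuous (fun s => g s • z s)

theorem compactlyGenerated_groupBar {Z : Type u} [TopologicalSpace Z] [MulAction G Z]
    [CompactlyGeneratedSpace Z] (q : ℕ) :
    CompactlyGeneratedSpace ((groupBar G Z).obj q) :=
  compactlyGenerated_iter q

/-! ### Local trivialisations of homotopy quotients -/

namespace UnitNDR

variable (N : UnitNDR G) (n : ℕ) {Z : Type u} [TopologicalSpace Z]

/-- The `n`-th local section, in terms of the coordinates of the bar construction. -/
def psi (q : ℕ) (t : stdSimplex ℝ (Fin (q + 1))) (x : (groupMonad G).iter (TopCat.of Z) q) : G :=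
  N.frame n (red (weights t) (gverts q x))

variable {N n}

theorem value_vertex (t : stdSimplex ℝ (Fin 1)) :
    N.Value 0 (red (weights t) (fun _ => (1 : G))) 1 := by
  refine value_of_length.2 ⟨?_, rfl⟩
  obtain ⟨i, hi⟩ := exists_weights_ne_zero t
  obtain rfl : i = 0 := Fin.ext (by omega)
  exact pos_iff_ne_zero.2 hi

/-- Normalises the `0`-th trivialisation at vertices, so that it matches the inclusion of the fibre
without a correcting group element. -/
theorem psi_vertex (t : stdSimplex ℝ (Fin 1)) (z : (groupMonad G).iter (TopCat.of Z) 0) :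
    N.psi 0 0 t z = 1 :=
  frame_eq (value_vertex t)

theorem continuous_psi [IsTopologicalGroup G] {S : Type u} [TopologicalSpace S] [CompactSpace S] [T2Space S] {q : ℕ}
    {t : S → stdSimplex ℝ (Fin (q + 1))} {x : S → (groupMonad G).iter (TopCat.of Z) q}
    (ht : Continuous t) (hx : Continuous x)
    (h : ∀ s, N.Dom n (red (weights (t s)) (gverts q (x s)))) :
    Continuous (fun s => N.psi n q (t s) (x s)) :=
  continuous_iff_continuousAt.2 fun s => (goodAt_red n q (continuous_weights.comp ht)
    (continuous_gverts.comp hx) s (h s)).2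

theorem psi_groupBarMap {Z' : Type u} [TopologicalSpace Z'] [MulAction G Z] [MulAction G Z']
    (f : Z → Z') (q : ℕ) (t : stdSimplex ℝ (Fin (q + 1)))
    (x : (groupMonad G).iter (TopCat.of Z) q) :
    N.psi n q t (groupBarMap f q x) = N.psi n q t x := by
  rw [psi, gverts_groupBarMap]
  rfl

theorem red_face [MulAction G Z] {q : ℕ} {i : Fin (q + 2)}
    {x : (groupMonad G).iter (TopCat.of Z) (q + 1)} {a : G}
    (ha : ∀ j, gverts q ((groupBar G Z).face q i x) j * a = gverts (q + 1) x (i.succAbove j))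
    (t : stdSimplex ℝ (Fin (q + 1))) :
    red (weights (stdSimplex.map i.succAbove t)) (gverts (q + 1) x) =
      translate a (red (weights t) (gverts q ((groupBar G Z).face q i x))) := by
  rw [red_map_succAbove, ← red_mul]
  simp only [ha]

/-- The factor `a` cancels against the translation of the last entry in `exists_face_eq`; this is
why `untwist` and `twist` respect the gluing. -/
theorem psi_face [MulAction G Z] {q : ℕ} {i : Fin (q + 2)}
    {x : (groupMonad G).iter (TopCat.of Z) (q + 1)} {a : G}
    (ha : ∀ j, gverts q ((groupBar G Z).face q i x) j * a = gverts (q + 1) x (i.succAbove j))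
    (t : stdSimplex ℝ (Fin (q + 1))) : N.psi n (q + 1) (stdSimplex.map i.succAbove t) x =
      N.psi n q t ((groupBar G Z).face q i x) * a := by
  rw [psi, red_face ha, frame_translate (red_weights_ne_nil _ _)]
  rfl

theorem red_degen [MulAction G Z] {q : ℕ} (i : Fin (q + 1))
    (x : (groupMonad G).iter (TopCat.of Z) q) (t : stdSimplex ℝ (Fin (q + 2))) :
    red (weights (stdSimplex.map i.predAbove t)) (gverts q x) =
      red (weights t) (gverts (q + 1) ((groupBar G Z).degen q i x)) := by
  rw [red_map_predAbove]
  exact congrArg _ (gverts_iterDegen q i x).1.symm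

theorem psi_degen [MulAction G Z] {q : ℕ} (i : Fin (q + 1))
    (x : (groupMonad G).iter (TopCat.of Z) q) (t : stdSimplex ℝ (Fin (q + 2))) :
    N.psi n q (stdSimplex.map i.predAbove t) x =
      N.psi n (q + 1) t ((groupBar G Z).degen q i x) := by
  rw [psi, red_degen]
  rfl

variable (N n)

/-- The `n`-th open subset of a homotopy quotient. -/
def chart (Z : Type u) [TopologicalSpace Z] [MulAction G Z] (m : HomotopyQuotient G Z) : Prop :=
  Quot.lift (fun z : (Σ q : ℕ, stdSimplex ℝ (Fin (q + 1)) × (groupBar G Z).obj q) =>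
    N.Dom n (red (weights z.2.1) (gverts z.1 z.2.2))) (by
      rintro _ _ (⟨q, i, t, x⟩ | ⟨q, i, t, x⟩)
      · obtain ⟨a, ha, -⟩ := exists_face_eq (Z' := Z) q i x
        dsimp only
        rw [red_face ha, dom_translate]
      · exact congrArg (N.Dom n) (red_degen i x t)) m

/-- The `n`-th local trivialisation of a homotopy quotient. -/
def untwist {Z : Type u} [TopologicalSpace Z] [MulAction G Z] : HomotopyQuotient G Z → Z :=
  Quot.lift (fun z : (Σ q : ℕ, stdSimplex ℝ (Fin (q + 1)) × (groupBar G Z).obj q) =>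
    N.psi n z.1 z.2.1 z.2.2 • lastEntry z.1 z.2.2) (by
      rintro _ _ (⟨q, i, t, x⟩ | ⟨q, i, t, x⟩)
      · obtain ⟨a, ha, ha', -⟩ := exists_face_eq (Z' := Z) q i x
        dsimp only
        rw [psi_face ha, mul_smul, ha']
      · exact congrArg₂ (· • ·) (psi_degen i x t) (gverts_iterDegen q i x).2.symm)

/-- The embedding of a `G`-space `Z'` into its homotopy quotient as the fibre over a point `m` of
a homotopy quotient, given by the `n`-th local trivialisation. -/
def twist {Z Z' : Type u} [TopologicalSpace Z] [MulAction G Z] [TopologicalSpace Z']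
    [MulAction G Z'] (m : HomotopyQuotient G Z) (z : Z') : HomotopyQuotient G Z' :=
  Quot.lift (fun y : (Σ q : ℕ, stdSimplex ℝ (Fin (q + 1)) × (groupBar G Z).obj q) =>
    (Quot.mk _ ⟨y.1, y.2.1, groupBarMap (fun _ => (N.psi n y.1 y.2.1 y.2.2)⁻¹ • z) y.1 y.2.2⟩ :
      HomotopyQuotient G Z')) (by
      rintro _ _ (⟨q, i, t, x⟩ | ⟨q, i, t, x⟩)
      · obtain ⟨a, ha, -, ha'⟩ := exists_face_eq (Z' := Z') q i x
        dsimp only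
        -- The face moves the inserted point by `a`, and this cancels the factor `a⁻¹` coming from
        -- the inverse of `psi`.
        refine (Quot.sound (SimplicialSpace.Glue.face q i t _)).trans ?_
        rw [psi_face ha, mul_inv_rev, mul_smul, ha', smul_inv_smul]
      · change (groupMonad G).iter (TopCat.of Z) q at x
        refine (Quot.sound (SimplicialSpace.Glue.degen q i t _)).trans ?_
        refine congrArg (fun y => Quot.mk (groupBar G Z').Glue (Sigma.mk (q + 1) (t, y))) ?_
        refine (groupBarMap_degen _ q i x).symm.trans ?_
        dsimp only
        rw [psi_degen i x t]) m

section Identities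

variable {N n} {Z Z' Z'' : Type u} [TopologicalSpace Z] [MulAction G Z] [TopologicalSpace Z']
  [MulAction G Z'] [TopologicalSpace Z''] [MulAction G Z'']

theorem untwist_map (f : Z → Z') (hf : ∀ (g : G) (z : Z), f (g • z) = g • f z)
    (m : HomotopyQuotient G Z) :
    N.untwist n (homotopyQuotientMap f hf m) = f (N.untwist n m) := by
  obtain ⟨q, t, x⟩ := m
  change (groupMonad G).iter (TopCat.of Z) q at x
  change N.psi n q t (groupBarMap f q x) • lastEntry q (groupBarMap f q x) =
    f (N.psi n q t x • lastEntry q x)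
  rw [psi_groupBarMap, lastEntry_groupBarMap, hf]

theorem twist_map (f : Z' → Z'') (hf : ∀ (g : G) (z : Z'), f (g • z) = g • f z)
    (m : HomotopyQuotient G Z) (z : Z') :
    homotopyQuotientMap f hf (N.twist n m z) = N.twist n m (f z) := by
  obtain ⟨q, t, x⟩ := m
  change (groupMonad G).iter (TopCat.of Z) q at x
  refine congrArg (fun y => Quot.mk (groupBar G Z'').Glue (Sigma.mk q (t, y))) ?_
  refine (groupBarMap_comp _ _ q x).trans ?_
  simp only [hf]

/-- Only the weights and group entries of `m` enter `twist`, so a point of a homotopy quotient may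
be replaced by its image in another one. -/
theorem twist_homotopyQuotientMap (f : Z → Z'') (hf : ∀ (g : G) (z : Z), f (g • z) = g • f z)
    (m : HomotopyQuotient G Z) (z : Z') :
    N.twist n (homotopyQuotientMap f hf m) z = N.twist n m z := by
  obtain ⟨q, t, x⟩ := m
  change (groupMonad G).iter (TopCat.of Z) q at x
  refine congrArg (fun y => Quot.mk (groupBar G Z').Glue (Sigma.mk q (t, y))) ?_
  refine (groupBarMap_comp _ _ q x).trans ?_
  change groupBarMap (fun _ => (N.psi n q t (groupBarMap f q x))⁻¹ • z) q x =
    groupBarMap (fun _ => (N.psi n q t x)⁻¹ • z) q x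
  rw [psi_groupBarMap]

theorem twist_untwist (m : HomotopyQuotient G Z) : N.twist n m (N.untwist n m) = m := by
  obtain ⟨q, t, x⟩ := m
  change (groupMonad G).iter (TopCat.of Z) q at x
  refine congrArg (fun y => Quot.mk (groupBar G Z).Glue (Sigma.mk q (t, y))) ?_
  change groupBarMap (fun _ => (N.psi n q t x)⁻¹ • N.psi n q t x • lastEntry q x) q x = x
  rw [inv_smul_smul, groupBarMap_lastEntry]

theorem chart_map (f : Z → Z') (hf : ∀ (g : G) (z : Z), f (g • z) = g • f z)
    (m : HomotopyQuotient G Z) :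
    N.chart n Z' (homotopyQuotientMap f hf m) ↔ N.chart n Z m := by
  obtain ⟨q, t, x⟩ := m
  change (groupMonad G).iter (TopCat.of Z) q at x
  change N.Dom n (red (weights t) (gverts q (groupBarMap f q x))) ↔
    N.Dom n (red (weights t) (gverts q x))
  rw [gverts_groupBarMap]

theorem exists_chart (m : HomotopyQuotient G Z) : ∃ n, N.chart n Z m := by
  obtain ⟨q, t, x⟩ := m
  change (groupMonad G).iter (TopCat.of Z) q at x
  obtain ⟨i, hi⟩ := exists_weights_ne_zero t
  exact exists_dom _ _ i hi

theorem chart_vertex (z : Z) : N.chart 0 Z ((groupBar G Z).vertex z) := ⟨1, value_vertex _⟩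

theorem untwist_vertex (z : Z) : N.untwist 0 ((groupBar G Z).vertex z) = z := by
  refine Eq.trans (congrArg (· • z) (psi_vertex (N := N) (Z := Z) _ z)) (one_smul _ _)

theorem twist_vertex (z : Z) (z' : Z') :
    N.twist 0 ((groupBar G Z).vertex z) z' = (groupBar G Z').vertex z' := by
  refine congrArg (fun y => Quot.mk (groupBar G Z').Glue (Sigma.mk 0 (stdSimplex.vertex 0, y))) ?_
  refine Eq.trans (congrArg (fun g => g⁻¹ • z') (psi_vertex (N := N) (Z := Z) _ z)) ?_
  rw [inv_one, one_smul]

end Identities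

section Continuity

variable {N n} [IsTopologicalGroup G] {Z Z' : Type u} [TopologicalSpace Z] [MulAction G Z]
  [TopologicalSpace Z'] [MulAction G Z']

theorem isOpen_chart [CompactlyGeneratedSpace Z] : IsOpen {m | N.chart n Z m} := by
  refine (groupBar G Z).isQuotientMap_realisation.isOpen_preimage.1 ?_
  refine isOpen_sigma_iff.2 fun q => ?_
  have := compactlyGenerated_groupBar (G := G) (Z := Z) q
  refine CompactlyGeneratedSpace.isOpen' fun S _ _ _ g hg => ?_
  refine isOpen_iff_mem_nhds.2 fun s hs => ?_
  exact (goodAt_red n q (continuous_weights.comp (continuous_fst.comp hg))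
    (continuous_gverts.comp (continuous_snd.comp hg)) s hs).1

theorem continuousOn_untwist [CompactlyGeneratedSpace Z] (hZ : ContAction G Z) :
    ContinuousOn (N.untwist n (Z := Z)) {m | N.chart n Z m} := by
  have := compactlyGenerated_groupBar (G := G) (Z := Z)
  refine (groupBar G Z).continuousOn_realisation (Or.inl isOpen_chart)
    fun q T _ _ _ t x ht hx hR => ?_
  exact hZ T _ _ (continuous_psi ht hx hR) (continuous_lastEntry.comp hx)

theorem continuous_twist [CompactlyGeneratedSpace Z] (hZ : ContAction G Z') {S : Type u}
    [TopologicalSpace S] [CompactSpace S] [T2Space S] {m : S → HomotopyQuotient G Z} {z : S → Z'}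
    (hm : Continuous m) (hz : Continuous z) (h : ∀ s, N.chart n Z (m s)) :
    Continuous (fun s => N.twist n (m s) (z s)) := by
  have := compactlyGenerated_groupBar (G := G) (Z := Z)
  -- The base point is treated as an independent variable, so that it can be represented by
  -- simplices; afterwards the result is pulled back along `s ↦ (m s, s)`.
  have key : ContinuousOn (fun p : HomotopyQuotient G Z × S => N.twist n p.1 (z p.2))
      {p | N.chart n Z p.1} := by
    refine (groupBar G Z).continuousOn_realisation_prod
      (Or.inl (isOpen_chart.preimage continuous_fst)) fun q T _ _ _ t x σ ht hx hσ hR => ?_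
    refine SimplicialSpace.continuous_mk ht (continuous_setLastEntry hx ?_)
    exact hZ T _ _ (continuous_psi ht hx hR).inv (hz.comp hσ)
  exact key.comp_continuous (f := fun s => (m s, s)) (hm.prodMk continuous_id) h

end Continuity

end UnitNDR

end GroupBar

/-! ### Continuity properties of spaces of smooth maps -/

universe v₁ w₁ v₂ w₂ v₃ w₃

namespace Mfd

theorem iterTangentSet_univ (k : ℕ) (X : Mfd.{v, w}) : iterTangentSet k X univ = univ := by
  induction k generalizing X with
  | zero => rfl
  | succ k ih => exact ih X.tangent

theorem iterTangentMap_congr (k : ℕ) (X : Mfd.{v₁, w₁}) (Y : Mfd.{v₂, w₂}) {s : Set X.M}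
    {f f' : X.M → Y.M} (h : EqOn f f' s) :
    EqOn (iterTangentMap k X Y s f) (iterTangentMap k X Y s f') (iterTangentSet k X s) := by
  induction k generalizing X Y with
  | zero => exact h
  | succ k ih => exact ih X.tangent Y.tangent fun p hp => tangentMapWithin_congr h p hp

theorem continuousOn_iterTangentMap (k : ℕ) (X : Mfd.{v₁, w₁}) (Y : Mfd.{v₂, w₂}) {s : Set X.M}
    (hs : UniqueMDiffOn X.I s) {f : X.M → Y.M} (hf : ContMDiffOn X.I Y.I ∞ f s) :
    ContinuousOn (iterTangentMap k X Y s f) (iterTangentSet k X s) := by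
  induction k generalizing X Y with
  | zero => exact hf.continuousOn
  | succ k ih =>
    exact ih X.tangent Y.tangent hs.tangentBundle_proj_preimage
      (hf.contMDiffOn_tangentMapWithin (m := ∞) (by simp) hs)

/-- The chain rule, iterated: each application of the tangent functor turns a composite into a
composite. -/
theorem iterTangentMap_comp (k : ℕ) (X : Mfd.{v₁, w₁}) (Y : Mfd.{v₂, w₂}) (Z : Mfd.{v₃, w₃})
    {s : Set X.M} (hs : UniqueMDiffOn X.I s) {f : X.M → Y.M} (hf : ContMDiffOn X.I Y.I ∞ f s)
    {g : Y.M → Z.M} (hg : ContMDiff Y.I Z.I ∞ g) :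
    EqOn (iterTangentMap k X Z s (g ∘ f))
      (iterTangentMap k Y Z univ g ∘ iterTangentMap k X Y s f) (iterTangentSet k X s) := by
  induction k generalizing X Y Z with
  | zero => exact fun _ _ => rfl
  | succ k ih =>
    have h : EqOn (tangentMapWithin X.I Z.I (g ∘ f) s)
        (tangentMapWithin Y.I Z.I g univ ∘ tangentMapWithin X.I Y.I f s)
        ((fun p : TangentBundle X.I X.M => p.proj) ⁻¹' s) := fun p hp =>
      tangentMapWithin_comp_at p
        (hg.mdifferentiable (by simp) _).mdifferentiableWithinAt
        ((hf _ hp).mdifferentiableWithinAt (by simp)) (fun _ _ => mem_univ _) (hs _ hp)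
    refine (iterTangentMap_congr k X.tangent Z.tangent h).trans ?_
    refine ih X.tangent Y.tangent Z.tangent hs.tangentBundle_proj_preimage
      (hf.contMDiffOn_tangentMapWithin (m := ∞) (by simp) hs) ?_
    have := hg.contMDiff_tangentMap (m := ∞) (by simp)
    rw [← tangentMapWithin_univ] at this
    exact this

theorem locallyCompactSpace_iterTangent (k : ℕ) (X : Mfd.{v, w}) [FiniteDimensional ℝ X.E] :
    LocallyCompactSpace (X.iterTangent k).M := by
  induction k generalizing X with
  | zero => exact Manifold.locallyCompact_of_finiteDimensional (M := X.M) X.I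
  | succ k ih =>
    have : FiniteDimensional ℝ X.tangent.E := inferInstanceAs (FiniteDimensional ℝ (X.E × X.E))
    exact ih X.tangent

end Mfd

/-- A continuity criterion for maps into a space of smooth maps. -/
theorem continuous_smoothTopology {X : Mfd.{v₁, w₁}} {Y : Mfd.{v₂, w₂}} {s : Set X.M} {T : Type*}
    [TopologicalSpace T] {F : T → X.M → Y.M}
    (h : ∀ (k : ℕ) (K : Set (X.iterTangent k).M) (V : Set (Y.iterTangent k).M), IsCompact K →
      K ⊆ Mfd.iterTangentSet k X s → IsOpen V →
      IsOpen {x | MapsTo (Mfd.iterTangentMap k X Y s (F x)) K V}) :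
    @Continuous _ _ _ (smoothTopology X Y s) F := by
  refine continuous_generateFrom_iff.2 ?_
  rintro _ ⟨k, K, V, hK, hKs, hV, rfl⟩
  exact h k K V hK hKs hV

theorem isOpen_smoothTopology {X : Mfd.{v₁, w₁}} {Y : Mfd.{v₂, w₂}} {s : Set X.M} {T : Type*}
    [TopologicalSpace T] {F : T → X.M → Y.M} (hF : @Continuous _ _ _ (smoothTopology X Y s) F)
    (k : ℕ) {K : Set (X.iterTangent k).M} {V : Set (Y.iterTangent k).M} (hK : IsCompact K)
    (hKs : K ⊆ Mfd.iterTangentSet k X s) (hV : IsOpen V) :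
    IsOpen {x | MapsTo (Mfd.iterTangentMap k X Y s (F x)) K V} :=
  continuous_generateFrom_iff.1 hF _ ⟨k, K, V, hK, hKs, hV, rfl⟩

/-- Composition of smooth maps is continuous. -/
theorem continuous_comp_smoothTopology {X : Mfd.{v₁, w₁}} {Y : Mfd.{v₂, w₂}} {Z : Mfd.{v₃, w₃}}
    [FiniteDimensional ℝ Y.E] {s : Set X.M} (hs : UniqueMDiffOn X.I s) {T : Type*}
    [TopologicalSpace T] {F : T → X.M → Y.M} {G : T → Y.M → Z.M}
    (hF : @Continuous _ _ _ (smoothTopology X Y s) F)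
    (hG : @Continuous _ _ _ (smoothTopology Y Z univ) G)
    (hF' : ∀ x, ContMDiffOn X.I Y.I ∞ (F x) s) (hG' : ∀ x, ContMDiff Y.I Z.I ∞ (G x)) :
    @Continuous _ _ _ (smoothTopology X Z s) (fun x => G x ∘ F x) := by
  refine continuous_smoothTopology fun k K V hK hKs hV => isOpen_iff_mem_nhds.2 fun x hx => ?_
  have := Mfd.locallyCompactSpace_iterTangent k Y
  have hGc : Continuous (Mfd.iterTangentMap k Y Z univ (G x)) := by
    have := Mfd.continuousOn_iterTangentMap k Y Z uniqueMDiffOn_univ (hG' x).contMDiffOn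
    rwa [Mfd.iterTangentSet_univ, continuousOn_univ] at this
  have hFK : IsCompact (Mfd.iterTangentMap k X Y s (F x) '' K) :=
    hK.image_of_continuousOn ((Mfd.continuousOn_iterTangentMap k X Y hs (hF' x)).mono hKs)
  -- As for the compact-open topology, a compact `L` is interposed in the locally compact middle
  -- space: nearby inner maps send `K` into the interior of `L`, and nearby outer maps send `L` into
  -- `V`.
  obtain ⟨L, hL, hKL, hLV⟩ := exists_compact_between hFK (hV.preimage hGc) (by
    rintro _ ⟨p, hp, rfl⟩
    have := hx hp
    rwa [Mfd.iterTangentMap_comp k X Y Z hs (hF' x) (hG' x) (hKs hp)] at this)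
  have h₁ := isOpen_smoothTopology hF k hK hKs isOpen_interior (V := interior L)
  have h₂ := isOpen_smoothTopology hG k hL (by rw [Mfd.iterTangentSet_univ]; exact subset_univ _) hV
  filter_upwards [h₁.mem_nhds (show x ∈ _ from fun p hp => hKL ⟨p, hp, rfl⟩),
    h₂.mem_nhds (show x ∈ _ from fun p hp => hLV hp)] with y hy₁ hy₂ p hp
  rw [Mfd.iterTangentMap_comp k X Y Z hs (hF' y) (hG' y) (hKs hp)]
  exact hy₂ (interior_subset (hy₁ hp))

/-! ### Diffeomorphism groups, framings and embedded discs -/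

section Manifold

variable {d : ℕ} {θ : TangentialStructure.{u} d} {H : Type w} [TopologicalSpace H]
  {I : ModelWithCorners ℝ (Euc d) H} {W : Type u} [TopologicalSpace W] [ChartedSpace H W]
  [IsManifold I ∞ W]

instance : FiniteDimensional ℝ (toMfd I W).E := inferInstanceAs (FiniteDimensional ℝ (Euc d))

namespace DiffBd

variable {C : Collar I W}

theorem continuous_coe : @Continuous _ _ _ (smoothTopology (toMfd I W) (toMfd I W) univ)
    (fun φ : DiffBd C => (φ.1 : W → W)) :=
  continuous_iff_le_induced.2 inf_le_left

theorem continuous_coe_symm : @Continuous _ _ _ (smoothTopology (toMfd I W) (toMfd I W) univ)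
    (fun φ : DiffBd C => (φ.1.symm : W → W)) :=
  continuous_iff_le_induced.2 inf_le_right

theorem continuous_iff {T : Type*} [TopologicalSpace T] {f : T → DiffBd C} : Continuous f ↔
    @Continuous _ _ _ (smoothTopology (toMfd I W) (toMfd I W) univ) (fun x => ((f x).1 : W → W)) ∧
    @Continuous _ _ _ (smoothTopology (toMfd I W) (toMfd I W) univ)
      (fun x => ((f x).1.symm : W → W)) :=
  continuous_inf_rng.trans (and_congr continuous_induced_rng continuous_induced_rng)

/-- The topology controls a diffeomorphism and its inverse symmetrically, so inversion is continuous
at once and only composition needs an argument. -/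
instance : IsTopologicalGroup (DiffBd C) where
  continuous_mul := by
    have h₁ := (continuous_iff (C := C) (T := DiffBd C × DiffBd C)).1 continuous_fst
    have h₂ := (continuous_iff (C := C) (T := DiffBd C × DiffBd C)).1 continuous_snd
    refine continuous_iff.2 ⟨?_, ?_⟩
    · have := continuous_comp_smoothTopology (X := toMfd I W) (Y := toMfd I W) (Z := toMfd I W)
        uniqueMDiffOn_univ h₂.1 h₁.1 (fun x => x.2.1.contMDiff.contMDiffOn)
        (fun x => x.1.1.contMDiff)
      exact this
    · have := continuous_comp_smoothTopology (X := toMfd I W) (Y := toMfd I W) (Z := toMfd I W)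
        uniqueMDiffOn_univ h₁.2 h₂.2 (fun x => x.1.1.symm.contMDiff.contMDiffOn)
        (fun x => x.2.1.symm.contMDiff)
      exact this
  continuous_inv := continuous_iff.2 ⟨continuous_coe_symm, continuous_coe⟩

theorem continuous_eval (x : W) : Continuous (fun φ : DiffBd C => φ.1 x) := by
  refine continuous_def.2 fun V hV => ?_
  have := isOpen_smoothTopology (X := toMfd I W) (Y := toMfd I W) (continuous_coe (C := C)) 0 (K := ({x} : Set W)) (V := V)
    isCompact_singleton (subset_univ _) hV
  convert this using 1
  ext φ
  exact (mapsTo_singleton).symm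

instance [T2Space W] : T2Space (DiffBd C) :=
  T2Space.of_injective_continuous (f := fun (φ : DiffBd C) (x : W) => φ.1 x)
    (fun _ _ h => Subtype.ext (Diffeomorph.ext fun x => congrFun h x))
    (continuous_pi continuous_eval)

/-- The case `k = 1` of the subbasis of the `C^∞`-topology is the compact-open topology on tangent
maps. -/
theorem continuous_tangentInv : Continuous (fun φ : DiffBd C => φ.tangentInv) := by
  refine ContinuousMap.continuous_compactOpen.2 fun K hK U hU => ?_
  have := isOpen_smoothTopology (X := toMfd I W) (Y := toMfd I W)
    (continuous_coe_symm (C := C)) 1 (K := K) (V := U) hK (subset_univ _) hU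
  convert this using 1
  ext φ
  change MapsTo (tangentMap I I φ.1.symm) K U ↔ MapsTo (tangentMapWithin I I φ.1.symm univ) K U
  rw [tangentMapWithin_univ]

end DiffBd

/-- Makes composition through `TW` jointly continuous in the compact-open topology, hence also the
action on framings and their restriction to discs. -/
instance : LocallyCompactSpace (TangentBundle I W) :=
  Mfd.locallyCompactSpace_iterTangent 1 (toMfd I W)

theorem continuous_fr_mk {T : Type*} [TopologicalSpace T] {F : T → Fr θ I W} :
    Continuous F ↔ Continuous (fun x => (F x).1) :=
  continuous_induced_rng

theorem Fr.continuous_smul {C : Collar I W} {T : Type*} [TopologicalSpace T] {φ : T → DiffBd C}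
    {ℓ : T → Fr θ I W} (hφ : Continuous φ) (hℓ : Continuous ℓ) :
    Continuous (fun x => φ x • ℓ x) :=
  continuous_fr_mk.2 ((continuous_fr_mk.1 hℓ).compCM (DiffBd.continuous_tangentInv.comp hφ))

theorem FrOrbit.continuous_val {ℓW : Fr θ I W} {C : Collar I W} :
    Continuous (fun ℓ : FrOrbit ℓW C => ℓ.1.1) :=
  (continuous_induced_dom : Continuous (fun ℓ : FrBd ℓW C => ℓ.1)).comp continuous_induced_dom

theorem FrOrbit.continuous_iff {ℓW : Fr θ I W} {C : Collar I W} {T : Type*} [TopologicalSpace T]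
    {ℓ : T → FrOrbit ℓW C} : Continuous ℓ ↔ Continuous (fun x => (ℓ x).1.1) :=
  ⟨fun h => FrOrbit.continuous_val.comp h,
    fun h => continuous_induced_rng.2 (continuous_induced_rng.2 h)⟩

theorem FrOrbit.continuous_smul {ℓW : Fr θ I W} {C : Collar I W} {T : Type*} [TopologicalSpace T]
    {φ : T → DiffBd C} {ℓ : T → FrOrbit ℓW C} (hφ : Continuous φ) (hℓ : Continuous ℓ) :
    Continuous (fun x => φ x • ℓ x) :=
  FrOrbit.continuous_iff.2 (Fr.continuous_smul hφ (FrOrbit.continuous_iff.1 hℓ))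

theorem DiscEmb.continuous_iff {T : Type*} [TopologicalSpace T] {f : T → DiscEmb I W} :
    Continuous f ↔ @Continuous _ _ _ (smoothTopology (eucMfd d) (toMfd I W) (ballSet d))
      (fun x => extendDisc (f x).1) :=
  continuous_induced_rng

theorem DiscEmb.continuous_postcomp {C : Collar I W} {T : Type*} [TopologicalSpace T]
    {φ : T → DiffBd C} {f : T → DiscEmb I W} (hφ : Continuous φ) (hf : Continuous f) :
    Continuous (fun x => (f x).postcomp (φ x)) := by
  have h : (fun x => extendDisc ((f x).postcomp (φ x)).1) =
      fun x => (φ x).1 ∘ extendDisc (f x).1 :=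
    funext fun x => extendDisc_postcomp _ _
  have h' := continuous_comp_smoothTopology (X := eucMfd d) (Y := toMfd I W) (Z := toMfd I W)
    uniqueMDiffOn_ballSet (DiscEmb.continuous_iff.1 hf) (DiffBd.continuous_iff.1 hφ).1
    (fun x => (f x).2.smooth) (fun x => (φ x).1.contMDiff)
  exact DiscEmb.continuous_iff.2 (h ▸ h')

theorem DiscEmb.continuous_tangentMap :
    Continuous (fun f : DiscEmb I W => (⟨f.tangent, f.continuous_tangent⟩ : C(_, _))) := by
  refine ContinuousMap.continuous_compactOpen.2 fun K hK U hU => ?_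
  have := isOpen_smoothTopology (X := eucMfd d) (Y := toMfd I W)
    (DiscEmb.continuous_iff.1 (continuous_id (X := DiscEmb I W))) 1
    (K := (discVec '' K : Set (TangentBundle 𝓘(ℝ, Euc d) (Euc d)))) (V := U)
    (hK.image continuous_discVec) (by
      rintro _ ⟨p, _, rfl⟩
      exact p.1.2) hU
  convert this using 1
  ext f
  exact (mapsTo_image_iff (g := discVec (d := d))
    (f := tangentMapWithin 𝓘(ℝ, Euc d) I (extendDisc f.1) (ballSet d))).symm

theorem Fr.continuous_pull {T : Type*} [TopologicalSpace T] {ℓ : T → Fr θ I W}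
    {f : T → DiscEmb I W} (hℓ : Continuous ℓ) (hf : Continuous f) :
    Continuous (fun x => Fr.pull (ℓ x) (f x)) :=
  continuous_induced_rng.2
    ((continuous_fr_mk.1 hℓ).compCM (DiscEmb.continuous_tangentMap.comp hf))

/-- The coordinates of `ℝ^∞`. -/
def RInf.coord (i : ℕ) (x : RInf) : ℝ := (show ℕ →₀ ℝ from x) i

/-- Checked on each `ℝ^n` of the colimit. Coordinates separate points, so `ℝ^∞` is Hausdorff. -/
theorem RInf.continuous_coord (i : ℕ) : Continuous (RInf.coord i) := by
  refine continuous_iSup_dom.2 fun n => continuous_coinduced_dom.2 ?_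
  have : RInf.coord i ∘ RInf.incl n =
      fun x : Fin n → ℝ => ∑ j : Fin n, if (j : ℕ) = i then x j else 0 := by
    funext x
    change (∑ j : Fin n, Finsupp.single (j : ℕ) (x j)) i = _
    rw [Finsupp.finsetSum_apply]
    simp only [Finsupp.single_apply]
  rw [this]
  refine continuous_finsetSum _ fun j _ => ?_
  split_ifs
  · exact continuous_apply j
  · exact continuous_const

instance : T2Space RInf :=
  T2Space.of_injective_continuous (f := fun (x : RInf) (i : ℕ) => RInf.coord i x)
    (fun _ _ h => Finsupp.ext fun i => congrFun h i) (continuous_pi RInf.continuous_coord)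

instance : T2Space θ.Total :=
  inferInstanceAs (T2Space {p : θ.L × RInf // p.2 ∈ θ.fibre p.1})

/-- Framings are maps into the Hausdorff space `θ.Total`. As a consequence, prescribing the framing
is a closed condition, and continuity on the corresponding subsets can be tested. -/
instance (ℓW : Fr θ I W) (C : Collar I W) : T2Space (FrOrbit ℓW C) :=
  T2Space.of_injective_continuous (f := fun ℓ : FrOrbit ℓW C => ℓ.1.1.1)
    (fun _ _ h => Subtype.ext (Subtype.ext (Subtype.ext h)))
    (continuous_induced_dom.comp FrOrbit.continuous_val)

end Manifold

/-! ### Families of maps of bar constructions -/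

theorem SimplicialSpace.continuousOn_realise_family {X X' : SimplicialSpace.{u}}
    [∀ p, CompactlyGeneratedSpace (X.obj p)] {S : Type u} [TopologicalSpace S] [CompactSpace S]
    [T2Space S] (f : S → X.Hom X') {R : Set (X.realisation × S)} (hR : IsOpen R ∨ IsClosed R)
    (h : ∀ (p : ℕ) (T : Type u) [TopologicalSpace T] [CompactSpace T] [T2Space T]
      (t : T → stdSimplex ℝ (Fin (p + 1))) (x : T → X.obj p) (σ : T → S), Continuous t →
      Continuous x → Continuous σ → (∀ y, (Quot.mk _ ⟨p, t y, x y⟩, σ y) ∈ R) →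
      Continuous (fun y => (f (σ y)).app p (x y))) :
    ContinuousOn (fun z : X.realisation × S => (f z.2).realise z.1) R :=
  X.continuousOn_realisation_prod hR fun p T _ _ _ t x σ ht hx hσ hT =>
    SimplicialSpace.continuous_mk ht (h p T t x σ ht hx hσ hT)

theorem SimplicialSpace.Hom.continuousOn_realise {X X' : SimplicialSpace.{u}}
    [∀ p, CompactlyGeneratedSpace (X.obj p)] (f : X.Hom X') {R : Set X.realisation}
    (hR : IsOpen R ∨ IsClosed R)
    (h : ∀ (p : ℕ) (T : Type u) [TopologicalSpace T] [CompactSpace T] [T2Space T]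
      (t : T → stdSimplex ℝ (Fin (p + 1))) (x : T → X.obj p), Continuous t →
      Continuous x → (∀ y, (Quot.mk _ ⟨p, t y, x y⟩ : X.realisation) ∈ R) →
      Continuous (fun y => f.app p (x y))) : ContinuousOn f.realise R :=
  X.continuousOn_realisation hR fun p T _ _ _ t x ht hx hT =>
    SimplicialSpace.continuous_mk ht (h p T t x ht hx hT)

theorem SimplicialSpace.continuous_augment (X : SimplicialSpace.{u}) {Y : Type u}
    [TopologicalSpace Y] (f : ∀ p : ℕ, X.obj p → Y)
    (hface : ∀ p i x, f p (X.face p i x) = f (p + 1) x)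
    (hdegen : ∀ p i x, f (p + 1) (X.degen p i x) = f p x) (hf : ∀ p, Continuous (f p)) :
    Continuous (X.augment f hface hdegen) :=
  continuous_quot_lift _ (continuous_sigma fun p => (hf p).comp continuous_snd)

theorem SimplicialSpace.continuous_vertex (X : SimplicialSpace.{u}) : Continuous X.vertex :=
  SimplicialSpace.continuous_mk continuous_const continuous_id

theorem continuous_homotopyQuotientMap {G : Type u} [TopologicalSpace G] [Group G] {Z Z' : Type u}
    [TopologicalSpace Z] [MulAction G Z] [TopologicalSpace Z'] [MulAction G Z'] {f : Z → Z'}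
    (hf : ∀ (g : G) (z : Z), f (g • z) = g • f z) (hc : Continuous f) :
    Continuous (homotopyQuotientMap f hf) :=
  (groupBarHom f hf).continuous_realise fun p => continuous_groupBarMap hc p

theorem homotopyQuotientMap_eq_self {G : Type u} [TopologicalSpace G] [Group G] {Z : Type u}
    [TopologicalSpace Z] [MulAction G Z] (f : Z → Z) (hf : ∀ (g : G) (z : Z), f (g • z) = g • f z)
    (h : ∀ z, f z = z) (m : HomotopyQuotient G Z) : homotopyQuotientMap f hf m = m := by
  obtain rfl : f = id := funext h
  have key : ∀ (q : ℕ) (x : (groupMonad G).iter (TopCat.of Z) q), groupBarMap id q x = x := by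
    intro q
    induction q with
    | zero => exact fun _ => rfl
    | succ q ih => exact fun x => congrArg (consEntry (headEntry x)) (ih (tailEntries x))
  obtain ⟨q, t, x⟩ := m
  exact congrArg (fun y => Quot.mk (groupBar G Z).Glue (Sigma.mk q (t, y))) (key q x)

/-! ### Labelled operations and maps of symmetric sequences -/

namespace SymSeq

variable (S : SymSeq.{u}) (X : TopCat.{u})

instance : CompactlyGeneratedSpace (S.Labelled X) :=
  inferInstanceAs
    (UCompactlyGeneratedSpace.{u} (Σ r : ℕ, Kify (S.obj (Fin r) × (Fin r → X))))

instance : CompactlyGeneratedSpace (S.free X) :=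
  inferInstanceAs (CompactlyGeneratedSpace (Quot (S.Rel X)))

variable {S X}

theorem continuous_free_mk {T : Type v} [TopologicalSpace T] [UCompactlyGeneratedSpace.{u} T]
    {r : ℕ} {a : T → S.obj (Fin r)} {x : T → Fin r → X} (ha : Continuous a) (hx : Continuous x) :
    Continuous (fun y => (Quot.mk (S.Rel X) ⟨r, a y, x y⟩ : S.free X)) :=
  continuous_quot_mk.comp (continuous_sigmaMk.comp
    (continuous_kify_iff (X := S.obj (Fin r) × (Fin r → X)).2 (ha.prodMk hx)))

/-- On an open or closed subset of `S.free X × B`, continuity can be tested on families of labelled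
operations that are parametrised by compact Hausdorff spaces. -/
theorem continuousOn_free_prod {Y : Type v} [TopologicalSpace Y] {B : Type u}
    [TopologicalSpace B] [CompactSpace B] [T2Space B] {R : Set (S.free X × B)}
    (hR : IsOpen R ∨ IsClosed R) {f : S.free X × B → Y}
    (h : ∀ (r : ℕ) (T : Type u) [TopologicalSpace T] [CompactSpace T] [T2Space T]
      (a : T → S.obj (Fin r)) (x : T → Fin r → X) (σ : T → B), Continuous a →
      Continuous x → Continuous σ → (∀ y, (Quot.mk (S.Rel X) ⟨r, a y, x y⟩, σ y) ∈ R) →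
      Continuous (fun y => f (Quot.mk (S.Rel X) ⟨r, a y, x y⟩, σ y))) : ContinuousOn f R :=
  continuousOn_quotient_test (X := S.free X) (D := fun r => Kify (S.obj (Fin r) × (Fin r → X)))
    (pr := fun r z => Quot.mk _ ⟨r, z⟩) isQuotientMap_quot_mk hR
    fun r T _ _ _ d σ hd hσ hdR => h r T (fun y => (d y).1) (fun y => (d y).2) σ
      (continuous_fst.comp (continuous_ofKify.comp hd))
      (continuous_snd.comp (continuous_ofKify.comp hd)) hσ hdR

/-- Along a family `z` of points of `S.free X`, continuity of a function of `z` and the parameter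
can be tested on families of labelled operations. -/
theorem continuous_free_test {Y : Type v} [TopologicalSpace Y] {B : Type u}
    [TopologicalSpace B] [CompactSpace B] [T2Space B] {z : B → S.free X} (hz : Continuous z)
    {R : Set (S.free X × B)} (hR : IsOpen R ∨ IsClosed R) (hzR : ∀ b, (z b, b) ∈ R)
    {f : S.free X → B → Y}
    (h : ∀ (r : ℕ) (T : Type u) [TopologicalSpace T] [CompactSpace T] [T2Space T]
      (a : T → S.obj (Fin r)) (x : T → Fin r → X) (σ : T → B), Continuous a →
      Continuous x → Continuous σ → (∀ y, (Quot.mk (S.Rel X) ⟨r, a y, x y⟩, σ y) ∈ R) →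
      Continuous (fun y => f (Quot.mk (S.Rel X) ⟨r, a y, x y⟩) (σ y))) :
    Continuous (fun b => f (z b) b) :=
  (continuousOn_free_prod (f := fun z => f z.1 z.2) hR h).comp_continuous
    (f := fun b => (z b, b)) (hz.prodMk continuous_id) hzR

/-- Maps of symmetric sequences. -/
structure Hom (S S' : SymSeq.{u}) where
  app : ∀ {J : Type}, S.obj J → S'.obj J
  reindex : ∀ {J K : Type} (e : J ≃ K) (s : S.obj K), app (S.reindex e s) = S'.reindex e (app s)

variable {S' : SymSeq.{u}}

/-- The map of labelled operations induced by a map of symmetric sequences. -/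
def Hom.free (f : S.Hom S') (X : TopCat.{u}) : S.free X → S'.free X :=
  Quot.map (fun z => ⟨z.1, f.app z.2.1, z.2.2⟩) (by
    rintro ⟨r, s, x⟩ ⟨r', b⟩ ⟨e, h⟩
    change Fin r' ≃ Fin r at e
    obtain rfl : b = (S.reindex e s, x ∘ e) := h
    exact ⟨e, Prod.ext (f.reindex e s) rfl⟩)

/-- The transformation of right functors induced by an equivariant map of symmetric sequences. -/
def Hom.rightFunctor {O : OperadData.{u}} (f : S.Hom S') (m : S.RightAction O.toSymSeq)
    (m' : S'.RightAction O.toSymSeq)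
    (h : ∀ {J : Type} {K : J → Type} (s : S.obj J) (o : ∀ j, O.obj (K j)),
      f.app (m.comp s o) = m'.comp (f.app s) o) :
    (OperadData.rightFunctor S m).Hom (OperadData.rightFunctor S' m') where
  app := f.free
  map g := by
    rintro ⟨z⟩
    rfl
  act X := by
    rintro ⟨r, s, x⟩
    refine congrArg (fun y => Quot.mk (S'.Rel X) (Sigma.mk _ (Prod.mk y _))) ?_
    exact (f.reindex _ _).trans (congrArg _ (h s _))

end SymSeq

theorem OperadData.compactlyGenerated_bar {O : OperadData.{u}} (S : SymSeq.{u})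
    (m : S.RightAction O.toSymSeq) {A : TopCat.{u}} (a : O.monad.obj A → A) (p : ℕ) :
    CompactlyGeneratedSpace ((MonadData.bar (OperadData.rightFunctor S m) a).obj p) :=
  inferInstanceAs (CompactlyGeneratedSpace (S.free _))

section Moduli

variable {d : ℕ} {θ : TangentialStructure.{u} d} (ℓ₀ : StdFraming θ)
  {H : Type w} [TopologicalSpace H] {I : ModelWithCorners ℝ (Euc d) H}
  {W : Type u} [TopologicalSpace W] [ChartedSpace H W] [IsManifold I ∞ W]
  (ℓW : Fr θ I W) (C : Collar I W)

/-! ### Continuity of the actions of the diffeomorphism group -/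

theorem contAction_kify_frOrbit : ContAction (DiffBd C) (Kify (FrOrbit ℓW C)) :=
  fun _ _ _ _ _ _ hg hz => continuous_kify_iff.2
    (FrOrbit.continuous_smul hg (continuous_ofKify.comp hz))

theorem VarEmb.continuous_smul {J : Type} {T : Type*} [TopologicalSpace T] {φ : T → DiffBd C}
    {a : T → VarEmb ℓ₀ ℓW C J} (hφ : Continuous φ) (ha : Continuous a) :
    Continuous (fun x => φ x • a x) := by
  have h := continuous_subtype_val.comp ha
  refine Continuous.subtype_mk (Continuous.prodMk (Continuous.prodMk ?_ ?_) ?_) _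
  · exact continuous_pi fun j => DiscEmb.continuous_postcomp hφ
      ((continuous_apply j).comp (continuous_fst.comp (continuous_fst.comp h)))
  · exact continuous_snd.comp (continuous_fst.comp h)
  · exact FrOrbit.continuous_smul hφ (continuous_snd.comp h)

theorem contAction_free (X : TopCat.{u}) :
    ContAction (DiffBd C) ((varEmbSeq ℓ₀ ℓW C).free X) := by
  intro S _ _ _ g z hg hz
  refine SymSeq.continuous_free_test (f := fun z s => g s • z) hz (Or.inl isOpen_univ)
    (fun _ => mem_univ _) fun r T _ _ _ a x σ ha hx hσ _ => ?_
  exact SymSeq.continuous_free_mk (S := varEmbSeq ℓ₀ ℓW C)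
    (VarEmb.continuous_smul ℓ₀ ℓW C (hg.comp hσ) ha) hx

theorem continuous_forgetDiscs (X : TopCat.{u}) : Continuous (forgetDiscs ℓ₀ ℓW C X) := by
  refine continuous_quot_lift _ (continuous_sigma fun r => ?_)
  refine continuous_kify_iff.2 ?_
  have h : Continuous (fun a : VarEmb ℓ₀ ℓW C (Fin r) => a.1.2) :=
    continuous_snd.comp continuous_subtype_val
  have hfst : Continuous (fun z : Kify ((varEmbSeq ℓ₀ ℓW C).obj (Fin r) × (Fin r → X)) =>
      (ofKify z).1) := continuous_fst.comp continuous_ofKify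
  exact h.comp hfst

/-! ### Transport along paths of framings -/

variable {ℓ₀ ℓW C}

/-- Extend a Moore path of framings of a disc that ends at `ℓ ∘ Tα` by a path of framings of
`W` that starts at `ℓ`. -/
def extendPath (η : C(ℝ≥0, FrOrbit ℓW C)) (s : ℝ≥0) (f : DiscEmb I W) (t : ℝ≥0)
    (γ : C(ℝ≥0, FrDisc θ)) (h : γ t = Fr.pull (η 0).1.1 f) : C(ℝ≥0, FrDisc θ) where
  toFun r := if r ≤ t then γ r else Fr.pull (η (min (r - t) s)).1.1 f
  continuous_toFun := by
    refine Continuous.if_le γ.continuous (Fr.continuous_pull ?_ continuous_const) continuous_id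
      continuous_const ?_
    · exact FrOrbit.continuous_val.comp (η.continuous.comp
        ((continuous_id.sub continuous_const).min continuous_const))
    · rintro r rfl
      simpa using h

/-- Transport of framed embeddings along paths of framings. -/
def RawEmb.transport {J : Type} (η : C(ℝ≥0, FrOrbit ℓW C)) (s : ℝ≥0) (a : RawEmb θ I W J)
    (h : ∀ j, a.2.2 j (a.2.1 j) = Fr.pull (η 0).1.1 (a.1 j)) : RawEmb θ I W J :=
  (a.1, fun j => a.2.1 j + s, fun j => extendPath η s (a.1 j) (a.2.1 j) (a.2.2 j) (h j))

theorem IsFramedEmb.end_eq {J : Type} {ℓ : FrOrbit ℓW C} {η : C(ℝ≥0, FrOrbit ℓW C)}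
    {a : RawEmb θ I W J} (ha : IsFramedEmb ℓ₀ ℓ.1.1 a) (h : ℓ = η 0) (j : J) :
    a.2.2 j (a.2.1 j) = Fr.pull (η 0).1.1 (a.1 j) := by
  rw [ha.finish j _ le_rfl, h]

theorem IsFramedEmb.transport {J : Type} {η : C(ℝ≥0, FrOrbit ℓW C)} {s : ℝ≥0}
    {a : RawEmb θ I W J} (ha : IsFramedEmb ℓ₀ (η 0).1.1 a) :
    IsFramedEmb ℓ₀ (η s).1.1 (a.transport η s (ha.end_eq rfl)) where
  injective := ha.injective
  start j := (if_pos zero_le).trans (ha.start j)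
  finish j r hr := by
    change a.2.1 j + s ≤ r at hr
    change (if r ≤ a.2.1 j then _ else Fr.pull (η (min (r - a.2.1 j) s)).1.1 (a.1 j)) =
      Fr.pull (η s).1.1 (a.1 j)
    split_ifs with hr'
    -- Past the total length but not past the original length: this forces the appended path to have
    -- length zero.
    · have hs : s = 0 := by
        have := hr.trans hr'
        simpa using this
      rw [ha.finish j r (le_self_add.trans hr), hs]
    · rw [min_eq_right (le_tsub_of_add_le_left hr)]

open Classical in
/-- Transport of framed embeddings along paths of framings that start at the given framing. -/
def transportEmb (η : C(ℝ≥0, FrOrbit ℓW C)) (s : ℝ≥0) {J : Type} (a : VarEmb ℓ₀ ℓW C J) :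
    VarEmb ℓ₀ ℓW C J :=
  if h : a.1.2 = η 0 then
    ⟨(a.1.1.transport η s (a.2.end_eq h), η s),
      IsFramedEmb.transport (a := a.1.1) (h ▸ a.2)⟩
  else a

theorem transportEmb_of_eq {η : C(ℝ≥0, FrOrbit ℓW C)} (s : ℝ≥0) {J : Type} {a : VarEmb ℓ₀ ℓW C J}
    (h : a.1.2 = η 0) : (transportEmb η s a).1 = (a.1.1.transport η s (a.2.end_eq h), η s) := by
  rw [transportEmb, dif_pos h]

theorem transportEmb_of_ne {η : C(ℝ≥0, FrOrbit ℓW C)} (s : ℝ≥0) {J : Type} {a : VarEmb ℓ₀ ℓW C J}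
    (h : a.1.2 ≠ η 0) : transportEmb η s a = a := dif_neg h

theorem RawEmb.ext {J : Type} {a b : RawEmb θ I W J} (h₁ : ∀ j, a.1 j = b.1 j)
    (h₂ : ∀ j, a.2.1 j = b.2.1 j) (h₃ : ∀ j r, a.2.2 j r = b.2.2 j r) : a = b :=
  Prod.ext (funext h₁) (Prod.ext (funext h₂) (funext fun j => ContinuousMap.ext (h₃ j)))

/-- Appending a path of length zero changes nothing, because a Moore path is constant beyond its
length. -/
theorem transportEmb_zero (η : C(ℝ≥0, FrOrbit ℓW C)) {J : Type} (a : VarEmb ℓ₀ ℓW C J) :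
    transportEmb η 0 a = a := by
  by_cases h : a.1.2 = η 0
  · refine Subtype.ext ((transportEmb_of_eq 0 h).trans (Prod.ext ?_ h.symm))
    refine RawEmb.ext (fun j => rfl) (fun j => add_zero _) fun j r => ?_
    change (if r ≤ a.1.1.2.1 j then _ else
      Fr.pull (η (min (r - a.1.1.2.1 j) 0)).1.1 (a.1.1.1 j)) = a.1.1.2.2 j r
    split_ifs with hr
    · rfl
    · rw [min_eq_right zero_le, a.2.finish j r (not_le.1 hr).le, h]
  · exact transportEmb_of_ne 0 h

/-- Composition prepends the path of the inner disc and transport appends a path. For Moore paths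
the two orders give the same threefold concatenation on the nose, which makes transport a strict map
of right functors. -/
theorem transportEmb_comp (η : C(ℝ≥0, FrOrbit ℓW C)) (s : ℝ≥0) {J : Type} {K : J → Type}
    (a : VarEmb ℓ₀ ℓW C J) (b : ∀ j, DiscOp ℓ₀ (K j)) :
    transportEmb η s ((varEmbAction ℓ₀ ℓW C).comp a b) =
      (varEmbAction ℓ₀ ℓW C).comp (transportEmb η s a) b := by
  by_cases h : a.1.2 = η 0
  · have ha : transportEmb η s a = ⟨(a.1.1.transport η s (a.2.end_eq h), η s),
        IsFramedEmb.transport (a := a.1.1) (h ▸ a.2)⟩ := Subtype.ext (transportEmb_of_eq s h)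
    rw [ha]
    have h' : ((varEmbAction ℓ₀ ℓW C).comp a b).1.2 = η 0 := h
    refine Subtype.ext ((transportEmb_of_eq s h').trans (Prod.ext ?_ rfl))
    refine RawEmb.ext (fun p => rfl) (fun p => add_assoc _ _ _) fun p r => ?_
    obtain ⟨j, k⟩ := p
    set t := a.1.1.2.1 j with ht
    set t' := (b j).1.2.1 k with ht'
    change (if r ≤ t' + t then (if r ≤ t' then _ else FrDisc.pull (a.1.1.2.2 j (r - t')) _) else
        Fr.pull (η (min (r - (t' + t)) s)).1.1 ((a.1.1.1 j).comp ((b j).emb k))) =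
      if r ≤ t' then _ else FrDisc.pull (if r - t' ≤ t then a.1.1.2.2 j (r - t') else
        Fr.pull (η (min (r - t' - t) s)).1.1 (a.1.1.1 j)) ((b j).emb k)
    by_cases h₁ : r ≤ t'
    · rw [if_pos h₁, if_pos h₁, if_pos (h₁.trans le_self_add)]
    · rw [if_neg h₁, if_neg h₁]
      have h₂ : r ≤ t' + t ↔ r - t' ≤ t := tsub_le_iff_left.symm
      by_cases h₃ : r ≤ t' + t
      · rw [if_pos h₃, if_pos (h₂.1 h₃)]
      · rw [if_neg h₃, if_neg (fun h₄ => h₃ (h₂.2 h₄)), Fr.pull_comp, tsub_tsub]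
  · have hne : ((varEmbAction ℓ₀ ℓW C).comp a b).1.2 ≠ η 0 := h
    rw [transportEmb_of_ne s h]
    exact transportEmb_of_ne s hne

/-- Transport, as a map of symmetric sequences. -/
def transportSeq (η : C(ℝ≥0, FrOrbit ℓW C)) (s : ℝ≥0) :
    (varEmbSeq ℓ₀ ℓW C).Hom (varEmbSeq ℓ₀ ℓW C) where
  app a := transportEmb η s a
  reindex e a := by
    by_cases h : a.1.2 = η 0
    · have h' : ((varEmbSeq ℓ₀ ℓW C).reindex e a).1.2 = η 0 := h
      have ha : transportEmb η s a = ⟨(a.1.1.transport η s (a.2.end_eq h), η s),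
        IsFramedEmb.transport (a := a.1.1) (h ▸ a.2)⟩ := Subtype.ext (transportEmb_of_eq s h)
      rw [ha]
      exact Subtype.ext (transportEmb_of_eq s h')
    · have hne : ((varEmbSeq ℓ₀ ℓW C).reindex e a).1.2 ≠ η 0 := h
      rw [transportEmb_of_ne s h]
      exact transportEmb_of_ne s hne

theorem continuous_transportEmb {T : Type*} [TopologicalSpace T] {J : Type}
    {η : T → C(ℝ≥0, FrOrbit ℓW C)} {s : T → ℝ≥0} {a : T → VarEmb ℓ₀ ℓW C J} (hη : Continuous η)
    (hs : Continuous s) (ha : Continuous a) (h : ∀ x, (a x).1.2 = η x 0) :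
    Continuous (fun x => transportEmb (η x) (s x) (a x)) := by
  have h₀ := continuous_subtype_val.comp ha
  have h₁ : Continuous (fun x => (a x).1.1) := continuous_fst.comp h₀
  have hα : ∀ j, Continuous (fun x => (a x).1.1.1 j) :=
    fun j => (continuous_apply j).comp (continuous_fst.comp h₁)
  have ht : ∀ j, Continuous (fun x => (a x).1.1.2.1 j) :=
    fun j => (continuous_apply j).comp (continuous_fst.comp (continuous_snd.comp h₁))
  have hγ : ∀ j, Continuous (fun x => (a x).1.1.2.2 j) :=
    fun j => (continuous_apply j).comp (continuous_snd.comp (continuous_snd.comp h₁))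
  refine continuous_induced_rng.2 ?_
  have e : (Subtype.val ∘ fun x => transportEmb (η x) (s x) (a x)) = fun x =>
      ((a x).1.1.transport (η x) (s x) ((a x).2.end_eq (h x)), η x (s x)) :=
    funext fun x => transportEmb_of_eq _ (h x)
  rw [e]
  refine Continuous.prodMk (Continuous.prodMk (continuous_fst.comp h₁) (Continuous.prodMk
    (continuous_pi fun j => (ht j).add hs) (continuous_pi fun j => ?_))) (by fun_prop)
  refine ContinuousMap.continuous_of_continuous_uncurry _ ?_
  have hev : Continuous (fun z : T × ℝ≥0 => (a z.1).1.1.2.2 j z.2) :=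
    ContinuousEval.continuous_eval.comp (((hγ j).comp continuous_fst).prodMk continuous_snd)
  refine Continuous.if_le hev (Fr.continuous_pull (FrOrbit.continuous_val.comp ?_)
    ((hα j).comp continuous_fst)) continuous_snd ((ht j).comp continuous_fst) ?_
  · have hm : Continuous (fun z : T × ℝ≥0 => min (z.2 - (a z.1).1.1.2.1 j) (s z.1)) :=
      (continuous_snd.sub ((ht j).comp continuous_fst)).min (hs.comp continuous_fst)
    exact ContinuousEval.continuous_eval.comp ((hη.comp continuous_fst).prodMk hm)
  · rintro ⟨x, r⟩ hr
    change r = (a x).1.1.2.1 j at hr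
    subst hr
    have := (a x).2.end_eq (h x) j
    simpa using this

/-! ### Framed embeddings with a fixed framing -/

variable (ℓ₀ ℓW C)

/-- The inclusion of framed embeddings with fixed framing. -/
def fixedSeq : (framedEmbSeq ℓ₀ ℓW).Hom (varEmbSeq ℓ₀ ℓW C) where
  app a := ⟨(a.1, FrOrbit.base ℓW C), a.2⟩
  reindex _ _ := rfl

/-- The operation without inputs. -/
def noDiscs (ℓ : Fr θ I W) : FramedEmb ℓ₀ ℓ (Fin 0) :=
  ⟨(Fin.elim0, Fin.elim0, Fin.elim0),
    { injective := fun p => p.1.elim0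
      start := fun j => j.elim0
      finish := fun j => j.elim0 }⟩

/-- There is only one operation without inputs. It is therefore preserved by relabelling and by the
operad action, which makes it a consistent default value for embeddings with the wrong framing. -/
theorem framedEmb_rel_of_isEmpty {ℓ : Fr θ I W} {X : TopCat.{u}}
    {a b : (framedEmbSeq ℓ₀ ℓ).Labelled X} (ha : a.1 = 0) (hb : b.1 = 0) :
    (framedEmbSeq ℓ₀ ℓ).Rel X a b := by
  obtain ⟨r, s, x⟩ := a
  obtain ⟨r', s', x'⟩ := b
  obtain rfl : r = 0 := ha
  obtain rfl : r' = 0 := hb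
  refine ⟨Equiv.refl _, Prod.ext (Subtype.ext ?_) (funext fun j => j.elim0)⟩
  exact RawEmb.ext (fun j => j.elim0) (fun j => j.elim0) (fun j => j.elim0)

open Classical in
/-- A labelled framed embedding whose framing is `ℓW`; all discs are removed from those with
another framing. -/
def fixLabelled {X : TopCat.{u}} {r : ℕ} (s : VarEmb ℓ₀ ℓW C (Fin r)) (x : Fin r → X) :
    (framedEmbSeq ℓ₀ ℓW).free X :=
  if h : s.1.2 = FrOrbit.base ℓW C then
    Quot.mk _ ⟨r, (⟨s.1.1, (congrArg (fun ℓ : FrOrbit ℓW C =>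
      IsFramedEmb ℓ₀ ℓ.1.1 s.1.1) h).mp s.2⟩ : FramedEmb ℓ₀ ℓW (Fin r)), x⟩
  else Quot.mk _ ⟨0, noDiscs ℓ₀ ℓW, Fin.elim0⟩

variable {ℓ₀ ℓW C}

theorem fixLabelled_of_eq {X : TopCat.{u}} {r : ℕ} {s : VarEmb ℓ₀ ℓW C (Fin r)}
    (h : s.1.2 = FrOrbit.base ℓW C) (hs : IsFramedEmb ℓ₀ ℓW s.1.1) (x : Fin r → X) :
    fixLabelled ℓ₀ ℓW C s x = Quot.mk _ ⟨r, (⟨s.1.1, hs⟩ : FramedEmb ℓ₀ ℓW (Fin r)), x⟩ :=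
  dif_pos h

theorem fixLabelled_of_ne {X : TopCat.{u}} {r : ℕ} {s : VarEmb ℓ₀ ℓW C (Fin r)}
    (h : s.1.2 ≠ FrOrbit.base ℓW C) (x : Fin r → X) :
    fixLabelled ℓ₀ ℓW C s x = Quot.mk _ ⟨0, noDiscs ℓ₀ ℓW, Fin.elim0⟩ :=
  dif_neg h

theorem VarEmb.isFramedEmb_of_eq {J : Type} {s : VarEmb ℓ₀ ℓW C J}
    (h : s.1.2 = FrOrbit.base ℓW C) : IsFramedEmb ℓ₀ ℓW s.1.1 :=
  (congrArg (fun ℓ : FrOrbit ℓW C => IsFramedEmb ℓ₀ ℓ.1.1 s.1.1) h).mp s.2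

variable (ℓ₀ ℓW C)

/-- Retain those labelled framed embeddings whose framing is `ℓW`. -/
def fixFraming (X : TopCat.{u}) : (varEmbSeq ℓ₀ ℓW C).free X → (framedEmbSeq ℓ₀ ℓW).free X :=
  Quot.lift (fun z => fixLabelled ℓ₀ ℓW C z.2.1 z.2.2) (by
    rintro ⟨r, s, x⟩ ⟨r', b⟩ ⟨e, h⟩
    change Fin r' ≃ Fin r at e
    obtain rfl : b = ((varEmbSeq ℓ₀ ℓW C).reindex e s, x ∘ e) := h
    change VarEmb ℓ₀ ℓW C (Fin r) at s
    by_cases h : s.1.2 = FrOrbit.base ℓW C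
    · refine (fixLabelled_of_eq h (VarEmb.isFramedEmb_of_eq h) x).trans (Eq.trans ?_
        (fixLabelled_of_eq (s := (varEmbSeq ℓ₀ ℓW C).reindex e s) h
          ((VarEmb.isFramedEmb_of_eq h).reindex e) (x ∘ e)).symm)
      exact Quot.sound ⟨e, rfl⟩
    · exact (fixLabelled_of_ne h x).trans
        (fixLabelled_of_ne (s := (varEmbSeq ℓ₀ ℓW C).reindex e s) h (x ∘ e)).symm)

/-- The right functor of labelled framed embeddings with varying framing. -/
abbrev varFunctor : RightFunctorData (discOperad ℓ₀).monad :=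
  OperadData.rightFunctor (varEmbSeq ℓ₀ ℓW C) (varEmbAction ℓ₀ ℓW C)

/-- The transformation given by `fixFraming`. -/
def fixHom : (varFunctor ℓ₀ ℓW C).Hom (embFunctor ℓ₀ ℓW) where
  app := fixFraming ℓ₀ ℓW C
  map f := by
    rintro ⟨r, s, x⟩
    change VarEmb ℓ₀ ℓW C (Fin r) at s
    by_cases h : s.1.2 = FrOrbit.base ℓW C
    · refine (fixLabelled_of_eq h (VarEmb.isFramedEmb_of_eq h) (f ∘ x)).trans ?_
      exact (congrArg ((framedEmbSeq ℓ₀ ℓW).freeMap f)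
        (fixLabelled_of_eq h (VarEmb.isFramedEmb_of_eq h) x)).symm
    · refine (fixLabelled_of_ne h (f ∘ x)).trans ?_
      refine Eq.trans ?_ (congrArg ((framedEmbSeq ℓ₀ ℓW).freeMap f) (fixLabelled_of_ne h x)).symm
      exact Quot.sound (framedEmb_rel_of_isEmpty ℓ₀ rfl rfl)
  act X := by
    rintro ⟨r, s, x⟩
    change VarEmb ℓ₀ ℓW C (Fin r) at s
    by_cases h : s.1.2 = FrOrbit.base ℓW C
    · refine Eq.trans ?_ (congrArg ((framedEmbAction ℓ₀ ℓW).act X)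
        (fixLabelled_of_eq h (VarEmb.isFramedEmb_of_eq h) x)).symm
      refine fixLabelled_of_eq (s := (varEmbSeq ℓ₀ ℓW C).reindex finSigmaFinEquiv.symm
        ((varEmbAction ℓ₀ ℓW C).comp s fun i => (Quot.out (x i)).2.1)) h
        (((VarEmb.isFramedEmb_of_eq h).comp _).reindex _) _
    · refine Eq.trans ?_ (congrArg ((framedEmbAction ℓ₀ ℓW).act X) (fixLabelled_of_ne h x)).symm
      refine (fixLabelled_of_ne (s := (varEmbSeq ℓ₀ ℓW C).reindex finSigmaFinEquiv.symm
        ((varEmbAction ℓ₀ ℓW C).comp s fun i => (Quot.out (x i)).2.1)) h _).trans ?_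
      exact Quot.sound (framedEmb_rel_of_isEmpty ℓ₀ rfl rfl)

/-- The transformation given by the inclusion of framed embeddings with fixed framing. -/
def fixedHom : (embFunctor ℓ₀ ℓW).Hom (varFunctor ℓ₀ ℓW C) :=
  (fixedSeq ℓ₀ ℓW C).rightFunctor (framedEmbAction ℓ₀ ℓW) (varEmbAction ℓ₀ ℓW C) fun _ _ => rfl

variable {ℓW C} in
/-- The transformation given by transport. -/
def transportHom (η : C(ℝ≥0, FrOrbit ℓW C)) (s : ℝ≥0) :
    (varFunctor ℓ₀ ℓW C).Hom (varFunctor ℓ₀ ℓW C) :=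
  (transportSeq η s).rightFunctor (varEmbAction ℓ₀ ℓW C) (varEmbAction ℓ₀ ℓW C)
    (transportEmb_comp η s)

/-- The local trivialisation of the homotopy quotient, as a transformation. -/
def untwistHom (N : UnitNDR (DiffBd C)) (n : ℕ) :
    (moduliFunctor ℓ₀ ℓW C).Hom (varFunctor ℓ₀ ℓW C) where
  app X := N.untwist n (Z := (varEmbSeq ℓ₀ ℓW C).free X)
  map {X Y} _ z := UnitNDR.untwist_map (Z := (varEmbSeq ℓ₀ ℓW C).free X)
    (Z' := (varEmbSeq ℓ₀ ℓW C).free Y) _ _ z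
  act X z := UnitNDR.untwist_map (Z := (varEmbSeq ℓ₀ ℓW C).free ((discOperad ℓ₀).monad.obj X))
    (Z' := (varEmbSeq ℓ₀ ℓW C).free X) _ _ z

variable {ℓW C} in
/-- The inclusion of a fibre into the homotopy quotient, as a transformation. -/
def twistHom (N : UnitNDR (DiffBd C)) (n : ℕ) (m : ModuliSpace ℓW C) :
    (varFunctor ℓ₀ ℓW C).Hom (moduliFunctor ℓ₀ ℓW C) where
  app X := N.twist n (Z := Kify (FrOrbit ℓW C)) (Z' := (varEmbSeq ℓ₀ ℓW C).free X) m
  map {X Y} _ z := (UnitNDR.twist_map (Z' := (varEmbSeq ℓ₀ ℓW C).free X)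
    (Z'' := (varEmbSeq ℓ₀ ℓW C).free Y) _ _ m z).symm
  act X z := (UnitNDR.twist_map
    (Z' := (varEmbSeq ℓ₀ ℓW C).free ((discOperad ℓ₀).monad.obj X))
    (Z'' := (varEmbSeq ℓ₀ ℓW C).free X) _ _ m z).symm

end Moduli

section Comparison

variable {d : ℕ} {θ : TangentialStructure.{u} d} (ℓ₀ : StdFraming θ)
  {H : Type w} [TopologicalSpace H] {I : ModelWithCorners ℝ (Euc d) H}
  {W : Type u} [TopologicalSpace W] [ChartedSpace H W] [IsManifold I ∞ W]
  (ℓW : Fr θ I W) (C : Collar I W) {A : Type u} [TopologicalSpace A]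
  (α : (discOperad ℓ₀).Algebra A)

/-! ### Factorisation homology with varying framing -/

/-- The bar construction of decorated framed embeddings with varying framing. -/
abbrev varBar : SimplicialSpace.{u} := MonadData.bar (varFunctor ℓ₀ ℓW C) α.structureMap

/-- The bar construction of decorated framed embeddings with fixed framing. -/
abbrev embBar : SimplicialSpace.{u} := MonadData.bar (embFunctor ℓ₀ ℓW) α.structureMap

/-- The bar construction underlying the decorated moduli space. -/
abbrev moduliBar : SimplicialSpace.{u} := MonadData.bar (moduliFunctor ℓ₀ ℓW C) α.structureMap

instance (p : ℕ) : CompactlyGeneratedSpace ((varBar ℓ₀ ℓW C α).obj p) :=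
  OperadData.compactlyGenerated_bar _ _ _ p

instance (p : ℕ) : CompactlyGeneratedSpace ((moduliBar ℓ₀ ℓW C α).obj p) :=
  have := fun q => compactlyGenerated_groupBar (G := DiffBd C)
    (Z := (varEmbSeq ℓ₀ ℓW C).free ((discOperad ℓ₀).monad.iter (TopCat.of A) p)) q
  (groupBar (DiffBd C) _).compactlyGenerated_realisation

theorem forgetDiscs_map {X Y : TopCat.{u}} (f : X → Y) (z : (varFunctor ℓ₀ ℓW C).obj X) :
    forgetDiscs ℓ₀ ℓW C Y ((varFunctor ℓ₀ ℓW C).map f z) = forgetDiscs ℓ₀ ℓW C X z := by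
  obtain ⟨z⟩ := z
  rfl

theorem forgetDiscs_act (X : TopCat.{u})
    (z : (varFunctor ℓ₀ ℓW C).obj ((discOperad ℓ₀).monad.obj X)) :
    forgetDiscs ℓ₀ ℓW C X ((varFunctor ℓ₀ ℓW C).act X z) = forgetDiscs ℓ₀ ℓW C _ z := by
  obtain ⟨z⟩ := z
  rfl

/-- The underlying framing. -/
def varFraming : (varBar ℓ₀ ℓW C α).realisation → Kify (FrOrbit ℓW C) :=
  (varBar ℓ₀ ℓW C α).augment (fun _ => forgetDiscs ℓ₀ ℓW C _)
    (fun p i x => by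
      refine Fin.cases ?_ (fun j => ?_) i
      · exact forgetDiscs_act ℓ₀ ℓW C _ x
      · exact forgetDiscs_map ℓ₀ ℓW C _ x)
    (fun p i x => forgetDiscs_map ℓ₀ ℓW C _ x)

theorem continuous_varFraming : Continuous (varFraming ℓ₀ ℓW C α) :=
  SimplicialSpace.continuous_augment _ _ _ _ fun _ => continuous_forgetDiscs ℓ₀ ℓW C _

theorem continuous_moduliProjection : Continuous (moduliProjection ℓ₀ ℓW C α) :=
  SimplicialSpace.continuous_augment _ _ _ _ fun _ =>
    continuous_homotopyQuotientMap _ (continuous_forgetDiscs ℓ₀ ℓW C _)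

theorem continuous_fixedFree (X : TopCat.{u}) : Continuous ((fixedSeq ℓ₀ ℓW C).free X) := by
  refine continuous_quot_lift _ (continuous_sigma fun r => ?_)
  have h : Continuous (fun a : FramedEmb ℓ₀ ℓW (Fin r) => (fixedSeq ℓ₀ ℓW C).app a) :=
    (continuous_subtype_val.prodMk continuous_const).subtype_mk _
  refine SymSeq.continuous_free_mk (S := varEmbSeq ℓ₀ ℓW C)
    (T := Kify ((framedEmbSeq ℓ₀ ℓW).obj (Fin r) × (Fin r → X)))
    (a := fun z => (fixedSeq ℓ₀ ℓW C).app (ofKify z).1) (x := fun z => (ofKify z).2)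
    (h.comp ?_) ?_
  · exact continuous_fst.comp continuous_ofKify
  · exact continuous_snd.comp continuous_ofKify

theorem continuous_fibreInclusion : Continuous (fibreInclusion ℓ₀ ℓW C α) :=
  SimplicialSpace.Hom.continuous_realise _ fun _ =>
    (SimplicialSpace.continuous_vertex _).comp (continuous_fixedFree ℓ₀ ℓW C _)

/-! ### Restriction to the framing `ℓW` -/

/-- The inclusion of factorisation homology with fixed framing. -/
def fixedInclusion : FactorisationHomology ℓ₀ ℓW α → (varBar ℓ₀ ℓW C α).realisation :=
  ((fixedHom ℓ₀ ℓW C).bar α.structureMap).realise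

/-- The retraction that forgets all discs if the framing is not `ℓW`. -/
def fixedRetraction : (varBar ℓ₀ ℓW C α).realisation → FactorisationHomology ℓ₀ ℓW α :=
  ((fixHom ℓ₀ ℓW C).bar α.structureMap).realise

theorem fixFraming_fixed (X : TopCat.{u}) (z : (framedEmbSeq ℓ₀ ℓW).free X) :
    fixFraming ℓ₀ ℓW C X ((fixedSeq ℓ₀ ℓW C).free X z) = z := by
  obtain ⟨r, s, x⟩ := z
  exact fixLabelled_of_eq (s := (fixedSeq ℓ₀ ℓW C).app s) rfl s.2 x

theorem fixed_fixFraming (X : TopCat.{u}) (z : (varEmbSeq ℓ₀ ℓW C).free X)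
    (hz : forgetDiscs ℓ₀ ℓW C X z = FrOrbit.base ℓW C) :
    (fixedSeq ℓ₀ ℓW C).free X (fixFraming ℓ₀ ℓW C X z) = z := by
  obtain ⟨r, s, x⟩ := z
  change VarEmb ℓ₀ ℓW C (Fin r) at s
  have h : s.1.2 = FrOrbit.base ℓW C := hz
  refine (congrArg _ (fixLabelled_of_eq h (VarEmb.isFramedEmb_of_eq h) x)).trans ?_
  refine congrArg (fun s' : VarEmb ℓ₀ ℓW C (Fin r) =>
    Quot.mk ((varEmbSeq ℓ₀ ℓW C).Rel X) (Sigma.mk r (s', x))) ?_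
  exact Subtype.ext (Prod.ext rfl h.symm)

theorem fixedRetraction_fixedInclusion (z : FactorisationHomology ℓ₀ ℓW α) :
    fixedRetraction ℓ₀ ℓW C α (fixedInclusion ℓ₀ ℓW C α z) = z := by
  obtain ⟨p, t, x⟩ := z
  exact congrArg (fun y => Quot.mk (embBar ℓ₀ ℓW α).Glue (Sigma.mk p (t, y)))
    (fixFraming_fixed ℓ₀ ℓW C _ x)

theorem fixedInclusion_fixedRetraction (y : (varBar ℓ₀ ℓW C α).realisation)
    (hy : varFraming ℓ₀ ℓW C α y = FrOrbit.base ℓW C) :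
    fixedInclusion ℓ₀ ℓW C α (fixedRetraction ℓ₀ ℓW C α y) = y := by
  obtain ⟨p, t, x⟩ := y
  exact congrArg (fun y => Quot.mk (varBar ℓ₀ ℓW C α).Glue (Sigma.mk p (t, y)))
    (fixed_fixFraming ℓ₀ ℓW C _ x hy)

/-- Over the closed locus where the framing is `ℓW`, the default branch of `fixLabelled` never
occurs, and the retraction just forgets the framing. -/
theorem continuousOn_fixedRetraction : ContinuousOn (fixedRetraction ℓ₀ ℓW C α)
    {y | varFraming ℓ₀ ℓW C α y = FrOrbit.base ℓW C} := by
  have hcl : IsClosed {ℓ : Kify (FrOrbit ℓW C) | ℓ = FrOrbit.base ℓW C} := isClosed_singleton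
  refine SimplicialSpace.Hom.continuousOn_realise _
    (Or.inr (hcl.preimage (continuous_varFraming ℓ₀ ℓW C α))) fun p S _ _ _ t z ht hz hS => ?_
  refine SymSeq.continuous_free_test (S := varEmbSeq ℓ₀ ℓW C)
    (f := fun z _ => fixFraming ℓ₀ ℓW C _ z) hz
    (R := {y | forgetDiscs ℓ₀ ℓW C _ y.1 = FrOrbit.base ℓW C})
    (Or.inr (hcl.preimage ((continuous_forgetDiscs ℓ₀ ℓW C _).comp continuous_fst))) hS
    fun r T _ _ _ a x σ ha hx hσ hT => ?_
  have h : ∀ y, (a y).1.2 = FrOrbit.base ℓW C := hT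
  have ha' : Continuous (fun y => (⟨(a y).1.1, VarEmb.isFramedEmb_of_eq (h y)⟩ :
      FramedEmb ℓ₀ ℓW (Fin r))) :=
    (continuous_fst.comp (continuous_subtype_val.comp ha)).subtype_mk _
  refine (SymSeq.continuous_free_mk (S := framedEmbSeq ℓ₀ ℓW) ha' hx).congr fun y => ?_
  exact (fixLabelled_of_eq (h y) (VarEmb.isFramedEmb_of_eq (h y)) (x y)).symm

/-! ### Transport -/

variable {ℓW C}

/-- Transport of decorated framed embeddings along a path of framings. -/
def transport (η : C(ℝ≥0, FrOrbit ℓW C)) (s : ℝ≥0) :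
    (varBar ℓ₀ ℓW C α).realisation → (varBar ℓ₀ ℓW C α).realisation :=
  ((transportHom ℓ₀ η s).bar α.structureMap).realise

theorem transport_zero (η : C(ℝ≥0, FrOrbit ℓW C)) (y : (varBar ℓ₀ ℓW C α).realisation) :
    transport ℓ₀ α η 0 y = y := by
  obtain ⟨p, t, x⟩ := y
  refine congrArg (fun y => Quot.mk (varBar ℓ₀ ℓW C α).Glue (Sigma.mk p (t, y))) ?_
  obtain ⟨r, s, x⟩ := x
  exact congrArg (fun s' : VarEmb ℓ₀ ℓW C (Fin r) =>
    Quot.mk ((varEmbSeq ℓ₀ ℓW C).Rel _) (Sigma.mk r (s', x))) (transportEmb_zero η s)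

theorem varFraming_transport (η : C(ℝ≥0, FrOrbit ℓW C)) (s : ℝ≥0)
    (y : (varBar ℓ₀ ℓW C α).realisation) (hy : varFraming ℓ₀ ℓW C α y = η 0) :
    varFraming ℓ₀ ℓW C α (transport ℓ₀ α η s y) = η s := by
  obtain ⟨p, t, ⟨r, a, x⟩⟩ := y
  change VarEmb ℓ₀ ℓW C (Fin r) at a
  exact congrArg Prod.snd (transportEmb_of_eq s (show a.1.2 = η 0 from hy))

/-- Joint continuity in the path, the time and the point, on the closed locus where the path starts
at the framing of the point; elsewhere transport is the identity by convention. -/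
theorem continuousOn_transport {S : Type u} [TopologicalSpace S] [CompactSpace S] [T2Space S]
    {η : S → C(ℝ≥0, FrOrbit ℓW C)} {s : S → ℝ≥0} (hη : Continuous η) (hs : Continuous s) :
    ContinuousOn (fun z : (varBar ℓ₀ ℓW C α).realisation × S => transport ℓ₀ α (η z.2) (s z.2) z.1)
      {z | varFraming ℓ₀ ℓW C α z.1 = η z.2 0} := by
  have h0 : Continuous (fun x => toKify (η x 0)) :=
    continuous_kify_iff.2 (show Continuous (fun x => η x 0) by fun_prop)
  refine SimplicialSpace.continuousOn_realise_family
    (fun x => (transportHom ℓ₀ (η x) (s x)).bar α.structureMap)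
    (Or.inr (isClosed_eq ((continuous_varFraming ℓ₀ ℓW C α).comp continuous_fst)
      (h0.comp continuous_snd))) fun p S' _ _ _ t z σ ht hz hσ hS => ?_
  refine SymSeq.continuous_free_test (S := varEmbSeq ℓ₀ ℓW C)
    (f := fun z y => (transportSeq (η (σ y)) (s (σ y))).free _ z) hz
    (R := {y | forgetDiscs ℓ₀ ℓW C _ y.1 = toKify (η (σ y.2) 0)})
    (Or.inr (isClosed_eq ((continuous_forgetDiscs ℓ₀ ℓW C _).comp continuous_fst)
      (h0.comp (hσ.comp continuous_snd)))) hS fun r T _ _ _ a x σ' ha hx hσ' hT => ?_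
  exact SymSeq.continuous_free_mk (S := varEmbSeq ℓ₀ ℓW C) (continuous_transportEmb
    (hη.comp (hσ.comp hσ')) (hs.comp (hσ.comp hσ')) ha hT) hx

/-! ### Local trivialisations -/

variable (N : UnitNDR (DiffBd C)) (n : ℕ)

variable (ℓW) in
/-- The local trivialisation of the decorated moduli space. -/
def untwistAll : DecoratedModuliSpace ℓ₀ ℓW C α → (varBar ℓ₀ ℓW C α).realisation :=
  ((untwistHom ℓ₀ ℓW C N n).bar α.structureMap).realise

/-- The inclusion of a fibre into the decorated moduli space. -/
def twistAll (m : ModuliSpace ℓW C) :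
    (varBar ℓ₀ ℓW C α).realisation → DecoratedModuliSpace ℓ₀ ℓW C α :=
  ((twistHom ℓ₀ N n m).bar α.structureMap).realise

theorem varFraming_untwistAll (x : DecoratedModuliSpace ℓ₀ ℓW C α) :
    varFraming ℓ₀ ℓW C α (untwistAll ℓ₀ ℓW α N n x) =
      N.untwist n (Z := Kify (FrOrbit ℓW C)) (moduliProjection ℓ₀ ℓW C α x) := by
  obtain ⟨p, t, x⟩ := x
  exact (UnitNDR.untwist_map (Z := (varEmbSeq ℓ₀ ℓW C).free _) _ _ x).symm

theorem moduliProjection_twistAll (m : ModuliSpace ℓW C) (y : (varBar ℓ₀ ℓW C α).realisation) :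
    moduliProjection ℓ₀ ℓW C α (twistAll ℓ₀ α N n m y) =
      N.twist n (Z := Kify (FrOrbit ℓW C)) m (varFraming ℓ₀ ℓW C α y) := by
  obtain ⟨p, t, y⟩ := y
  exact UnitNDR.twist_map (Z' := (varEmbSeq ℓ₀ ℓW C).free _) _ _ m y

/-- A point of the decorated moduli space is recovered from its base point and its untwisted
decorated embedding. Together with the two formulas for the framing and the projection, this is the
trivialisation used for lifting. -/
theorem twistAll_untwistAll (x : DecoratedModuliSpace ℓ₀ ℓW C α) :
    twistAll ℓ₀ α N n (moduliProjection ℓ₀ ℓW C α x) (untwistAll ℓ₀ ℓW α N n x) = x := by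
  obtain ⟨p, t, x⟩ := x
  refine congrArg (fun y => Quot.mk (moduliBar ℓ₀ ℓW C α).Glue (Sigma.mk p (t, y))) ?_
  exact (UnitNDR.twist_homotopyQuotientMap (Z := (varEmbSeq ℓ₀ ℓW C).free _)
    (Z' := (varEmbSeq ℓ₀ ℓW C).free _) _ _ x _).trans (UnitNDR.twist_untwist x)

theorem twistAll_base (z : FactorisationHomology ℓ₀ ℓW α) :
    twistAll ℓ₀ α N 0 (ModuliSpace.base ℓW C) (fixedInclusion ℓ₀ ℓW C α z) =
      fibreInclusion ℓ₀ ℓW C α z := by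
  obtain ⟨p, t, x⟩ := z
  refine congrArg (fun y => Quot.mk (moduliBar ℓ₀ ℓW C α).Glue (Sigma.mk p (t, y))) ?_
  exact UnitNDR.twist_vertex (Z := Kify (FrOrbit ℓW C)) (Z' := (varEmbSeq ℓ₀ ℓW C).free _) _ _

theorem untwistAll_fibreInclusion (z : FactorisationHomology ℓ₀ ℓW α) :
    untwistAll ℓ₀ ℓW α N 0 (fibreInclusion ℓ₀ ℓW C α z) = fixedInclusion ℓ₀ ℓW C α z := by
  obtain ⟨p, t, x⟩ := z
  refine congrArg (fun y => Quot.mk (varBar ℓ₀ ℓW C α).Glue (Sigma.mk p (t, y))) ?_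
  exact UnitNDR.untwist_vertex (Z := (varEmbSeq ℓ₀ ℓW C).free _) _

theorem moduliProjection_fibreInclusion (z : FactorisationHomology ℓ₀ ℓW α) :
    moduliProjection ℓ₀ ℓW C α (fibreInclusion ℓ₀ ℓW C α z) = ModuliSpace.base ℓW C := by
  obtain ⟨p, t, ⟨x⟩⟩ := z
  rfl

variable (ℓW C) in
/-- The open subset of the moduli space over which the `n`-th local trivialisation is defined. -/
def moduliChart : Set (ModuliSpace ℓW C) := {m | N.chart n (Kify (FrOrbit ℓW C)) m}

theorem isOpen_moduliChart : IsOpen (moduliChart ℓW C N n) :=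
  UnitNDR.isOpen_chart

theorem continuousOn_untwistAll : ContinuousOn (untwistAll ℓ₀ ℓW α N n)
    (moduliProjection ℓ₀ ℓW C α ⁻¹' moduliChart ℓW C N n) := by
  refine SimplicialSpace.Hom.continuousOn_realise _ (Or.inl ((isOpen_moduliChart N n).preimage
    (continuous_moduliProjection ℓ₀ ℓW C α))) fun p S _ _ _ t z ht hz hS => ?_
  refine (UnitNDR.continuousOn_untwist (Z := (varEmbSeq ℓ₀ ℓW C).free _)
    (contAction_free ℓ₀ ℓW C _)).comp_continuous hz fun y => ?_
  exact (UnitNDR.chart_map (Z := (varEmbSeq ℓ₀ ℓW C).free _) _ _ _).1 (hS y)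

theorem continuous_twistAll {S : Type u} [TopologicalSpace S] [CompactSpace S] [T2Space S]
    {m : S → ModuliSpace ℓW C} {y : S → (varBar ℓ₀ ℓW C α).realisation} (hm : Continuous m)
    (hy : Continuous y) (h : ∀ s, m s ∈ moduliChart ℓW C N n) :
    Continuous (fun s => twistAll ℓ₀ α N n (m s) (y s)) := by
  have key := SimplicialSpace.continuousOn_realise_family
    (fun s => (twistHom ℓ₀ N n (m s)).bar α.structureMap) (R := univ) (Or.inl isOpen_univ)
    fun p T _ _ _ t z σ ht hz hσ _ => UnitNDR.continuous_twist (Z := Kify (FrOrbit ℓW C))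
      (Z' := (varEmbSeq ℓ₀ ℓW C).free _) (contAction_free ℓ₀ ℓW C _) (hm.comp hσ) hz
      fun y => h (σ y)
  exact key.comp_continuous (f := fun s => (y s, s)) (hy.prodMk continuous_id) fun _ => mem_univ _

/-- Untwisting turns the base homotopy into paths of framings. The lift untwists the starting point,
transports it along these paths and twists the result back over the current base point. -/
theorem liftsOver_moduliChart :
    LiftsOver (moduliProjection ℓ₀ ℓW C α) (moduliChart ℓW C N n) := by
  intro K _ _ _ f F hf hF hfF hU
  have hτ : Continuous (fun z : K × ℝ => N.untwist n (Z := Kify (FrOrbit ℓW C)) (F z)) :=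
    (UnitNDR.continuousOn_untwist (contAction_kify_frOrbit ℓW C)).comp_continuous hF hU
  let η : K → C(ℝ≥0, FrOrbit ℓW C) := fun k =>
    ⟨fun r => ofKify (N.untwist n (Z := Kify (FrOrbit ℓW C)) (F (k, r))),
      continuous_ofKify.comp (hτ.comp (by fun_prop))⟩
  have hη : Continuous η := ContinuousMap.continuous_of_continuous_uncurry _
    (continuous_ofKify.comp (hτ.comp (f := fun z : K × ℝ≥0 => (z.1, (z.2 : ℝ))) (by fun_prop)))
  -- The parameter space has to be compact and to lie in the universe of the test spaces; real times
  -- are projected to the unit interval below.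
  let S : Type u := ULift.{u} (K × unitInterval)
  have hfU : ∀ k, f k ∈ moduliProjection ℓ₀ ℓW C α ⁻¹' moduliChart ℓW C N n := fun k => by
    have := hU (k, 0)
    rw [hfF] at this
    exact this
  let y : S → (varBar ℓ₀ ℓW C α).realisation := fun s => untwistAll ℓ₀ ℓW α N n (f s.down.1)
  have hk : Continuous (fun s : S => s.down.1) := by fun_prop
  have hy : Continuous y :=
    (continuousOn_untwistAll ℓ₀ α N n).comp_continuous (hf.comp hk) fun s => hfU _
  have hy0 : ∀ s : S, varFraming ℓ₀ ℓW C α (y s) = η s.down.1 0 := fun s => by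
    refine (varFraming_untwistAll ℓ₀ α N n _).trans ?_
    rw [← hfF]
    rfl
  let σ : S → ℝ≥0 := fun s => ⟨s.down.2, s.down.2.2.1⟩
  have hσ : Continuous σ := by fun_prop
  have hy' : Continuous (fun s : S => transport ℓ₀ α (η s.down.1) (σ s) (y s)) :=
    (continuousOn_transport ℓ₀ α (hη.comp hk) hσ).comp_continuous (f := fun s => (y s, s))
      (hy.prodMk continuous_id) hy0
  have hL := continuous_twistAll ℓ₀ α N n (m := fun s : S => F (s.down.1, (s.down.2 : ℝ)))
    (hF.comp (by fun_prop)) hy' fun s => hU _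
  refine ⟨fun z => twistAll ℓ₀ α N n (F (z.1, (projIcc 0 1 zero_le_one z.2 : ℝ)))
    (transport ℓ₀ α (η z.1) (σ ⟨z.1, projIcc 0 1 zero_le_one z.2⟩)
      (untwistAll ℓ₀ ℓW α N n (f z.1))), ?_, fun k => ?_, fun k s hs => ?_⟩
  · exact hL.comp (f := fun z : K × ℝ => ULift.up (z.1, projIcc 0 1 zero_le_one z.2))
      (continuous_uliftUp.comp (continuous_fst.prodMk (continuous_projIcc.comp continuous_snd)))
  · have h0 : projIcc (0 : ℝ) 1 zero_le_one 0 = 0 := projIcc_left _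
    have hσ0 : σ ⟨k, projIcc 0 1 zero_le_one 0⟩ = 0 := by
      rw [h0]
      rfl
    dsimp only
    rw [hσ0, transport_zero, h0]
    change twistAll ℓ₀ α N n (F (k, 0)) _ = _
    rw [hfF, twistAll_untwistAll]
  · dsimp only
    rw [moduliProjection_twistAll, varFraming_transport ℓ₀ α _ _ _ (hy0 ⟨k, 0⟩),
      projIcc_of_mem _ hs]
    -- After transport to time `s` the framing is the untwisted `F (k, s)`, so twisting over `F (k,
    -- s)` gives back `F (k, s)`.
    exact UnitNDR.twist_untwist _

/-! ### The section -/

variable (ℓW C) in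
/-- The equivariant map that assigns to a framing the embedding of no discs. -/
def emptyEmb (X : TopCat.{u}) (ℓ : Kify (FrOrbit ℓW C)) : (varEmbSeq ℓ₀ ℓW C).free X :=
  Quot.mk _ ⟨0, (⟨((noDiscs ℓ₀ (ofKify ℓ).1.1).1, ofKify ℓ), (noDiscs ℓ₀ (ofKify ℓ).1.1).2⟩ :
    VarEmb ℓ₀ ℓW C (Fin 0)), Fin.elim0⟩

theorem emptyEmb_smul (X : TopCat.{u}) (φ : DiffBd C) (ℓ : Kify (FrOrbit ℓW C)) :
    emptyEmb ℓ₀ ℓW C X (φ • ℓ) = φ • emptyEmb ℓ₀ ℓW C X ℓ := by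
  refine congrArg (fun s' : VarEmb ℓ₀ ℓW C (Fin 0) =>
    Quot.mk ((varEmbSeq ℓ₀ ℓW C).Rel X) (Sigma.mk 0 (s', Fin.elim0))) ?_
  exact Subtype.ext (Prod.ext (RawEmb.ext (fun j => j.elim0) (fun j => j.elim0)
    (fun j => j.elim0)) rfl)

theorem continuous_emptyEmb (X : TopCat.{u}) : Continuous (emptyEmb ℓ₀ ℓW C X) := by
  refine SymSeq.continuous_free_mk (S := varEmbSeq ℓ₀ ℓW C) ?_ continuous_const
  exact (continuous_const.prodMk continuous_ofKify).subtype_mk _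

/-- The empty configuration exists for every framing and is preserved by diffeomorphisms. It
involves no labels, so the `0`-simplices of the bar construction suffice. -/
theorem exists_section : ∃ s : ModuliSpace ℓW C → DecoratedModuliSpace ℓ₀ ℓW C α,
    Continuous s ∧ ∀ m, moduliProjection ℓ₀ ℓW C α (s m) = m := by
  refine ⟨fun m => (moduliBar ℓ₀ ℓW C α).vertex
    (homotopyQuotientMap (emptyEmb ℓ₀ ℓW C _) (emptyEmb_smul ℓ₀ _) m), ?_, fun m => ?_⟩
  · exact (SimplicialSpace.continuous_vertex _).comp
      (continuous_homotopyQuotientMap _ (continuous_emptyEmb ℓ₀ _))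
  · refine (homotopyQuotientMap_comp_eq (emptyEmb ℓ₀ ℓW C _) (emptyEmb_smul ℓ₀ _) _ _ id
      (fun _ _ => rfl) (fun _ => rfl) m).trans ?_
    exact homotopyQuotientMap_eq_self _ _ (fun _ => rfl) m

variable (ℓW C) in
theorem isHomotopyFibreSequence_moduliProjection [T2Space W]
    (hG : WellPointed (Kify (DiffBd C)) 1) :
    IsHomotopyFibreSequence (fibreInclusion ℓ₀ ℓW C α) (moduliProjection ℓ₀ ℓW C α)
      (ModuliSpace.base ℓW C) := by
  obtain ⟨N⟩ := nonempty_unitNDR hG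
  have hbase : ∀ x, moduliProjection ℓ₀ ℓW C α x = ModuliSpace.base ℓW C →
      varFraming ℓ₀ ℓW C α (untwistAll ℓ₀ ℓW α N 0 x) = FrOrbit.base ℓW C := fun x hx => by
    rw [varFraming_untwistAll, hx]
    exact UnitNDR.untwist_vertex (Z := Kify (FrOrbit ℓW C)) _
  refine isHomotopyFibreSequence_of_lifting
    -- The base point lies in the `0`-th chart, where untwisting identifies the fibre with the
    -- decorated embeddings of framing `ℓW`; on the fibre, `ρ` is inverse to the inclusion.
    (ρ := fun x => fixedRetraction ℓ₀ ℓW C α (untwistAll ℓ₀ ℓW α N 0 x))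
    (continuous_fibreInclusion ℓ₀ ℓW C α) (continuous_moduliProjection ℓ₀ ℓW C α)
    (moduliProjection_fibreInclusion ℓ₀ α) ?_ (fun z => ?_) (fun x hx => ?_) ?_
  · refine (continuousOn_fixedRetraction ℓ₀ ℓW C α).comp
      ((continuousOn_untwistAll ℓ₀ α N 0).mono ?_) hbase
    intro x hx
    rw [mem_preimage, show moduliProjection ℓ₀ ℓW C α x = _ from hx]
    exact UnitNDR.chart_vertex (Z := Kify (FrOrbit ℓW C)) _
  · rw [untwistAll_fibreInclusion, fixedRetraction_fixedInclusion]
  · rw [← twistAll_base ℓ₀ α N, fixedInclusion_fixedRetraction ℓ₀ ℓW C α _ (hbase x hx), ← hx,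
      twistAll_untwistAll]
  · intro K _ _ f F hf hF hfF
    exact exists_lift_of_cover (fun n => liftsOver_moduliChart ℓ₀ α N n)
      (fun n => isOpen_moduliChart N n)
      (fun m => UnitNDR.exists_chart (Z := Kify (FrOrbit ℓW C)) m) hf hF hfF

end Comparison

end DecoratedModuli

end

theorem mainTheorem10 {d : ℕ} (θ : TangentialStructure.{u} d) (ℓ₀ : StdFraming θ)
    {H : Type w} [TopologicalSpace H] (I : ModelWithCorners ℝ (EuclideanSpace ℝ (Fin d)) H)
    (W : Type u) [TopologicalSpace W] [T2Space W] [SecondCountableTopology W]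
    [ChartedSpace H W] [IsManifold I ∞ W]
    (ℓW : Fr θ I W) (C : Collar I W) (hG : WellPointed (Kify (DiffBd C)) 1)
    (A : Type u) [TopologicalSpace A] [CompactlyGeneratedSpace A]
    (α : (discOperad ℓ₀).Algebra A) :
    IsHomotopyFibreSequence (fibreInclusion ℓ₀ ℓW C α) (moduliProjection ℓ₀ ℓW C α)
      (ModuliSpace.base ℓW C) ∧
    ∃ s : ModuliSpace ℓW C → DecoratedModuliSpace ℓ₀ ℓW C α,
      Continuous s ∧ ∀ m, moduliProjection ℓ₀ ℓW C α (s m) = m :=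
  ⟨isHomotopyFibreSequence_moduliProjection ℓ₀ ℓW C α hG, exists_section ℓ₀ α⟩
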